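/- **Setting.** Let $H$ be a complex Hilbert space, $p\ge 1$ an integer, and fix a Dixmier trace $\mathrm{Tr}_\omega$, where $\omega$ is a positive functional on bounded sequences that extends the limit and satisfies $\omega(x_1,x_1,x_2,x_2,\dots)=\omega(x_1,x_2,\dots)$. For a selfadjoint operator $\mathcal D$ write $\langle \mathcal D\rangle=(1+\mathcal D^2)^{1/2}$, $\delta=[|\mathcal D|,\cdot\,]$, $\mathcal H_\infty=\bigcap_n \mathrm{Dom}\,\mathcal D^n$, and $\psi_\omega(w)=\mathrm{Tr}_\omega(w\langle\mathcal D\rangle^{-p})$. A *noncommutative oriented Riemannian manifold* $(\mathcal A,H,\mathcal D,\mathbf c,\Phi)$ of spectral dimension $p$ consists of a unital $*$-subalgebra $\mathcal A\subseteq B(H)$, a selfadjoint operator $\mathcal D$ with $\langle\mathcal D\rangle^{-1}$ compact, such that each $a\in\mathcal A$ preserves $\mathrm{Dom}\,\mathcal D$ and has bounded commutator $[\mathcal D,a]$, a Hochschild $p$-cycle $\mathbf c$ of $\mathcal A$ with values in $\mathcal A$, and a vector $\Phi$. Let $\mathcal C=\mathcal C_{\mathcal D}(\mathcal A)$ be the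 subalgebra of $B(H)$ generated by $\mathcal A$ and $[\mathcal D,\mathcal A]$. The following conditions are required. 1. *Regularity:* $\mathcal A$ and $[\mathcal D,\mathcal A]$ lie in the domains of all powers of $\delta$, and $\mathcal A$ is complete and separable for the seminorms $\|\delta^m a\|$, $\|\delta^m[\mathcal D,a]\|$, $m\ge 0$. 2. *Dimension:* $\langle\mathcal D\rangle^{-p}$ lies in the Dixmier ideal (the sum of its first $N$ singular values is $O(\log N)$). 3. *Finiteness and absolute continuity:* $\mathcal H_\infty$ is a finitely generated projective left $\mathcal C$-module, $\psi_\omega$ is faithful on $\mathcal C$, and there is a $\mathcal C$-valued hermitian pairing on $\mathcal H_\infty$ with $\langle\eta|\xi\rangle=\psi_\omega((\xi|\eta))$. 4. *Orientability:* $C=\pi_{\mathcal D}(\mathbf c)=\sum_\alpha a^0_\alpha[\mathcal D,a^1_\alpha]\cdots[\mathcal D,a^p_\alpha]$ satisfies $C=C^*$, $C^2=1$, $C\mathcal D=(-1)^{p-1}\mathcal DC$, and $Ca=aC$ for $a\in\mathcal A$. 5. *Riemannian condition:* $\mathcal H_\infty=\mathcal C\Phi$; $w\Phi=0$ with $w\in\mathcal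 C$ only if $w=0$; there is a $\mathcal C$-valued hermitian pairing on $\mathcal H_\infty$ with $\langle\eta|\xi\rangle=\psi_\omega((\xi|\eta))$ for which $z=(\Phi|\Phi)$ is central in $\mathcal C$ and strictly positive ($\langle x|zx\rangle>0$ for $x\neq0$); $\mathcal H_\infty$ is finitely generated projective as a left $\mathcal A$-module; there is a selfadjoint unitary $\varepsilon$ which commutes with $\mathcal A$, anticommutes with $\mathcal D$ and satisfies $\varepsilon\Phi=\Phi$; and $\|\Phi\|=1$. The algebra $\mathcal C$ is $\mathbb Z_2$-graded by $w\mapsto\varepsilon w\varepsilon$. **Proposition (noncommutative Kasparov fundamental class).** Let $(\mathcal A,H,\mathcal D,\mathbf c,\Phi)$ be a noncommutative oriented Riemannian manifold of spectral dimension $p$. There is an antiunitary operator $J$ on $H$ with $J(T\Phi)=T^*\Phi$ for all $T\in\mathcal C''$. Put $a^{\mathrm{op}}=Ja^*J$ for $a\in\mathcal A$, let $\mathcal A^{\mathrm{op}}$ also denote the algebra of these operators, and put $\widetilde{\mathcal D}=iJ\mathcal DJ\varepsilon$. Then: (a) There is an isometric $*$-homomorphism $\alpha:\mathcal C^{\mathrm{op}}\to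 B(H)$ with $\alpha(a^{\mathrm{op}})=Ja^*J$ and $\alpha([\mathcal D,a]^{\mathrm{op}})=[\widetilde{\mathcal D},a^{\mathrm{op}}]$ for $a\in\mathcal A$. Its range is the algebra $\mathcal C_{\widetilde{\mathcal D}}(\mathcal A^{\mathrm{op}})$ generated by $\mathcal A^{\mathrm{op}}$ and $[\widetilde{\mathcal D},\mathcal A^{\mathrm{op}}]$. (b) With $\mathcal C^{\mathrm{op}}$ acting through $\alpha$, the triple $(\mathcal A\otimes\mathcal C^{\mathrm{op}},H,\mathcal D)$ is a $\mathbb Z_2$-graded spectral triple with grading operator $\varepsilon$. That is: $\mathcal A$ (trivially graded) and $\mathcal C^{\mathrm{op}}$ are faithfully represented by commuting operators, compatibly with the gradings; $\mathcal D$ is selfadjoint and odd, with $\langle\mathcal D\rangle^{-1}$ compact; and all elements of $\mathcal A\otimes\mathcal C^{\mathrm{op}}$ preserve $\mathrm{Dom}\,\mathcal D$ and have bounded graded commutators with $\mathcal D$. It satisfies the graded first order condition $[[\mathcal D,a],\alpha(w)]_\pm=0$ for $a\in\mathcal A$, $w\in\mathcal C^{\mathrm{op}}$. Moreover $(\mathcal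 A\otimes\mathcal A^{\mathrm{op}},H,\mathcal D)$ is an even spectral triple with grading operator $\varepsilon$. (c) Let $A$ be the norm closure of $\mathcal A$, and let $C^{\mathrm{op}}$ be the norm closure of $\mathcal C^{\mathrm{op}}$, as a $\mathbb Z_2$-graded C*-algebra. Let $A\otimes C^{\mathrm{op}}$ be their maximal C*-tensor product. The action of $\mathcal A\otimes\mathcal C^{\mathrm{op}}$ on $H$ extends to $A\otimes C^{\mathrm{op}}$; together with the bounded operator $\mathcal D(1+\mathcal D^2)^{-1/2}$ and the grading $\varepsilon$, it forms a Kasparov $(A\otimes C^{\mathrm{op}})$-$\mathbb C$-module. Hence the triple represents a well-defined class $\lambda\in KK(A\otimes C^{\mathrm{op}},\mathbb C)$. -/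

import Mathlib

open scoped ComplexOrder ENNReal TensorProduct BoundedContinuousFunction

noncomputable section

universe u

namespace NCRiem

/-! ### Unbounded operators on a Hilbert space -/

section Unbounded

variable {H : Type u} [NormedAddCommGroup H] [InnerProductSpace ℂ H] [CompleteSpace H]

/-- `X` is the bounded extension of the commutator `[S, T]`: the bounded operator `T` preserves
the domain of `S`, and `S T - T S` agrees with `X` there. -/
def IsCommutator (S : H →ₗ.[ℂ] H) (T X : H →L[ℂ] H) : Prop :=
  ∀ x : S.domain, ∃ h : T x ∈ S.domain, S ⟨T x, h⟩ - T (S x) = X x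

/-- The bounded extension of `[S, T]` (meaningful when it exists; it is unique when `S` is densely
defined). -/
def comm (S : H →ₗ.[ℂ] H) (T : H →L[ℂ] H) : H →L[ℂ] H :=
  Classical.epsilon (IsCommutator S T)

/-- `X` is the bounded extension of the graded commutator `S T - (ε T ε) S` of an odd operator `S`
with `T`; on `ε`-even `T` it is `S T - T S`, on `ε`-odd `T` it is `S T + T S`. -/
def IsGradedCommutator (S : H →ₗ.[ℂ] H) (ε T X : H →L[ℂ] H) : Prop :=
  ∀ x : S.domain, ∃ h : T x ∈ S.domain, S ⟨T x, h⟩ - (ε * T * ε) (S x) = X x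

/-- `x ∈ Dom S²` and `S² x = y`. -/
def SqRel (S : H →ₗ.[ℂ] H) (x y : H) : Prop :=
  ∃ (h : x ∈ S.domain) (h' : S ⟨x, h⟩ ∈ S.domain), S ⟨S ⟨x, h⟩, h'⟩ = y

/-- The bounded operator `(1 + S²)⁻¹`. -/
def invOneAddSq (S : H →ₗ.[ℂ] H) : H →L[ℂ] H :=
  Classical.epsilon fun R : H →L[ℂ] H => ∀ x : H, ∃ y : H, SqRel S (R x) y ∧ R x + y = x

/-- The bounded operator `⟨S⟩⁻¹ = (1 + S²)^(-1/2)`. -/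
def regInv (S : H →ₗ.[ℂ] H) : H →L[ℂ] H :=
  CFC.sqrt (invOneAddSq S)

/-- The bounded transform `S (1 + S²)^(-1/2)`. -/
def boundedTransform (S : H →ₗ.[ℂ] H) : H →L[ℂ] H :=
  Classical.epsilon fun F : H →L[ℂ] H =>
    ∀ x : H, ∃ h : regInv S x ∈ S.domain, S ⟨regInv S x, h⟩ = F x

/-- `P` is the absolute value of `S`: the positive selfadjoint operator with `P² = S²`. -/
def IsAbs (S P : H →ₗ.[ℂ] H) : Prop :=
  IsSelfAdjoint P ∧ (∀ x : P.domain, 0 ≤ inner ℂ (x : H) (P x)) ∧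
    ∀ x y : H, SqRel P x y ↔ SqRel S x y

/-- The absolute value `|S|` of a selfadjoint operator. -/
def absOp (S : H →ₗ.[ℂ] H) : H →ₗ.[ℂ] H :=
  Classical.epsilon (IsAbs S)

/-- The domain of `Sⁿ`. -/
def powDomain (S : H →ₗ.[ℂ] H) : ℕ → Submodule ℂ H
  | 0 => ⊤
  | n + 1 => ((powDomain S n).comap S.toFun).map S.domain.subtype

/-- The smooth domain `H_∞ = ⋂ₙ Dom Sⁿ`. -/
def smoothDomain (S : H →ₗ.[ℂ] H) : Submodule ℂ H :=
  ⨅ n, powDomain S n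

/-- `T` lies in the domain of the `n`-th power of the derivation `[S, ·]` of `B(H)`. -/
def InDomPow (S : H →ₗ.[ℂ] H) : ℕ → (H →L[ℂ] H) → Prop
  | 0, _ => True
  | n + 1, T => (∃ X, IsCommutator S T X) ∧ InDomPow S n (comm S T)

end Unbounded

/-! ### Singular values and Dixmier traces -/

section Dixmier

variable {H : Type u} [NormedAddCommGroup H] [InnerProductSpace ℂ H] [CompleteSpace H]

/-- The `n`-th singular value (`n = 0, 1, 2, …`) as an approximation number: the distance of `T` to
the operators of rank at most `n`. -/
def singularValue (T : H →L[ℂ] H) (n : ℕ) : ℝ :=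
  sInf {r | ∃ R : H →L[ℂ] H, FiniteDimensional ℂ R.range ∧
    Module.finrank ℂ R.range ≤ n ∧ ‖T - R‖ = r}

/-- `N ↦ (1 / log (1 + N)) ∑_{k < N} μ_k(T)` for `N = 1, 2, …`, indexed by `n = N - 1`. -/
def dixmierSeq (T : H →L[ℂ] H) (n : ℕ) : ℝ :=
  (∑ k ∈ Finset.range (n + 1), singularValue T k) / Real.log (n + 2)

/-- The Dixmier ideal `L^{1,∞}`: operators whose `N`-th partial sum of singular values is
`O(log N)`. -/
def InDixmierIdeal (T : H →L[ℂ] H) : Prop :=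
  ∃ C : ℝ, ∀ n, ‖dixmierSeq T n‖ ≤ C

/-- A Dixmier limit: a positive linear functional on bounded sequences which extends the ordinary
limit and satisfies `ω(x₁, x₁, x₂, x₂, …) = ω(x₁, x₂, …)`. -/
structure DixmierLimit where
  toFun : (ℕ →ᵇ ℝ) →ₗ[ℝ] ℝ
  nonneg : ∀ x : ℕ →ᵇ ℝ, (∀ n, 0 ≤ x n) → 0 ≤ toFun x
  lim : ∀ (x : ℕ →ᵇ ℝ) (l : ℝ), Filter.Tendsto x Filter.atTop (nhds l) → toFun x = l
  dilation : ∀ x : ℕ →ᵇ ℝ,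
    toFun (x.compContinuous ⟨fun n => n / 2, continuous_of_discreteTopology⟩) = toFun x

open Classical in
/-- The Dixmier trace of a positive operator of the Dixmier ideal. -/
def dixmierTracePos (ω : DixmierLimit) (T : H →L[ℂ] H) : ℝ :=
  if h : InDixmierIdeal T then
    ω.toFun (BoundedContinuousFunction.ofNormedAddCommGroupDiscrete (dixmierSeq T)
      h.choose h.choose_spec)
  else 0

/-- The Dixmier trace `Tr_ω`, extended from the positive cone of the Dixmier ideal through the
positive and negative parts of the real and imaginary parts. -/
def dixmierTrace (ω : DixmierLimit) (T : H →L[ℂ] H) : ℂ :=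
  ((dixmierTracePos ω ((realPart T : H →L[ℂ] H)⁺) : ℂ)
      - (dixmierTracePos ω ((realPart T : H →L[ℂ] H)⁻) : ℂ))
    + Complex.I * ((dixmierTracePos ω ((imaginaryPart T : H →L[ℂ] H)⁺) : ℂ)
      - (dixmierTracePos ω ((imaginaryPart T : H →L[ℂ] H)⁻) : ℂ))

/-- The functional `ψ_ω(w) = Tr_ω(w ⟨D⟩^{-p})`. -/
def dixmierFunctional (ω : DixmierLimit) (D : H →ₗ.[ℂ] H) (p : ℕ) (w : H →L[ℂ] H) : ℂ :=
  dixmierTrace ω (w * regInv D ^ p)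

end Dixmier

/-! ### Clifford algebra, smooth topology, Hochschild cycles, hermitian pairings -/

section Triple

variable {H : Type u} [NormedAddCommGroup H] [InnerProductSpace ℂ H] [CompleteSpace H]

/-- The algebra `C_D(A)` generated by `A` and the (bounded) commutators `[D, a]`, `a ∈ A`. The set
of generators is stable under the involution, as `[D, a]* = -[D, a*]`. -/
def cliffordAlg (A : StarSubalgebra ℂ (H →L[ℂ] H)) (D : H →ₗ.[ℂ] H) :
    StarSubalgebra ℂ (H →L[ℂ] H) :=
  StarAlgebra.adjoin ℂ ((A : Set (H →L[ℂ] H)) ∪ {X | ∃ a ∈ A, IsCommutator D a X})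

/-- The seminorms `q_m(T) = ‖δ^m T‖`, where `δ = [|D|, ·]`. -/
def qNorm (D : H →ₗ.[ℂ] H) (m : ℕ) (T : H →L[ℂ] H) : ℝ :=
  ‖(comm (absOp D))^[m] T‖

/-- The seminorms `q'_m(T) = ‖δ^m [D, T]‖`, where `δ = [|D|, ·]`. -/
def qNorm' (D : H →ₗ.[ℂ] H) (m : ℕ) (T : H →L[ℂ] H) : ℝ :=
  ‖(comm (absOp D))^[m] (comm D T)‖

/-- `A` is complete in the (metrizable) topology of the seminorms `q_m`, `q'_m`. -/
def SmoothComplete (A : StarSubalgebra ℂ (H →L[ℂ] H)) (D : H →ₗ.[ℂ] H) : Prop :=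
  ∀ s : ℕ → H →L[ℂ] H, (∀ i, s i ∈ A) →
    (∀ m : ℕ, ∀ r > (0 : ℝ), ∃ N, ∀ i ≥ N, ∀ j ≥ N,
      qNorm D m (s i - s j) < r ∧ qNorm' D m (s i - s j) < r) →
    ∃ a ∈ A, ∀ m : ℕ, ∀ r > (0 : ℝ), ∃ N, ∀ i ≥ N,
      qNorm D m (s i - a) < r ∧ qNorm' D m (s i - a) < r

/-- `A` is separable in the topology of the seminorms `q_m`, `q'_m`. -/
def SmoothSeparable (A : StarSubalgebra ℂ (H →L[ℂ] H)) (D : H →ₗ.[ℂ] H) : Prop :=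
  ∃ S : Set (H →L[ℂ] H), S.Countable ∧ S ⊆ A ∧
    ∀ a ∈ A, ∀ m : ℕ, ∀ r > (0 : ℝ), ∃ s ∈ S, ∀ k ≤ m,
      qNorm D k (a - s) < r ∧ qNorm' D k (a - s) < r

/-- The subspace `V` of `H` is invariant under `S` and is a finitely generated projective left
`S`-module. -/
def IsFiniteProjective (S : StarSubalgebra ℂ (H →L[ℂ] H)) (V : Submodule ℂ H) : Prop :=
  ∃ W : Submodule S H, (W : Set H) = V ∧ Module.Finite S W ∧ Module.Projective S W

/-- A left hermitian pairing on a left `S`-module `V ⊆ H`, with values in `S`: linear over `S` in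
the first variable, hermitian, positive definite. -/
structure IsHermitianPairing (S : StarSubalgebra ℂ (H →L[ℂ] H)) (V : Submodule ℂ H)
    (P : V → V → H →L[ℂ] H) : Prop where
  mem : ∀ x y, P x y ∈ S
  add_left : ∀ x x' y, P (x + x') y = P x y + P x' y
  smul_left : ∀ u ∈ S, ∀ x x' y : V, (x' : H) = u x → P x' y = u * P x y
  star : ∀ x y, star (P x y) = P y x
  nonneg : ∀ x, 0 ≤ P x x
  definite : ∀ x, P x x = 0 → x = 0

/-- The Hochschild boundary
`b(a₀ ⊗ ⋯ ⊗ a_p) = ∑_{i < p} (-1)^i a₀ ⊗ ⋯ ⊗ a_i a_{i+1} ⊗ ⋯ ⊗ a_p + (-1)^p a_p a₀ ⊗ a₁ ⊗ ⋯ ⊗ a_{p-1}`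
of an elementary tensor. -/
def hochschildBoundary {A : Type u} [Ring A] [Algebra ℂ A] {p : ℕ} (a : Fin (p + 1) → A) :
    PiTensorProduct ℂ (fun _ : Fin p => A) :=
  (∑ i : Fin p, ((-1 : ℂ) ^ (i : ℕ)) •
      PiTensorProduct.tprod ℂ (Fin.contractNth i.castSucc (· * ·) a))
    + ((-1 : ℂ) ^ p) • PiTensorProduct.tprod ℂ
        (fun k : Fin p => if (k : ℕ) = 0 then a (Fin.last p) * a 0 else a k.castSucc)

/-- A Hochschild `p`-cycle `∑_α a_α⁰ ⊗ ⋯ ⊗ a_α^p` of `A` with coefficients in `A`. -/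
structure HochschildCycle (A : Type u) [Ring A] [Algebra ℂ A] (p : ℕ) where
  n : ℕ
  a : Fin n → Fin (p + 1) → A
  cycle : ∑ α, hochschildBoundary (a α) = 0

/-- `π_D(c) = ∑_α a_α⁰ [D, a_α¹] ⋯ [D, a_α^p]`. -/
def HochschildCycle.rep {A : StarSubalgebra ℂ (H →L[ℂ] H)} {p : ℕ} (c : HochschildCycle A p)
    (D : H →ₗ.[ℂ] H) : H →L[ℂ] H :=
  ∑ α, (c.a α 0 : H →L[ℂ] H) *
    (List.ofFn fun i : Fin p => comm D (c.a α i.succ : H →L[ℂ] H)).prod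

/-- `ε` is a selfadjoint unitary anticommuting with `D`. -/
structure IsGrading (ε : H →L[ℂ] H) (D : H →ₗ.[ℂ] H) : Prop where
  star_eq : star ε = ε
  mul_self : ε * ε = 1
  anticomm : ∀ x : D.domain, ∃ h : ε x ∈ D.domain, D ⟨ε x, h⟩ = -ε (D x)

end Triple

/-! ### Noncommutative oriented Riemannian manifolds -/

/-- A noncommutative oriented Riemannian manifold `(A, H, D, c, Φ)` of spectral dimension `p`, with
its grading operator `ε`; the Dixmier limit `ω` is fixed. -/
structure NCRiemannianManifold (ω : DixmierLimit) (p : ℕ) (H : Type u) [NormedAddCommGroup H]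
    [InnerProductSpace ℂ H] [CompleteSpace H] where
  /-- the algebra, as a unital `*`-subalgebra of `B(H)` -/
  A : StarSubalgebra ℂ (H →L[ℂ] H)
  D : H →ₗ.[ℂ] H
  /-- the orientation cycle -/
  c : HochschildCycle A p
  Φ : H
  ε : H →L[ℂ] H
  -- spectral triple
  selfAdjoint : IsSelfAdjoint D
  compact : IsCompactOperator (regInv D)
  bounded_comm : ∀ a ∈ A, ∃ X, IsCommutator D a X
  -- regularity, with the standing assumptions on the topology of `A`
  regular : ∀ a ∈ A, ∀ n, InDomPow (absOp D) n a ∧ InDomPow (absOp D) n (comm D a)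
  complete : SmoothComplete A D
  separable : SmoothSeparable A D
  -- dimension
  dim_pos : 0 < p
  summable : InDixmierIdeal (regInv D ^ p)
  -- finiteness and absolute continuity
  finite : IsFiniteProjective (cliffordAlg A D) (smoothDomain D)
  faithful : ∀ w ∈ cliffordAlg A D, dixmierFunctional ω D p (star w * w) = 0 → w = 0
  abs_cont : ∃ P : smoothDomain D → smoothDomain D → H →L[ℂ] H,
    IsHermitianPairing (cliffordAlg A D) (smoothDomain D) P ∧
    ∀ x y : smoothDomain D, inner ℂ (y : H) (x : H) = dixmierFunctional ω D p (P x y)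
  -- orientability
  orient_star : star (c.rep D) = c.rep D
  orient_sq : c.rep D * c.rep D = 1
  orient_D : ∀ x : D.domain, ∃ h : c.rep D x ∈ D.domain,
    c.rep D (D x) = (-1 : ℂ) ^ (p - 1) • D ⟨c.rep D x, h⟩
  orient_A : ∀ a ∈ A, c.rep D * a = a * c.rep D
  -- the Riemannian condition
  cyclic : (smoothDomain D : Set H) = {x | ∃ w ∈ cliffordAlg A D, x = w Φ}
  separating : ∀ w ∈ cliffordAlg A D, w Φ = 0 → w = 0
  pairing : ∃ (P : smoothDomain D → smoothDomain D → H →L[ℂ] H) (h : Φ ∈ smoothDomain D),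
    IsHermitianPairing (cliffordAlg A D) (smoothDomain D) P ∧
    (∀ x y : smoothDomain D, inner ℂ (y : H) (x : H) = dixmierFunctional ω D p (P x y)) ∧
    (∀ w ∈ cliffordAlg A D, P ⟨Φ, h⟩ ⟨Φ, h⟩ * w = w * P ⟨Φ, h⟩ ⟨Φ, h⟩) ∧
    ∀ x : H, x ≠ 0 → 0 < inner ℂ x (P ⟨Φ, h⟩ ⟨Φ, h⟩ x)
  finite_A : IsFiniteProjective A (smoothDomain D)
  grading : IsGrading ε D
  grading_A : ∀ a ∈ A, ε * a = a * ε
  grading_Φ : ε Φ = Φ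
  norm_Φ : ‖Φ‖ = 1

/-! ### Graded spectral triples over tensor products -/

section GradedTriple

variable {H : Type u} [NormedAddCommGroup H] [InnerProductSpace ℂ H] [CompleteSpace H]
variable {𝔄 𝔅 : Type u} [Ring 𝔄] [StarRing 𝔄] [Algebra ℂ 𝔄] [Ring 𝔅] [StarRing 𝔅] [Algebra ℂ 𝔅]

/-- The action `a ⊗ b ↦ ρ(a) σ(b)` of the algebraic tensor product. -/
def tensorAction (ρ : 𝔄 →⋆ₐ[ℂ] (H →L[ℂ] H)) (σ : 𝔅 →⋆ₐ[ℂ] (H →L[ℂ] H)) :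
    𝔄 ⊗[ℂ] 𝔅 →ₗ[ℂ] (H →L[ℂ] H) :=
  (LinearMap.mul' ℂ (H →L[ℂ] H)).comp
    (TensorProduct.map ρ.toAlgHom.toLinearMap σ.toAlgHom.toLinearMap)

/-- `(𝔄 ⊗ 𝔅, H, D)`, with the action of `𝔄` by `ρ` and of `𝔅` by `σ`, is a `ℤ/2`-graded spectral
triple with grading operator `ε`; here `𝔄` is trivially graded and `𝔅` is graded by the
automorphism `γ`. -/
structure IsGradedSpectralTriple (ρ : 𝔄 →⋆ₐ[ℂ] (H →L[ℂ] H)) (σ : 𝔅 →⋆ₐ[ℂ] (H →L[ℂ] H))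
    (γ : 𝔅 → 𝔅) (D : H →ₗ.[ℂ] H) (ε : H →L[ℂ] H) : Prop where
  faithful_left : Function.Injective ρ
  faithful_right : Function.Injective σ
  commute : ∀ a b, ρ a * σ b = σ b * ρ a
  selfAdjoint : IsSelfAdjoint D
  compact : IsCompactOperator (regInv D)
  grading : IsGrading ε D
  even_left : ∀ a, ε * ρ a * ε = ρ a
  graded_right : ∀ b, ε * σ b * ε = σ (γ b)
  bounded_comm : ∀ y : 𝔄 ⊗[ℂ] 𝔅, ∃ X, IsGradedCommutator D ε (tensorAction ρ σ y) X

/-- The (graded) first order condition `[[D, a], b]_± = 0`, where `[D, a]` is odd. -/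
def FirstOrder (ρ : 𝔄 →⋆ₐ[ℂ] (H →L[ℂ] H)) (σ : 𝔅 →⋆ₐ[ℂ] (H →L[ℂ] H))
    (γ : 𝔅 → 𝔅) (D : H →ₗ.[ℂ] H) : Prop :=
  ∀ a b, comm D (ρ a) * σ b - σ (γ b) * comm D (ρ a) = 0

end GradedTriple

/-! ### Norm closures of `*`-subalgebras of C*-algebras -/

section Closure

variable {U : Type*} [CStarAlgebra U]

/-- The norm closure of a `*`-subalgebra of a C*-algebra, as a C*-algebra. -/
def Closure (S : StarSubalgebra ℂ U) : Type _ := S.topologicalClosure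

instance (S : StarSubalgebra ℂ U) : CStarAlgebra (Closure S) :=
  haveI : IsClosed (S.topologicalClosure : Set U) := S.isClosed_topologicalClosure
  inferInstanceAs (CStarAlgebra S.topologicalClosure)

/-- The inclusion of the closure in the ambient algebra. -/
def Closure.val (S : StarSubalgebra ℂ U) : Closure S →⋆ₐ[ℂ] U :=
  S.topologicalClosure.subtype

/-- A `*`-homomorphism with values in the closure. -/
def Closure.lift {V : Type*} [Ring V] [StarRing V] [Algebra ℂ V] (S : StarSubalgebra ℂ U)
    (f : V →⋆ₐ[ℂ] U) (h : ∀ x, f x ∈ S.topologicalClosure) : V →⋆ₐ[ℂ] Closure S :=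
  f.codRestrict S.topologicalClosure h

/-- The inclusion of a `*`-subalgebra in its closure. -/
def Closure.incl (S : StarSubalgebra ℂ U) : S →⋆ₐ[ℂ] Closure S :=
  Closure.lift S S.subtype fun x => S.le_topologicalClosure x.2

/-- A `*`-endomorphism which preserves a `*`-subalgebra, restricted to its norm closure. -/
def Closure.restrict (S : StarSubalgebra ℂ U) (f : U →⋆ₐ[ℂ] U)
    (h : S.map f ≤ S) : Closure S →⋆ₐ[ℂ] Closure S :=
  Closure.lift S (f.comp (Closure.val S)) fun x =>
    StarSubalgebra.topologicalClosure_mono h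
      (StarSubalgebra.map_topologicalClosure_le S f
        (AddMonoidHomClass.continuous_of_bound f 1 fun y => by
          simpa using NonUnitalStarAlgHom.norm_apply_le f y) ⟨Closure.val S x, x.2, rfl⟩)

/-- The `*`-algebra generated by the ranges of two `*`-homomorphisms. -/
def genBy {A B : Type*} [CStarAlgebra A] [CStarAlgebra B] (f : A →⋆ₐ[ℂ] U) (g : B →⋆ₐ[ℂ] U) :
    StarSubalgebra ℂ U :=
  StarAlgebra.adjoin ℂ (Set.range f ∪ Set.range g)

theorem left_mem_genBy {A B : Type*} [CStarAlgebra A] [CStarAlgebra B] (f : A →⋆ₐ[ℂ] U)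
    (g : B →⋆ₐ[ℂ] U) (a : A) : f a ∈ genBy f g :=
  StarAlgebra.subset_adjoin ℂ _ (Or.inl ⟨a, rfl⟩)

theorem right_mem_genBy {A B : Type*} [CStarAlgebra A] [CStarAlgebra B] (f : A →⋆ₐ[ℂ] U)
    (g : B →⋆ₐ[ℂ] U) (b : B) : g b ∈ genBy f g :=
  StarAlgebra.subset_adjoin ℂ _ (Or.inr ⟨b, rfl⟩)

theorem genBy_map_le {A B : Type*} [CStarAlgebra A] [CStarAlgebra B] (f : A →⋆ₐ[ℂ] U)
    (g : B →⋆ₐ[ℂ] U) (t : U →⋆ₐ[ℂ] U) (hf : ∀ a, t (f a) ∈ genBy f g)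
    (hg : ∀ b, t (g b) ∈ genBy f g) : (genBy f g).map t ≤ genBy f g := by
  conv_lhs => rw [genBy, StarAlgHom.map_adjoin]
  refine StarAlgebra.adjoin_le ?_
  rintro _ ⟨_, ⟨a, rfl⟩ | ⟨b, rfl⟩, rfl⟩
  · exact hf a
  · exact hg b

theorem le_closure (S : StarSubalgebra ℂ U) {x : U} (h : x ∈ S) : x ∈ S.topologicalClosure :=
  S.le_topologicalClosure h

end Closure

/-! ### The maximal C*-tensor product -/

section MaxTensor

/-- A pair of commuting unital representations of `A` and `B` on a nonzero Hilbert space. -/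
structure CommutingRep (A B : Type u) [CStarAlgebra A] [CStarAlgebra B] : Type (u + 1) where
  K : Type u
  [nacg : NormedAddCommGroup K]
  [ips : InnerProductSpace ℂ K]
  [complete : CompleteSpace K]
  [nontriv : Nontrivial K]
  left : A →⋆ₐ[ℂ] (K →L[ℂ] K)
  right : B →⋆ₐ[ℂ] (K →L[ℂ] K)
  comm : ∀ a b, left a * right b = right b * left a

attribute [instance] CommutingRep.nacg CommutingRep.ips CommutingRep.complete CommutingRep.nontriv

variable (A B : Type u) [CStarAlgebra A] [CStarAlgebra B]

/-- The bounded families of operators indexed by all commuting pairs of representations. -/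
def RepProduct : Type (u + 1) := lp (fun r : CommutingRep A B => r.K →L[ℂ] r.K) ∞

instance lpCStarAlgebra : CStarAlgebra (lp (fun r : CommutingRep A B => r.K →L[ℂ] r.K) ∞) where

instance : CStarAlgebra (RepProduct A B) := lpCStarAlgebra A B

variable {A B}

theorem bddAbove_rep {C : Type u} [CStarAlgebra C]
    (π : ∀ r : CommutingRep A B, C →⋆ₐ[ℂ] (r.K →L[ℂ] r.K)) (c : C) :
    Memℓp (fun r => π r c) ∞ :=
  memℓp_infty ⟨‖c‖, by
    rintro _ ⟨r, rfl⟩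
    exact NonUnitalStarAlgHom.norm_apply_le (π r) c⟩

/-- The diagonal map of a family of representations. -/
def diagRep {C : Type u} [CStarAlgebra C]
    (π : ∀ r : CommutingRep A B, C →⋆ₐ[ℂ] (r.K →L[ℂ] r.K)) : C →⋆ₐ[ℂ] RepProduct A B where
  toFun c := ⟨fun r => π r c, bddAbove_rep π c⟩
  map_one' := Subtype.ext (funext fun r => map_one (π r))
  map_mul' x y := Subtype.ext (funext fun r => map_mul (π r) x y)
  map_zero' := Subtype.ext (funext fun r => map_zero (π r))
  map_add' x y := Subtype.ext (funext fun r => map_add (π r) x y)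
  commutes' z := Subtype.ext (funext fun r => (π r).commutes z)
  map_star' x := Subtype.ext (funext fun r => map_star (π r) x)

/-- `A` in the universal commuting pair of representations. -/
def univLeft : A →⋆ₐ[ℂ] RepProduct A B := diagRep fun r => r.left

/-- `B` in the universal commuting pair of representations. -/
def univRight : B →⋆ₐ[ℂ] RepProduct A B := diagRep fun r => r.right

variable (A B)

/-- The algebra generated by `A` and `B` in the universal commuting pair of representations, that
is, the image of the algebraic tensor product `A ⊙ B`. -/
def algTensor : StarSubalgebra ℂ (RepProduct A B) :=
  genBy univLeft univRight

/-- The maximal C*-tensor product: the completion of `A ⊙ B` in the largest C*-norm, which is the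
supremum of the norms given by all pairs of commuting representations. -/
abbrev MaxTensor : Type (u + 1) := Closure (algTensor A B)

variable {A B}

/-- `a ↦ a ⊗ 1`. -/
def inl : A →⋆ₐ[ℂ] MaxTensor A B :=
  Closure.lift (algTensor A B) univLeft fun a =>
    le_closure _ (left_mem_genBy univLeft univRight a)

/-- `b ↦ 1 ⊗ b`. -/
def inr : B →⋆ₐ[ℂ] MaxTensor A B :=
  Closure.lift (algTensor A B) univRight fun b =>
    le_closure _ (right_mem_genBy univLeft univRight b)

/-- Twisting a commuting pair of representations by an endomorphism of `B`. -/
def CommutingRep.twist (r : CommutingRep A B) (γ : B →⋆ₐ[ℂ] B) : CommutingRep A B where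
  K := r.K
  left := r.left
  right := r.right.comp γ
  comm a b := r.comm a (γ b)

/-- The endomorphism of the product induced by twisting. -/
def twistProduct (γ : B →⋆ₐ[ℂ] B) : RepProduct A B →⋆ₐ[ℂ] RepProduct A B where
  toFun x := ⟨fun r => x.1 (r.twist γ), memℓp_infty ⟨‖x‖, by
    rintro _ ⟨r, rfl⟩
    exact lp.norm_apply_le_norm ENNReal.top_ne_zero x (r.twist γ)⟩⟩
  map_one' := rfl
  map_mul' _ _ := rfl
  map_zero' := rfl
  map_add' _ _ := rfl
  commutes' _ := rfl
  map_star' _ := rfl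

/-- The endomorphism `1 ⊗ γ` of the maximal tensor product, that is, the grading automorphism when
`A` is trivially graded and `γ` is the grading automorphism of `B`. -/
def MaxTensor.grade (γ : B →⋆ₐ[ℂ] B) : MaxTensor A B →⋆ₐ[ℂ] MaxTensor A B :=
  Closure.restrict (algTensor A B) (twistProduct γ)
    (genBy_map_le univLeft univRight (twistProduct γ)
      (fun a => left_mem_genBy univLeft univRight a)
      (fun b => right_mem_genBy univLeft univRight (γ b)))

end MaxTensor

/-! ### Kasparov modules and `KK(X, ℂ)` -/

section KK

/-- The compact operators `K_B(E)` on a Hilbert `B`-module: the closed span of the rank one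
operators `g ↦ ⟨f, g⟩ e`. -/
def compactOps (B E : Type*) [CStarAlgebra B] [PartialOrder B] [NormedAddCommGroup E]
    [NormedSpace ℂ E] [SMul B E] [CStarModule B E] : Set (E →L[ℂ] E) :=
  closure (Submodule.span ℂ {T : E →L[ℂ] E | ∃ e f : E, ∀ g, T g = inner B f g • e})

/-- `(E, π, F)` with grading operator `ε` is a Kasparov `X`-`B`-module, for a C*-algebra `X` graded
by the automorphism `γ` and a trivially graded commutative C*-algebra `B`. For `F` odd, the graded
commutator of `F` and `π(x)` is `F π(x) - π(γ x) F`. -/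
structure IsKasparovModule {X : Type*} [CStarAlgebra X] (γ : X →⋆ₐ[ℂ] X) (B E : Type*)
    [CommCStarAlgebra B] [PartialOrder B] [NormedAddCommGroup E] [NormedSpace ℂ E]
    [CompleteSpace E] [SMul B E] [CStarModule B E]
    (ε : E →L[ℂ] E) (π : X →ₙₐ[ℂ] (E →L[ℂ] E)) (F : E →L[ℂ] E) : Prop where
  countably_generated : ∃ S : Set E, S.Countable ∧
    Dense (Submodule.span ℂ {e : E | ∃ b : B, ∃ s ∈ S, e = b • s} : Set E)
  grading_sq : ε * ε = 1
  grading_adj : ∀ e f : E, inner B (ε e) f = inner B e (ε f)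
  rep_adj : ∀ (x : X) (e f : E), inner B (π x e) f = inner B e (π (star x) f)
  rep_graded : ∀ x : X, ε * π x * ε = π (γ x)
  odd : ε * F = -(F * ε)
  comm_compact : ∀ x : X, F * π x - π (γ x) * F ∈ compactOps B E
  sq_compact : ∀ x : X, (F * F - 1) * π x ∈ compactOps B E
  adj_compact : ∃ F' : E →L[ℂ] E, (∀ e f : E, inner B (F e) f = inner B e (F' f)) ∧
    ∀ x : X, (F - F') * π x ∈ compactOps B E

/-- Kasparov `X`-`ℂ`-modules (Hilbert `ℂ`-modules being Hilbert spaces). -/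
structure KasparovModule (X : Type*) [CStarAlgebra X] (γ : X →⋆ₐ[ℂ] X) where
  E : Type u
  [nacg : NormedAddCommGroup E]
  [ips : InnerProductSpace ℂ E]
  [complete : CompleteSpace E]
  ε : E →L[ℂ] E
  π : X →ₙₐ[ℂ] (E →L[ℂ] E)
  F : E →L[ℂ] E
  isKasparov : IsKasparovModule γ ℂ E ε π F

attribute [instance] KasparovModule.nacg KasparovModule.ips KasparovModule.complete

/-- A homotopy between two Kasparov `X`-`ℂ`-modules: a Kasparov `X`-`C([0,1])`-module whose
localisation at `t ∈ {0, 1}` is unitarily equivalent to the given module; the equivalence of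
`E ⊗_{ev_t} ℂ` with `E_t` is given by the map `e ↦ e ⊗ 1`, which has dense range. -/
structure KasparovHomotopy {X : Type*} [CStarAlgebra X] {γ : X →⋆ₐ[ℂ] X}
    (M₀ M₁ : KasparovModule.{u} X γ) where
  E : Type u
  [nacg : NormedAddCommGroup E]
  [nspace : NormedSpace ℂ E]
  [complete : CompleteSpace E]
  [smul : SMul C(unitInterval, ℂ) E]
  [cstar : CStarModule C(unitInterval, ℂ) E]
  ε : E →L[ℂ] E
  π : X →ₙₐ[ℂ] (E →L[ℂ] E)
  F : E →L[ℂ] E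
  isKasparov : IsKasparovModule γ C(unitInterval, ℂ) E ε π F
  ev₀ : E →L[ℂ] M₀.E
  ev₁ : E →L[ℂ] M₁.E
  dense₀ : DenseRange ev₀
  dense₁ : DenseRange ev₁
  inner₀ : ∀ e f, inner ℂ (ev₀ e) (ev₀ f) = (inner C(unitInterval, ℂ) e f) 0
  inner₁ : ∀ e f, inner ℂ (ev₁ e) (ev₁ f) = (inner C(unitInterval, ℂ) e f) 1
  ε₀ : ∀ e, ev₀ (ε e) = M₀.ε (ev₀ e)
  ε₁ : ∀ e, ev₁ (ε e) = M₁.ε (ev₁ e)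
  π₀ : ∀ x e, ev₀ (π x e) = M₀.π x (ev₀ e)
  π₁ : ∀ x e, ev₁ (π x e) = M₁.π x (ev₁ e)
  F₀ : ∀ e, ev₀ (F e) = M₀.F (ev₀ e)
  F₁ : ∀ e, ev₁ (F e) = M₁.F (ev₁ e)

/-- (The underlying set of) `KK(X, ℂ)`: Kasparov modules up to homotopy. -/
def KK (X : Type*) [CStarAlgebra X] (γ : X →⋆ₐ[ℂ] X) :=
  Quot fun M₀ M₁ : KasparovModule.{u} X γ => Nonempty (KasparovHomotopy M₀ M₁)

/-- `lam ∈ KK(A ⊗ B, ℂ)` is the class of the graded spectral triple `(𝔄 ⊗ 𝔅, H, D)`, where `𝔄` and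
`𝔅` are mapped to the C*-algebras `A` and `B` by `i` and `j`: the action of `𝔄 ⊗ 𝔅` extends to
`A ⊗ B`, the bounded transform of `D` gives a Kasparov module, and `lam` is its class. -/
def IsClassOf {H : Type u} [NormedAddCommGroup H] [InnerProductSpace ℂ H] [CompleteSpace H]
    {𝔄 𝔅 A B : Type u} [CStarAlgebra A] [CStarAlgebra B] (γ : B →⋆ₐ[ℂ] B)
    (i : 𝔄 → A) (j : 𝔅 → B) (ρ : 𝔄 → H →L[ℂ] H) (σ : 𝔅 → H →L[ℂ] H)
    (D : H →ₗ.[ℂ] H) (ε : H →L[ℂ] H)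
    (lam : KK.{u} (MaxTensor A B) (MaxTensor.grade γ)) : Prop :=
  ∃ π : MaxTensor A B →ₙₐ[ℂ] (H →L[ℂ] H),
    (∀ a, π (inl (i a)) = ρ a) ∧ (∀ b, π (inr (j b)) = σ b) ∧
    ∃ h : IsKasparovModule (MaxTensor.grade γ) ℂ H ε π (boundedTransform D),
      lam = Quot.mk _ ⟨H, ε, π, boundedTransform D, h⟩

end KK

/-! ### The right action and the twisted operator -/

section RightAction

variable {H : Type u} [NormedAddCommGroup H] [InnerProductSpace ℂ H] [CompleteSpace H]

/-- `T^op = J T* J`. -/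
def rightOp (J : H ≃ₗᵢ⋆[ℂ] H) (T : H →L[ℂ] H) : H →L[ℂ] H :=
  (J : H →L⋆[ℂ] H).comp ((star T).comp (J : H →L⋆[ℂ] H))

/-- `D' = J D J`. -/
def rightDirac (J : H ≃ₗᵢ⋆[ℂ] H) (D : H →ₗ.[ℂ] H) : H →ₗ.[ℂ] H where
  domain := D.domain.comap (J.toLinearEquiv : H →ₗ⋆[ℂ] H)
  toFun :=
    { toFun := fun x => J (D ⟨J x, x.2⟩)
      map_add' := fun x y => by
        rw [← map_add, ← LinearPMap.map_add]
        congr 2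
        exact Subtype.ext (map_add J (x : H) y)
      map_smul' := fun z x => by
        have h : (⟨J ((z • x : _) : H), (z • x).2⟩ : D.domain)
            = (starRingEnd ℂ z) • ⟨J (x : H), x.2⟩ :=
          Subtype.ext (map_smulₛₗ J z (x : H))
        rw [h, LinearPMap.map_smul, map_smulₛₗ]
        simp }

/-- The twisted operator `i D' ε = i J D J ε`. -/
def twistedDirac (J : H ≃ₗᵢ⋆[ℂ] H) (D : H →ₗ.[ℂ] H) (ε : H →L[ℂ] H) : H →ₗ.[ℂ] H where
  domain := (rightDirac J D).domain.comap (ε : H →ₗ[ℂ] H)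
  toFun :=
    { toFun := fun x => Complex.I • rightDirac J D ⟨ε x, x.2⟩
      map_add' := fun x y => by
        rw [← smul_add, ← LinearPMap.map_add]
        congr 2
        exact Subtype.ext (map_add ε (x : H) y)
      map_smul' := fun z x => by
        have h : (⟨ε ((z • x : _) : H), (z • x).2⟩ : (rightDirac J D).domain)
            = z • ⟨ε (x : H), x.2⟩ :=
          Subtype.ext (map_smul ε z (x : H))
        rw [h, LinearPMap.map_smul, smul_comm]
        simp }

end RightAction

/-! ### The graded algebras attached to a noncommutative Riemannian manifold -/

section Gradings

/-- The opposite of a `*`-homomorphism. -/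
def opHom {C C' : Type*} [Ring C] [StarRing C] [Algebra ℂ C] [Ring C'] [StarRing C'] [Algebra ℂ C']
    (f : C →⋆ₐ[ℂ] C') : Cᵐᵒᵖ →⋆ₐ[ℂ] C'ᵐᵒᵖ :=
  { AlgHom.op f.toAlgHom with
    map_star' := fun x => MulOpposite.unop_injective (map_star f x.unop) }

variable {H : Type u} [NormedAddCommGroup H] [InnerProductSpace ℂ H] [CompleteSpace H]

/-- The automorphism `T ↦ ε T ε` of `B(H)`. -/
def conjHom {D : H →ₗ.[ℂ] H} {ε : H →L[ℂ] H} (hε : IsGrading ε D) :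
    (H →L[ℂ] H) →⋆ₐ[ℂ] (H →L[ℂ] H) where
  toFun T := ε * T * ε
  map_one' := by rw [mul_one, hε.mul_self]
  map_mul' S T := by
    rw [show ε * S * ε * (ε * T * ε) = ε * S * (ε * ε) * T * ε by simp only [mul_assoc],
      hε.mul_self]
    simp only [mul_assoc, one_mul]
  map_zero' := by simp
  map_add' S T := by rw [mul_add, add_mul]
  commutes' z := by
    rw [← Algebra.commutes, mul_assoc, hε.mul_self, mul_one]
  map_star' T := by rw [star_mul, star_mul, hε.star_eq, mul_assoc]

namespace NCRiemannianManifold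

variable {ω : DixmierLimit} {p : ℕ} (M : NCRiemannianManifold ω p H)

/-- `C_D(A)`. -/
abbrev C : StarSubalgebra ℂ (H →L[ℂ] H) := cliffordAlg M.A M.D

theorem A_le_C : M.A ≤ M.C := fun _ h => StarAlgebra.subset_adjoin ℂ _ (Or.inl h)

theorem isCommutator_comm {a : H →L[ℂ] H} (h : a ∈ M.A) : IsCommutator M.D a (comm M.D a) :=
  Classical.epsilon_spec (M.bounded_comm a h)

theorem comm_mem_C {a : H →L[ℂ] H} (h : a ∈ M.A) : comm M.D a ∈ M.C :=
  StarAlgebra.subset_adjoin ℂ _ (Or.inr ⟨a, h, M.isCommutator_comm h⟩)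

theorem map_C_le : M.C.map (conjHom M.grading) ≤ M.C := by
  rw [C, cliffordAlg, StarAlgHom.map_adjoin]
  refine StarAlgebra.adjoin_le ?_
  rintro _ ⟨T, hT | ⟨a, ha, hX⟩, rfl⟩
  · have : conjHom M.grading T = T := by
      change M.ε * T * M.ε = T
      rw [M.grading_A T hT, mul_assoc, M.grading.mul_self, mul_one]
    rw [this]
    exact M.A_le_C hT
  · have : conjHom M.grading T = -T := by
      change M.ε * T * M.ε = -T
      have hd : Dense ((Submodule.span ℂ (M.D.domain : Set H) : Submodule ℂ H) : Set H) := by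
        rw [Submodule.span_eq]
        exact M.selfAdjoint.dense_domain
      refine ContinuousLinearMap.ext_on hd ?_
      intro x hx
      obtain ⟨h1, h2⟩ := M.grading.anticomm ⟨x, hx⟩
      obtain ⟨h3, h4⟩ := hX ⟨x, hx⟩
      obtain ⟨h5, h6⟩ := hX ⟨M.ε x, h1⟩
      obtain ⟨h7, h8⟩ := M.grading.anticomm ⟨a x, h3⟩
      have hc : ∀ y, M.ε (a y) = a (M.ε y) := fun y =>
        congrArg (fun S : H →L[ℂ] H => S y) (M.grading_A a ha)
      have he : ∀ y, M.ε (M.ε y) = y := fun y =>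
        congrArg (fun S : H →L[ℂ] H => S y) M.grading.mul_self
      have h9 : M.D ⟨a (M.ε x), h5⟩ = M.D ⟨M.ε (a x), h7⟩ := by
        congr 1
        exact Subtype.ext (hc x).symm
      change M.ε (T (M.ε x)) = -(T x)
      rw [← h6, ← h4, h2, h9, h8, map_sub, map_neg, map_neg, map_neg, he, hc, he]
      abel
    rw [this]
    exact neg_mem (StarAlgebra.subset_adjoin ℂ _ (Or.inr ⟨a, ha, hX⟩))

/-- The parity automorphism `w ↦ ε w ε` of `C_D(A)`. -/
def gradeAlg : M.C →⋆ₐ[ℂ] M.C :=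
  ((conjHom M.grading).comp M.C.subtype).codRestrict _ fun x => M.map_C_le ⟨x, x.2, rfl⟩

/-- The C*-algebra `A`, the norm closure of `𝒜`. -/
abbrev Abar : Type u := Closure M.A

/-- The norm closure of `C_D(A)`. -/
abbrev Cbar : Type u := Closure M.C

/-- The parity automorphism of the norm closure of `C_D(A)`. -/
def gradeCbar : M.Cbar →⋆ₐ[ℂ] M.Cbar := Closure.restrict M.C (conjHom M.grading) M.map_C_le

end NCRiemannianManifold

end Gradings

end NCRiem

namespace NCRiem

/-! ### Lyapunov estimates and compact commutators -/

section Lyapunov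

open Filter Topology

variable {H : Type u} [NormedAddCommGroup H] [InnerProductSpace ℂ H] [CompleteSpace H]

/-! The Riemannian condition makes `Φ` a cyclic trace vector for `C_D(A)`: with `z = (Φ|Φ)` central,
`⟨vΦ|uΦ⟩ = ψ(v*uz) = ψ(v*zu) = ⟨u*Φ|v*Φ⟩` (`trace_vector`). Hence `uΦ ↦ u*Φ` is isometric on the
dense subspace `H_∞ = C_D(A)Φ` and extends to an antiunitary involution `J`. The operator `J w* J`
is right multiplication `uΦ ↦ uwΦ`, so it commutes with `C_D(A)`. As `εΦ = Φ`, `J` commutes with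
`ε`.

Let `U` be the unitary equal to `1` on even and to `-i` on odd vectors. Conjugation by `U` turns
commutation with odd operators into graded commutation, so `α(w^op) = U J w* J U*` is an injective,
hence isometric, `*`-homomorphism satisfying the graded first order condition. On odd `w` it equals
`-i J w* J ε`; combined with `[D, a*] = -[D, a]*` this identifies `α([D, a]^op)` with the commutator
of `i J D J ε` and `J a* J`.

The main analytic point of the spectral triple is that `D α(w) - α(εwε) D` is bounded. By the first
order condition it is `A`-linear on `H_∞`, and so is its formal adjoint. Since `H_∞` is finitely
generated over `A`, the iterates of the positive operator built from the two grow at most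
geometrically on each vector, at a rate independent of the vector, and Krein's log-convexity
argument bounds it (`exists_bound_of_adjointable`). The bound passes to `Dom D` because `H_∞` is a
core (`graph_of_smoothDomain`).

For the Kasparov module, write `g = (1 + D²)^(-1/2)` and `F = Dg`. If `[D, T] = X` is bounded, then
`S = [F, T]` solves a Lyapunov equation `gS + Sg = gYg` with `‖Y‖ ≤ 3‖X‖`, whence `‖S‖ ≤ ‖g‖‖Y‖` up
to replacing `‖g‖` by an upper bound. Replacing `F` by `D(n² + D²)^(-1/2)` changes it by a compact
operator and makes the bound `3‖X‖/n`, so `[F, T]` is a norm limit of compact operators. Graded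
commutators reduce to ordinary ones by splitting `T` into its even part and its odd part multiplied
by `ε`. Operators whose graded commutator with `F` is compact form a norm closed algebra, so it is
enough to treat the generators of the maximal tensor product. The class is unique because a Kasparov
representation preserves adjoints, is therefore contractive, and is determined on generators. -/

theorem isSelfAdjoint_apply {T : H →L[ℂ] H} (hT : IsSelfAdjoint T) (x y : H) :
    inner ℂ (T x) y = inner ℂ x (T y) :=
  hT.isSymmetric x y

/-- A closed subspace containing the eigenvectors of a compact selfadjoint operator is everything. -/
theorem mem_of_eigenspace_le {g : H →L[ℂ] H} (hg : IsSelfAdjoint g) (hc : IsCompactOperator g)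
    (W : Submodule ℂ H) (hW : IsClosed (W : Set H)) (h : ∀ (μ : ℂ) (x : H), g x = μ • x → x ∈ W)
    (x : H) : x ∈ W := by
  have h1 := ContinuousLinearMap.orthogonalComplement_iSup_eigenspaces_eq_bot hc hg.isSymmetric
  have h2 : (⨆ μ, Module.End.eigenspace (g : Module.End ℂ H) μ) ≤ W :=
    iSup_le fun μ y hy => h μ y (Module.End.mem_eigenspace_iff.mp hy)
  have h3 := (Submodule.topologicalClosure_eq_top_iff (K := ⨆ μ, Module.End.eigenspace
    (g : Module.End ℂ H) μ)).mpr h1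
  have h4 := Submodule.topologicalClosure_minimal _ h2 hW
  rw [h3] at h4
  exact h4 trivial

/-- Strong convergence to zero of the powers of the Cayley transform of a positive injective compact
operator. -/
theorem tendsto_cayley_pow {g k : H →L[ℂ] H} (hg : 0 ≤ g) (hi : ∀ x, g x = 0 → x = 0)
    (hc : IsCompactOperator g) (hk : ∀ y, k (y + g y) = y - g y) (hn : ∀ x, ‖k x‖ ≤ ‖x‖) (x : H) :
    Tendsto (fun n : ℕ => (k ^ n) x) atTop (𝓝 0) := by
  have hpos := (ContinuousLinearMap.nonneg_iff_isPositive g).mp hg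
  have hkn : ∀ (n : ℕ) (y : H), ‖(k ^ n) y‖ ≤ ‖y‖ := by
    intro n
    induction n with
    | zero => intro y; simp
    | succ n ih => intro y; rw [pow_succ]; exact (ih _).trans (hn y)
  let W : Submodule ℂ H :=
    { carrier := {y | Tendsto (fun n : ℕ => (k ^ n) y) atTop (𝓝 0)}
      add_mem' := fun {a b} ha hb => by
        simpa [map_add] using Tendsto.add ha hb
      zero_mem' := by simp
      smul_mem' := fun c y hy => by
        have : Tendsto (fun n : ℕ => c • (k ^ n) y) atTop (𝓝 (c • 0)) := Tendsto.const_smul hy c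
        rw [smul_zero] at this
        exact this.congr fun n => (map_smul _ _ _).symm }
  have hW : IsClosed (W : Set H) := by
    refine isClosed_of_closure_subset fun y hy => ?_
    change Tendsto (fun n : ℕ => (k ^ n) y) atTop (𝓝 0)
    rw [Metric.tendsto_atTop]
    intro e he
    obtain ⟨w, hw, hyw⟩ := Metric.mem_closure_iff.mp hy (e / 2) (by positivity)
    obtain ⟨N, hN⟩ := Metric.tendsto_atTop.mp
      (show Tendsto (fun n : ℕ => (k ^ n) w) atTop (𝓝 0) from hw) (e / 2) (by positivity)
    refine ⟨N, fun n hn => ?_⟩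
    have h1 := hN n hn
    rw [dist_zero_right] at h1 ⊢
    have h2 : (k ^ n) y = (k ^ n) (y - w) + (k ^ n) w := by rw [← map_add, sub_add_cancel]
    have h3 := hkn n (y - w)
    rw [dist_eq_norm] at hyw
    calc ‖(k ^ n) y‖ ≤ ‖(k ^ n) (y - w)‖ + ‖(k ^ n) w‖ := by rw [h2]; exact norm_add_le _ _
      _ < e := by linarith
  refine mem_of_eigenspace_le hpos.isSelfAdjoint hc W hW ?_ x
  intro μ y hy
  by_cases hy0 : y = 0
  · rw [hy0]; exact W.zero_mem
  have hn2 : (0 : ℝ) < ‖y‖ ^ 2 := by positivity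
  have h1 : 0 ≤ inner ℂ y (g y) := hpos.inner_nonneg_right y
  rw [hy, inner_smul_right, inner_self_eq_norm_sq_to_K] at h1
  have hμ0 : 0 ≤ μ := by
    have : (0 : ℂ) < ((‖y‖ : ℂ)) ^ 2 := by
      have : (0:ℂ) < ((‖y‖ ^ 2 : ℝ) : ℂ) := by exact_mod_cast hn2
      simpa using this
    have h2 := mul_nonneg h1 (inv_nonneg.mpr this.le)
    erw [mul_assoc, mul_inv_cancel₀ this.ne', mul_one] at h2
    exact h2
  obtain ⟨r, hr⟩ : ∃ r : ℝ, (r : ℂ) = μ := ⟨μ.re, by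
    have := Complex.nonneg_iff.mp hμ0
    apply Complex.ext <;> simp [← this.2]⟩
  have hr0 : 0 ≤ r := by rw [← hr] at hμ0; exact_mod_cast hμ0
  have hr1 : r ≠ 0 := by
    rintro rfl
    apply hy0
    apply hi
    rw [hy, ← hr]; simp
  have hr2 : 0 < r := lt_of_le_of_ne hr0 (Ne.symm hr1)
  -- The eigenvalue of the Cayley transform on an eigenvector of `g` with eigenvalue `r`;
  -- injectivity of `g` gives `r > 0`, hence `|t| < 1`.
  set t : ℂ := (((1 - r) / (1 + r) : ℝ) : ℂ) with ht
  have hky : k y = t • y := by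
    have h2 := hk ((1 + μ)⁻¹ • y)
    have h3 : (1 + μ) ≠ 0 := by
      rw [← hr]; exact_mod_cast (by positivity : (1 + r) ≠ 0)
    rw [map_smul, hy] at h2
    have h4 : (1 + μ)⁻¹ • y + (1 + μ)⁻¹ • μ • y = y := by
      rw [smul_smul, ← add_smul]
      convert one_smul ℂ y using 2
      field_simp
    rw [h4] at h2
    rw [h2, smul_smul, ← sub_smul, ht, ← hr]
    congr 1
    rw [← hr] at h3
    push_cast
    field_simp
  have hpow : ∀ n : ℕ, (k ^ n) y = t ^ n • y := by
    intro n
    induction n with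
    | zero => simp
    | succ n ih =>
      rw [pow_succ', pow_succ', mul_apply_eq_comp, ih, map_smul, hky, smul_smul,
        mul_comm]
  change Tendsto (fun n : ℕ => (k ^ n) y) atTop (𝓝 0)
  simp_rw [hpow]
  have ht1 : ‖t‖ < 1 := by
    rw [ht, Complex.norm_real, Real.norm_eq_abs, abs_lt]
    constructor
    · rw [lt_div_iff₀ (by positivity)]; linarith
    · rw [div_lt_one (by positivity)]; linarith
  simpa using (tendsto_pow_atTop_nhds_zero_of_norm_lt_one ht1).smul_const y

/-- Polarization: the terms that are even in `g` cancel. This converts the Lyapunov form of `A` into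
the decrease of the form of `A` under the Cayley transform `(1 - g)(1 + g)⁻¹`. -/
theorem re_inner_sub_sub {E : Type*} [NormedAddCommGroup E] [InnerProductSpace ℂ E]
    (g A : E →L[ℂ] E) (y : E) :
    (inner ℂ (y + g y) (A (y + g y))).re - (inner ℂ (y - g y) (A (y - g y))).re
      = 2 * (inner ℂ (g y) (A y) + inner ℂ y (A (g y))).re := by
  simp only [map_add, map_sub, inner_add_left, inner_add_right, inner_sub_left, inner_sub_right,
    Complex.add_re, Complex.sub_re]
  ring

/-- **Lyapunov's lemma**: if the form of `g A + A g` is accretive, with `g` positive, injective and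
compact, then so is the form of `A`. -/
theorem lyapunov_nonneg {g A : H →L[ℂ] H} (hg : 0 ≤ g) (hi : ∀ x, g x = 0 → x = 0)
    (hc : IsCompactOperator g)
    (h : ∀ y, 0 ≤ (inner ℂ (g y) (A y) + inner ℂ y (A (g y))).re) (x : H) :
    0 ≤ (inner ℂ x (A x)).re := by
  have hpos := (ContinuousLinearMap.nonneg_iff_isPositive g).mp hg
  have hre : ∀ y, 0 ≤ (inner ℂ y (g y)).re := fun y => hpos.re_inner_nonneg_right y
  obtain ⟨v, hv⟩ : IsUnit (1 + g) := by
    refine ContinuousLinearMap.isUnit_of_forall_le_norm_inner_map (1 + g) (c := 1) one_pos ?_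
    intro y
    have h1 : inner ℂ ((1 + g) y) y = inner ℂ y y + inner ℂ y (g y) := by
      rw [add_apply, inner_add_left, isSelfAdjoint_apply hpos.isSelfAdjoint]
      simp
    rw [h1, inner_self_eq_norm_sq_to_K]
    refine le_trans ?_ (Complex.re_le_norm _)
    have := hre y
    rw [Complex.add_re]
    have h3 : (((‖y‖ : ℂ)) ^ 2).re = ‖y‖ ^ 2 := by
      rw [← Complex.ofReal_pow, Complex.ofReal_re]
    simp only [Complex.coe_algebraMap, NNReal.coe_one, mul_one] at *
    rw [h3]
    linarith
  set k : H →L[ℂ] H := (1 - g) * (↑v⁻¹ : H →L[ℂ] H) with hkdef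
  have hinv : ∀ z, (↑v⁻¹ : H →L[ℂ] H) z + g ((↑v⁻¹ : H →L[ℂ] H) z) = z := fun z => by
    have : ((v : H →L[ℂ] H) * (↑v⁻¹ : H →L[ℂ] H)) z = z := by rw [v.mul_inv]; rfl
    rw [hv] at this
    simpa using this
  have hinv' : ∀ y, (↑v⁻¹ : H →L[ℂ] H) (y + g y) = y := fun y => by
    have : ((↑v⁻¹ : H →L[ℂ] H) * (v : H →L[ℂ] H)) y = y := by rw [v.inv_mul]; rfl
    rw [hv] at this
    simpa using this
  have hk : ∀ y, k (y + g y) = y - g y := fun y => by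
    rw [hkdef, mul_apply_eq_comp, hinv']; rfl
  have hk' : ∀ z, k z = (↑v⁻¹ : H →L[ℂ] H) z - g ((↑v⁻¹ : H →L[ℂ] H) z) := fun z => by
    rw [hkdef, mul_apply_eq_comp]; rfl
  -- Take `y = (1 + g)⁻¹ z` in `re_inner_sub_sub`: the form of `B` decreases under `k`. With `B = 1`
  -- this says that `k` is a contraction; with `B = A` it compares `⟨x, Ax⟩` with its values along
  -- `kⁿ x → 0`.
  have hstep : ∀ B : H →L[ℂ] H, (∀ y, 0 ≤ (inner ℂ (g y) (B y) + inner ℂ y (B (g y))).re) →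
      ∀ z, (inner ℂ (k z) (B (k z))).re ≤ (inner ℂ z (B z)).re := by
    intro B hB z
    have h1 := re_inner_sub_sub g B ((↑v⁻¹ : H →L[ℂ] H) z)
    rw [hinv, ← hk'] at h1
    have := hB ((↑v⁻¹ : H →L[ℂ] H) z)
    linarith
  have hn : ∀ z, ‖k z‖ ≤ ‖z‖ := by
    intro z
    have h1 := hstep 1 (fun y => by
      have h2 : inner ℂ (g y) ((1 : H →L[ℂ] H) y) = inner ℂ y (g y) :=
        isSelfAdjoint_apply hpos.isSelfAdjoint y y
      have := hre y
      rw [h2, Complex.add_re]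
      simpa using this) z
    have h2 : ∀ w : H, (inner ℂ w ((1 : H →L[ℂ] H) w)).re = ‖w‖ ^ 2 := fun w => by
      have := inner_self_eq_norm_sq (𝕜 := ℂ) w
      simpa using this
    rw [h2, h2] at h1
    exact le_of_sq_le_sq h1 (norm_nonneg _)
  have hlim := tendsto_cayley_pow hg hi hc hk hn x
  have hmono : ∀ n : ℕ, (inner ℂ ((k ^ n) x) (A ((k ^ n) x))).re ≤ (inner ℂ x (A x)).re := by
    intro n
    induction n with
    | zero => simp
    | succ n ih =>
      rw [pow_succ']
      exact (hstep A h ((k ^ n) x)).trans ih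
  have hlim2 : Tendsto (fun n : ℕ => (inner ℂ ((k ^ n) x) (A ((k ^ n) x))).re) atTop (𝓝 0) := by
    have h1 : Continuous fun z : H => (inner ℂ z (A z)).re := by fun_prop
    have h2 := (h1.tendsto 0).comp hlim
    simp only [map_zero, inner_zero_left, Complex.zero_re] at h2
    exact h2
  exact le_of_tendsto' hlim2 hmono

/-- The norm of a selfadjoint operator is the supremum of its Rayleigh quotients in absolute value.
-/
theorem norm_le_of_abs_re_inner_le {S : H →L[ℂ] H} (hS : IsSelfAdjoint S) {c : ℝ} (hc : 0 ≤ c)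
    (h : ∀ x, |(inner ℂ x (S x)).re| ≤ c * ‖x‖ ^ 2) : ‖S‖ ≤ c := by
  rw [S.norm_eq_iSup_rayleighQuotient hS.isSymmetric]
  refine ciSup_le fun x => ?_
  rw [ContinuousLinearMap.rayleighQuotient, ContinuousLinearMap.reApplyInnerSelf, abs_div,
    abs_of_nonneg (by positivity : 0 ≤ ‖x‖ ^ 2)]
  refine div_le_of_le_mul₀ (by positivity) hc ?_
  have := h x
  rw [← isSelfAdjoint_apply hS] at this
  exact this

/-- Solutions `S` of the Lyapunov equation `g S + S g = g Y g` with `g ≤ d`. -/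
theorem lyapunov_norm_le {g S Y : H →L[ℂ] H} {d : ℝ} (hg : 0 ≤ g) (hd : ‖g‖ ≤ d)
    (hi : ∀ x, g x = 0 → x = 0) (hc : IsCompactOperator g) (hS : IsSelfAdjoint S)
    (h : g * S + S * g = g * Y * g) : ‖S‖ ≤ d * ‖Y‖ := by
  have hd0 : 0 ≤ d := (norm_nonneg _).trans hd
  have hpos := (ContinuousLinearMap.nonneg_iff_isPositive g).mp hg
  have hre : ∀ y, 0 ≤ (inner ℂ y (g y)).re := fun y => hpos.re_inner_nonneg_right y
  -- This is `g² ≤ d g`, obtained by factoring `g` through its square root.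
  have hsq : ∀ y, ‖g y‖ ^ 2 ≤ d * (inner ℂ y (g y)).re := by
    intro y
    have hs := CFC.sqrt_nonneg g
    have hs' := ((ContinuousLinearMap.nonneg_iff_isPositive _).mp hs).isSelfAdjoint
    have h1 : ∀ z, CFC.sqrt g (CFC.sqrt g z) = g z := fun z => by
      rw [← mul_apply_eq_comp, CFC.sqrt_mul_sqrt_self g hg]
    have h2 : (inner ℂ y (g y)).re = ‖CFC.sqrt g y‖ ^ 2 := by
      rw [← h1, ← isSelfAdjoint_apply hs']
      exact inner_self_eq_norm_sq (𝕜 := ℂ) _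
    have h3 : ‖g y‖ ≤ √‖g‖ * ‖CFC.sqrt g y‖ := by
      rw [← h1, ← CFC.norm_sqrt g hg]
      exact ContinuousLinearMap.le_opNorm _ _
    rw [h2]
    calc ‖g y‖ ^ 2 ≤ (√‖g‖ * ‖CFC.sqrt g y‖) ^ 2 := by gcongr
      _ = ‖g‖ * ‖CFC.sqrt g y‖ ^ 2 := by rw [mul_pow, Real.sq_sqrt (norm_nonneg _)]
      _ ≤ d * ‖CFC.sqrt g y‖ ^ 2 := by gcongr
  have hform : ∀ y, inner ℂ (g y) (S y) + inner ℂ y (S (g y)) = inner ℂ (g y) (Y (g y)) := by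
    intro y
    rw [isSelfAdjoint_apply hpos.isSelfAdjoint, isSelfAdjoint_apply hpos.isSelfAdjoint,
      ← inner_add_right]
    exact congrArg (fun T : H →L[ℂ] H => inner ℂ y (T y)) h
  have hb : ∀ y, |(inner ℂ (g y) (Y (g y))).re| ≤ 2 * (d * ‖Y‖) * (inner ℂ y (g y)).re := by
    intro y
    have h0 := hre y
    calc |(inner ℂ (g y) (Y (g y))).re| ≤ ‖inner ℂ (g y) (Y (g y))‖ := Complex.abs_re_le_norm _
      _ ≤ ‖g y‖ * ‖Y (g y)‖ := norm_inner_le_norm _ _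
      _ ≤ ‖g y‖ * (‖Y‖ * ‖g y‖) := by gcongr; exact Y.le_opNorm _
      _ = ‖Y‖ * ‖g y‖ ^ 2 := by ring
      _ ≤ ‖Y‖ * (d * (inner ℂ y (g y)).re) := by gcongr; exact hsq y
      _ ≤ 2 * (d * ‖Y‖) * (inner ℂ y (g y)).re := by
        have : 0 ≤ d * ‖Y‖ * (inner ℂ y (g y)).re := by positivity
        linarith
  set c : ℂ := ((d * ‖Y‖ : ℝ) : ℂ) with hcdef
  have hcre : ∀ z : ℂ, (c * z).re = d * ‖Y‖ * z.re := fun z => by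
    rw [hcdef, Complex.re_ofReal_mul]
  -- The Lyapunov form of `d‖Y‖ + sS` is `2d‖Y‖⟨y, gy⟩ + s⟨gy, Ygy⟩`, whose real part is nonnegative
  -- by `hb`; the signs `s = ±1` bound the form of `S` from both sides.
  have key : ∀ s : ℝ, |s| = 1 → ∀ x, 0 ≤ d * ‖Y‖ * ‖x‖ ^ 2 + s * (inner ℂ x (S x)).re := by
    intro s hs x
    have h1 := lyapunov_nonneg (A := c • (1 : H →L[ℂ] H) + (s : ℂ) • S) hg hi hc (fun y => by
      simp only [add_apply, smul_apply,
        one_apply_eq_self, inner_add_right, inner_smul_right]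
      rw [show c * inner ℂ (g y) y + s * inner ℂ (g y) (S y)
          + (c * inner ℂ y (g y) + s * inner ℂ y (S (g y)))
          = c * (inner ℂ (g y) y + inner ℂ y (g y))
            + s * (inner ℂ (g y) (S y) + inner ℂ y (S (g y))) by ring, hform,
        isSelfAdjoint_apply hpos.isSelfAdjoint, Complex.add_re, hcre, Complex.re_ofReal_mul,
        Complex.add_re]
      have h2 : |s * (inner ℂ (g y) (Y (g y))).re| ≤ 2 * (d * ‖Y‖) * (inner ℂ y (g y)).re := by
        rw [abs_mul, hs, one_mul]; exact hb y
      have := neg_le_of_abs_le h2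
      linarith) x
    simp only [add_apply, smul_apply,
      one_apply_eq_self, inner_add_right, inner_smul_right, Complex.add_re, hcre,
      Complex.re_ofReal_mul] at h1
    have h2 : (inner ℂ x x : ℂ).re = ‖x‖ ^ 2 := inner_self_eq_norm_sq (𝕜 := ℂ) x
    rwa [h2] at h1
  refine norm_le_of_abs_re_inner_le hS (by positivity) fun x => ?_
  have h1 := key 1 (by simp) x
  have h2 := key (-1) (by simp) x
  rw [abs_le]
  constructor <;> linarith

end Lyapunov

/-! ### Compactness of commutators with the bounded transform -/

section CompactCommutator

open Filter Topology

variable {H : Type u} [NormedAddCommGroup H] [InnerProductSpace ℂ H] [CompleteSpace H]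

/-- With `F = Dg` and `X = [D, T]`, the hypothesis on `gXg` is the commutator relation sandwiched
between resolvents, so the unbounded operator no longer appears. Expanding the right side and
replacing each `F²` by `1 - m g²`, the terms containing `m` cancel. -/
theorem lyapunov_identity {R : Type*} [Ring R] [Algebra ℂ R] {F g T X : R} {m : ℂ}
    (hFg : F * g = g * F) (h1 : F * F + m • (g * g) = 1) (hX : g * X * g = F * T * g - g * T * F) :
    g * (F * T - T * F) + (F * T - T * F) * g
      = g * (X + m • (g * X * g) - F * X * F) * g := by
  have hFF : F * F = 1 - m • (g * g) := by rw [← h1]; abel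
  have e1 : g * (F * X * F) * g = F * (g * X * g) * F := by
    calc g * (F * X * F) * g = (g * F) * X * (F * g) := by simp only [mul_assoc]
      _ = (F * g) * X * (g * F) := by rw [hFg]
      _ = F * (g * X * g) * F := by simp only [mul_assoc]
  have e2 : g * (X + m • (g * X * g) - F * X * F) * g
      = g * X * g + m • (g * (g * X * g) * g) - g * (F * X * F) * g := by
    simp only [mul_add, mul_sub, add_mul, sub_mul, mul_smul_comm, smul_mul_assoc]
  rw [e2, e1, hX]
  have e3 : F * (F * T * g - g * T * F) * F = (F * F) * T * (F * g) - (F * g) * T * (F * F) := by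
    rw [mul_sub, sub_mul]
    congr 1
    · rw [hFg]; simp only [mul_assoc]
    · simp only [mul_assoc]
  rw [e3, hFF]
  have e4 : F * T * g * g = F * T * (g * g) := by simp only [mul_assoc]
  simp only [mul_sub, sub_mul, mul_one, one_mul, smul_mul_assoc, mul_smul_comm, smul_sub, hFg]
  simp only [mul_assoc, hFg]
  abel

/-- Commutator estimate for the bounded transform `F` with resolvent `g ≤ 1 / n`. -/
theorem commutator_norm_le {F g T X : H →L[ℂ] H} {n : ℝ} (hn : 0 < n) (hF : IsSelfAdjoint F)
    (hg : 0 ≤ g) (hi : ∀ x, g x = 0 → x = 0) (hc : IsCompactOperator g) (hFg : F * g = g * F)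
    (h1 : F * F + ((n : ℂ) ^ 2) • (g * g) = 1) (hT : IsSelfAdjoint T)
    (hX : g * X * g = F * T * g - g * T * F) : ‖F * T - T * F‖ ≤ 3 * ‖X‖ / n := by
  have hgs := ((ContinuousLinearMap.nonneg_iff_isPositive g).mp hg).isSelfAdjoint
  have hpyth : ∀ x, ‖F x‖ ^ 2 + n ^ 2 * ‖g x‖ ^ 2 = ‖x‖ ^ 2 := by
    intro x
    have h2 := congrArg (fun S : H →L[ℂ] H => (inner ℂ x (S x)).re) h1
    simp only [add_apply, smul_apply, mul_apply_eq_comp, one_apply_eq_self, inner_add_right,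
      inner_smul_right, Complex.add_re] at h2
    rw [← isSelfAdjoint_apply hF, ← isSelfAdjoint_apply hgs, ← Complex.ofReal_pow,
      Complex.re_ofReal_mul] at h2
    have h3 : ∀ y : H, (inner ℂ y y : ℂ).re = ‖y‖ ^ 2 := inner_self_eq_norm_sq (𝕜 := ℂ)
    rw [h3, h3, h3] at h2
    exact h2
  have hF1 : ‖F‖ ≤ 1 := F.opNorm_le_bound zero_le_one fun x => by
    have := hpyth x
    rw [one_mul]
    refine le_of_sq_le_sq ?_ (norm_nonneg _)
    have : 0 ≤ n ^ 2 * ‖g x‖ ^ 2 := by positivity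
    linarith
  have hg1 : ‖g‖ ≤ 1 / n := g.opNorm_le_bound (by positivity) fun x => by
    have := hpyth x
    rw [one_div, ← div_eq_inv_mul, le_div_iff₀ hn]
    refine le_of_sq_le_sq ?_ (norm_nonneg _)
    have : 0 ≤ ‖F x‖ ^ 2 := by positivity
    nlinarith
  -- Each of the three summands has norm at most `‖X‖`, because `‖F‖ ≤ 1` and `n‖g‖ ≤ 1`.
  set Y := X + ((n : ℂ) ^ 2) • (g * X * g) - F * X * F with hY
  have hid := lyapunov_identity hFg h1 hX
  have hYn : ‖Y‖ ≤ 3 * ‖X‖ := by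
    have a1 : ‖g * X * g‖ ≤ 1 / n * ‖X‖ * (1 / n) :=
      (norm_mul_le _ _).trans (by gcongr; exact (norm_mul_le _ _).trans (by gcongr))
    have a2 : ‖((n : ℂ) ^ 2) • (g * X * g)‖ ≤ ‖X‖ := by
      rw [norm_smul, norm_pow, Complex.norm_real, Real.norm_of_nonneg hn.le]
      calc n ^ 2 * ‖g * X * g‖ ≤ n ^ 2 * (1 / n * ‖X‖ * (1 / n)) := by gcongr
        _ = ‖X‖ := by field_simp
    have a3 : ‖F * X * F‖ ≤ 1 * ‖X‖ * 1 :=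
      (norm_mul_le _ _).trans (by gcongr; exact (norm_mul_le _ _).trans (by gcongr))
    have a4 := norm_sub_le (X + ((n : ℂ) ^ 2) • (g * X * g)) (F * X * F)
    have a5 := norm_add_le X (((n : ℂ) ^ 2) • (g * X * g))
    rw [← hY] at a4
    linarith
  -- The commutator of two selfadjoint operators is skew; the factor `i` makes `lyapunov_norm_le`
  -- applicable.
  have hS : IsSelfAdjoint (Complex.I • (F * T - T * F)) := by
    rw [IsSelfAdjoint, star_smul, star_sub, star_mul, star_mul, hF.star_eq, hT.star_eq,
      RCLike.star_def, Complex.conj_I, neg_smul, ← smul_neg, neg_sub]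
  have := lyapunov_norm_le (Y := Complex.I • Y) hg hg1 hi hc hS (by
    rw [mul_smul_comm, smul_mul_assoc, ← smul_add, hid, mul_smul_comm, smul_mul_assoc])
  rw [norm_smul, norm_smul, Complex.norm_I, one_mul, one_mul] at this
  calc _ ≤ 1 / n * ‖Y‖ := this
    _ ≤ 1 / n * (3 * ‖X‖) := by gcongr
    _ = _ := by ring

/-- The operators `c = (1 + m R)^(-1/2)`, for `R ≥ 0` compact, are compact perturbations of `1`. -/
theorem exists_rescaling {R : H →L[ℂ] H} (hR : 0 ≤ R) (hc : IsCompactOperator R) {m : ℝ}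
    (hm : 0 ≤ m) : ∃ c : H →L[ℂ] H, 0 ≤ c ∧ (∀ B, R * B = B * R → c * B = B * c) ∧
      c * c * (1 + (m : ℂ) • R) = 1 ∧ IsCompactOperator (1 - c : H →L[ℂ] H) := by
  have hRs := ((ContinuousLinearMap.nonneg_iff_isPositive R).mp hR).isSelfAdjoint
  have hsp : ∀ x ∈ spectrum ℝ R, 0 ≤ x := fun x hx => spectrum_nonneg_of_nonneg hR hx
  have hpos : ∀ x ∈ spectrum ℝ R, 0 < 1 + m * x := fun x hx => by
    have := mul_nonneg hm (hsp x hx); linarith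
  set f : ℝ → ℝ := fun x => (√(1 + m * x))⁻¹ with hf
  have hfc : ContinuousOn f (spectrum ℝ R) :=
    ContinuousOn.inv₀ (by fun_prop) fun x hx => (Real.sqrt_pos.mpr (hpos x hx)).ne'
  -- Since `1 - f² = m x f²`, one has `1 - f = x · m f² / (1 + f) = x h`; the factor `x` becomes the
  -- compact operator `R`.
  set h : ℝ → ℝ := fun x => m * f x ^ 2 * (1 + f x)⁻¹ with hh
  have hf0 : ∀ x, 0 ≤ f x := fun x => by positivity
  have hhc : ContinuousOn h (spectrum ℝ R) := by
    refine ContinuousOn.mul (by fun_prop) (ContinuousOn.inv₀ (by fun_prop) fun x _ => ?_)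
    have := hf0 x
    positivity
  refine ⟨cfc f R, cfc_nonneg fun x _ => hf0 x, fun B hB => (Commute.cfc_real hB f).eq, ?_, ?_⟩
  · have e1 : (1 + (m : ℂ) • R) = cfc (fun x : ℝ => 1 + m * x) R := by
      rw [cfc_const_add _ _ R, cfc_const_mul_id _ R, map_one]
      congr 1
    rw [e1, ← cfc_mul f f R, ← cfc_mul _ _ R]
    rw [← cfc_one ℝ R]
    refine cfc_congr fun x hx => ?_
    have h2 := Real.sq_sqrt (hpos x hx).le
    have h3 := (Real.sqrt_pos.mpr (hpos x hx)).ne'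
    simp only [hf, Pi.one_apply]
    field_simp
    exact h2.symm
  · have e2 : 1 - cfc f R = R * cfc h R := by
      have : R * cfc h R = cfc (fun x : ℝ => x * h x) R := by
        rw [cfc_mul (fun x : ℝ => x) h R continuousOn_id hhc, cfc_id' ℝ R]
      rw [this, ← cfc_const_one ℝ R, ← cfc_sub (fun _ => (1 : ℝ)) f R continuousOn_const hfc]
      refine cfc_congr fun x hx => ?_
      have h2 := Real.sq_sqrt (hpos x hx).le
      have h3 := (Real.sqrt_pos.mpr (hpos x hx))
      simp only [hf, hh]
      field_simp
      nlinarith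
    rw [e2]
    exact hc.comp_clm (cfc h R)

/-- Rescaling: `Fc` is `D(N² + D²)^(-1/2)` in bounded terms, with `‖[Fc, T]‖ ≤ 3‖X‖/N`, while `F -
Fc = F(1 - c)` is compact. Hence `[F, T]` is the norm limit of the compact operators `[F(1 - c), T]`
as `N → ∞`. -/
theorem isCompactOperator_commutator_of_isSelfAdjoint {F g T X : H →L[ℂ] H}
    (hF : IsSelfAdjoint F) (hg : 0 ≤ g) (hi : ∀ x, g x = 0 → x = 0) (hc : IsCompactOperator g)
    (hFg : F * g = g * F) (h1 : F * F + g * g = 1) (hT : IsSelfAdjoint T)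
    (hX : g * X * g = F * T * g - g * T * F) :
    IsCompactOperator (F * T - T * F : H →L[ℂ] H) := by
  have hgs := ((ContinuousLinearMap.nonneg_iff_isPositive g).mp hg).isSelfAdjoint
  have hR : 0 ≤ g * g := by
    have := star_mul_self_nonneg g
    rwa [hgs.star_eq] at this
  have hRc : IsCompactOperator (g * g : H →L[ℂ] H) := hc.comp_clm g
  have happ : ∀ n : ℕ, ∃ K : H →L[ℂ] H, IsCompactOperator K ∧
      ‖(F * T - T * F) - K‖ ≤ 3 * ‖X‖ / ((n : ℝ) + 1) := by
    intro n
    have hn : (0 : ℝ) < (n : ℝ) + 1 := by positivity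
    have hm : (0 : ℝ) ≤ ((n : ℝ) + 1) ^ 2 - 1 := by
      have : (0 : ℝ) ≤ n := Nat.cast_nonneg n
      nlinarith
    -- With `N = n + 1`, `c = (1 + (N² - 1) g²)^(-1/2)`, chosen so that `(Fc)² + N² (gc)² = c² (F² +
    -- N² g²) = 1`. The shift by one keeps `N` positive and `N² - 1` nonnegative.
    obtain ⟨c, hc0, hcomm, hcc, hcK⟩ := exists_rescaling hR hRc hm
    have hcs := ((ContinuousLinearMap.nonneg_iff_isPositive c).mp hc0).isSelfAdjoint
    have hcg : c * g = g * c := hcomm g (mul_assoc _ _ _)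
    have hcF : c * F = F * c := hcomm F (by
      rw [mul_assoc, ← hFg, ← mul_assoc, ← hFg, mul_assoc])
    refine ⟨F * (1 - c) * T - T * (F * (1 - c)), ?_, ?_⟩
    · have a1 : IsCompactOperator (F * (1 - c) : H →L[ℂ] H) := hcK.clm_comp F
      have a2 : IsCompactOperator (F * (1 - c) * T : H →L[ℂ] H) := a1.comp_clm T
      have a3 : IsCompactOperator (T * (F * (1 - c)) : H →L[ℂ] H) := a1.clm_comp T
      exact a2.sub a3
    · have e1 : (F * T - T * F) - (F * (1 - c) * T - T * (F * (1 - c)))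
          = (F * c) * T - T * (F * c) := by noncomm_ring
      rw [e1]
      have hcc' : c * (c * (1 + ((((n : ℝ) + 1) ^ 2 - 1 : ℝ) : ℂ) • (g * g))) = 1 := by
        rw [← mul_assoc, hcc]
      refine commutator_norm_le (g := g * c) (X := X) hn ?_ ?_ ?_ (hc.comp_clm c) ?_ ?_ hT ?_
      · rw [IsSelfAdjoint, star_mul, hF.star_eq, hcs.star_eq, hcF]
      · exact Commute.mul_nonneg hg hc0 hcg.symm
      · intro x hx
        have h2 : c x = 0 := hi _ hx
        have h3 : (c * (1 + ((((n : ℝ) + 1) ^ 2 - 1 : ℝ) : ℂ) • (g * g)) * c) x = x := by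
          have e2 : (1 + ((((n : ℝ) + 1) ^ 2 - 1 : ℝ) : ℂ) • (g * g)) * c
              = c * (1 + ((((n : ℝ) + 1) ^ 2 - 1 : ℝ) : ℂ) • (g * g)) := by
            rw [mul_add, add_mul, smul_mul_assoc, mul_smul_comm, mul_one, one_mul]
            congr 2
            rw [mul_assoc, ← hcg, ← mul_assoc, ← hcg, mul_assoc]
          rw [mul_assoc, e2, hcc']; rfl
        rw [mul_apply_eq_comp, h2, map_zero] at h3
        exact h3.symm
      · calc F * c * (g * c) = F * (c * g) * c := by simp only [mul_assoc]
          _ = F * g * (c * c) := by rw [hcg]; simp only [mul_assoc]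
          _ = g * (F * c) * c := by rw [hFg]; simp only [mul_assoc]
          _ = g * (c * F) * c := by rw [hcF]
          _ = g * c * (F * c) := by simp only [mul_assoc]
      · have e2 : F * c * (F * c) = c * c * (F * F) := by
          rw [← hcF, mul_assoc, ← mul_assoc F, ← hcF, mul_assoc, mul_assoc]
        have e3 : g * c * (g * c) = c * c * (g * g) := by
          rw [← hcg, mul_assoc, ← mul_assoc g, ← hcg, mul_assoc, mul_assoc]
        rw [e2, e3, ← mul_smul_comm, ← mul_add, ← hcc]
        congr 1
        rw [← h1]
        push_cast
        module
      · have e2 : g * c * X * (g * c) = c * (g * X * g) * c := by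
          calc g * c * X * (g * c) = c * g * X * (g * c) := by rw [hcg]
            _ = _ := by simp only [mul_assoc]
        rw [e2, hX, mul_sub, sub_mul, ← hcF, ← hcg]
        congr 1
        · rw [hcg]; simp only [mul_assoc]
        · rw [hcF]; simp only [mul_assoc]
  choose K hK hK' using happ
  refine isCompactOperator_of_tendsto (l := atTop) (F := K) ?_ (Eventually.of_forall hK)
  rw [tendsto_iff_norm_sub_tendsto_zero]
  refine squeeze_zero (fun _ => norm_nonneg _) (fun n => ?_)
    (g := fun n : ℕ => 3 * ‖X‖ * (1 / ((n : ℝ) + 1))) ?_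
  · rw [norm_sub_rev, mul_one_div]; exact hK' n
  · have := (tendsto_one_div_add_atTop_nhds_zero_nat (𝕜 := ℝ)).const_mul (3 * ‖X‖)
    rwa [mul_zero] at this

/-- If `[D, T]` is bounded and `F = D g`, `g = (1 + D²)^(-1/2)` compact, then `[F, T]` is compact. -/
theorem isCompactOperator_commutator {F g T X : H →L[ℂ] H}
    (hF : IsSelfAdjoint F) (hg : 0 ≤ g) (hi : ∀ x, g x = 0 → x = 0) (hc : IsCompactOperator g)
    (hFg : F * g = g * F) (h1 : F * F + g * g = 1)
    (hX : g * X * g = F * T * g - g * T * F) :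
    IsCompactOperator (F * T - T * F : H →L[ℂ] H) := by
  have hgs := ((ContinuousLinearMap.nonneg_iff_isPositive g).mp hg).isSelfAdjoint
  have hX' : g * star X * g = g * star T * F - F * star T * g := by
    have := congrArg star hX
    simp only [star_mul, star_sub, hgs.star_eq, hF.star_eq] at this
    simpa only [mul_assoc] using this
  -- As `[D, T*] = -[D, T]*`, the commutators attached to `T + T*` and `i(T - T*)` are `X - X*` and
  -- `i(X + X*)`.
  have c1 : IsCompactOperator (F * (T + star T) - (T + star T) * F : H →L[ℂ] H) :=
    isCompactOperator_commutator_of_isSelfAdjoint (X := X - star X) hF hg hi hc hFg h1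
      (by rw [IsSelfAdjoint, star_add, star_star, add_comm]) (by
        rw [mul_sub, sub_mul, hX, hX']; noncomm_ring)
  have c2 : IsCompactOperator (F * (Complex.I • (T - star T)) - (Complex.I • (T - star T)) * F :
      H →L[ℂ] H) :=
    isCompactOperator_commutator_of_isSelfAdjoint (X := Complex.I • (X + star X)) hF hg hi hc hFg h1
      (by rw [IsSelfAdjoint, star_smul, star_sub, star_star, RCLike.star_def, Complex.conj_I,
        neg_smul, ← smul_neg, neg_sub]) (by
        simp only [mul_smul_comm, smul_mul_assoc, mul_add, add_mul, hX, hX', mul_sub, sub_mul,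
          ← smul_sub]
        congr 1
        abel)
  have c3 := (c1.smul (1 / 2 : ℂ)).sub (c2.smul (Complex.I / 2 : ℂ))
  have e : (F * T - T * F) = (1 / 2 : ℂ) • (F * (T + star T) - (T + star T) * F)
      - (Complex.I / 2 : ℂ) • (F * (Complex.I • (T - star T)) - (Complex.I • (T - star T)) * F) := by
    simp only [mul_smul_comm, smul_mul_assoc, ← smul_sub, smul_smul]
    rw [show Complex.I / 2 * Complex.I = -(1 / 2 : ℂ) by
      rw [div_mul_eq_mul_div, Complex.I_mul_I]; ring]
    rw [neg_smul, sub_neg_eq_add, ← smul_add]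
    rw [show (F * (T + star T) - (T + star T) * F + (F * (T - star T) - (T - star T) * F))
      = (2 : ℂ) • (F * T - T * F) by rw [two_smul]; noncomm_ring, smul_smul]
    norm_num
  rw [e]
  exact c3

end CompactCommutator

/-! ### Selfadjoint operators through their graphs -/

section SelfAdjoint

open Filter Topology

variable {H : Type u} [NormedAddCommGroup H] [InnerProductSpace ℂ H]

theorem exists_apply_eq_iff {D : H →ₗ.[ℂ] H} {x y : H} :
    (∃ h : x ∈ D.domain, D ⟨x, h⟩ = y) ↔ (x, y) ∈ D.graph := by
  rw [LinearPMap.mem_graph_iff]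
  constructor
  · rintro ⟨h, rfl⟩
    exact ⟨⟨x, h⟩, rfl, rfl⟩
  · rintro ⟨⟨z, hz⟩, h1, h2⟩
    obtain rfl : z = x := h1
    exact ⟨hz, h2⟩

theorem graph_unique {D : H →ₗ.[ℂ] H} {x y z : H} (h : (x, y) ∈ D.graph) (h' : (x, z) ∈ D.graph) :
    y = z := by
  obtain ⟨_, h1⟩ := exists_apply_eq_iff.mpr h
  obtain ⟨_, h2⟩ := exists_apply_eq_iff.mpr h'
  rw [← h1, ← h2]

theorem graph_add {D : H →ₗ.[ℂ] H} {x y x' y' : H} (h : (x, y) ∈ D.graph)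
    (h' : (x', y') ∈ D.graph) : (x + x', y + y') ∈ D.graph := D.graph.add_mem h h'

theorem graph_sub {D : H →ₗ.[ℂ] H} {x y x' y' : H} (h : (x, y) ∈ D.graph)
    (h' : (x', y') ∈ D.graph) : (x - x', y - y') ∈ D.graph := D.graph.sub_mem h h'

theorem graph_smul {D : H →ₗ.[ℂ] H} {x y : H} (c : ℂ) (h : (x, y) ∈ D.graph) :
    (c • x, c • y) ∈ D.graph := D.graph.smul_mem c h

theorem graph_neg {D : H →ₗ.[ℂ] H} {x y : H} (h : (x, y) ∈ D.graph) :
    (-x, -y) ∈ D.graph := D.graph.neg_mem h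

/-- Two bounded operators that agree on a dense domain are equal. -/
theorem comm_eq_of_isCommutator {S : H →ₗ.[ℂ] H} (hS : Dense (S.domain : Set H))
    {T X Y : H →L[ℂ] H} (h : IsCommutator S T X) (h' : IsCommutator S T Y) : X = Y := by
  ext x
  refine hS.induction (P := fun x => X x = Y x) (fun x hx => ?_) ?_ x
  · obtain ⟨h1, h2⟩ := h ⟨x, hx⟩
    obtain ⟨h3, h4⟩ := h' ⟨x, hx⟩
    rw [← h2, ← h4]
  · exact isClosed_eq X.continuous Y.continuous

theorem sqRel_iff {D : H →ₗ.[ℂ] H} {x z : H} :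
    SqRel D x z ↔ ∃ y, (x, y) ∈ D.graph ∧ (y, z) ∈ D.graph := by
  constructor
  · rintro ⟨h, h', e⟩
    exact ⟨_, exists_apply_eq_iff.mp ⟨h, rfl⟩, exists_apply_eq_iff.mp ⟨h', e⟩⟩
  · rintro ⟨y, h1, h2⟩
    obtain ⟨h, rfl⟩ := exists_apply_eq_iff.mpr h1
    obtain ⟨h', e⟩ := exists_apply_eq_iff.mpr h2
    exact ⟨h, h', e⟩

theorem isCommutator_iff {D : H →ₗ.[ℂ] H} {T X : H →L[ℂ] H} :
    IsCommutator D T X ↔ ∀ x y, (x, y) ∈ D.graph → (T x, T y + X x) ∈ D.graph := by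
  constructor
  · intro h x y hxy
    obtain ⟨hx, rfl⟩ := exists_apply_eq_iff.mpr hxy
    obtain ⟨h1, h2⟩ := h ⟨x, hx⟩
    exact exists_apply_eq_iff.mp ⟨h1, by rw [← h2]; abel⟩
  · intro h x
    obtain ⟨h1, h2⟩ := exists_apply_eq_iff.mpr (h x (D x) (D.mem_graph x))
    exact ⟨h1, by rw [h2]; abel⟩

theorem isGradedCommutator_iff {D : H →ₗ.[ℂ] H} {ε T X : H →L[ℂ] H} :
    IsGradedCommutator D ε T X ↔
      ∀ x y, (x, y) ∈ D.graph → (T x, (ε * T * ε) y + X x) ∈ D.graph := by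
  constructor
  · intro h x y hxy
    obtain ⟨hx, rfl⟩ := exists_apply_eq_iff.mpr hxy
    obtain ⟨h1, h2⟩ := h ⟨x, hx⟩
    exact exists_apply_eq_iff.mp ⟨h1, by rw [← h2]; abel⟩
  · intro h x
    obtain ⟨h1, h2⟩ := exists_apply_eq_iff.mpr (h x (D x) (D.mem_graph x))
    exact ⟨h1, by rw [h2]; abel⟩

theorem mem_powDomain_succ {D : H →ₗ.[ℂ] H} {n : ℕ} {x : H} :
    x ∈ powDomain D (n + 1) ↔ ∃ y, (x, y) ∈ D.graph ∧ y ∈ powDomain D n := by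
  simp only [powDomain, Submodule.mem_map, Submodule.mem_comap]
  constructor
  · rintro ⟨z, hz, rfl⟩
    exact ⟨_, D.mem_graph z, hz⟩
  · rintro ⟨y, hxy, hy⟩
    obtain ⟨hx, rfl⟩ := exists_apply_eq_iff.mpr hxy
    exact ⟨⟨x, hx⟩, hy, rfl⟩

theorem smoothDomain_le_domain (D : H →ₗ.[ℂ] H) : smoothDomain D ≤ D.domain := by
  intro x hx
  obtain ⟨y, hy, -⟩ := mem_powDomain_succ.mp ((Submodule.mem_iInf _).mp hx 1)
  exact (exists_apply_eq_iff.mpr hy).1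

theorem apply_mem_smoothDomain {D : H →ₗ.[ℂ] H} {x y : H} (hx : x ∈ smoothDomain D)
    (hxy : (x, y) ∈ D.graph) : y ∈ smoothDomain D := by
  refine (Submodule.mem_iInf _).mpr fun n => ?_
  obtain ⟨y', hy', hn⟩ := mem_powDomain_succ.mp ((Submodule.mem_iInf _).mp hx (n + 1))
  rwa [graph_unique hxy hy']

/-- A subspace of the domain which is invariant under `D` lies in the smooth domain. -/
theorem mem_smoothDomain_of_invariant {D : H →ₗ.[ℂ] H} (V : Set H)
    (hV : ∀ x ∈ V, ∃ y ∈ V, (x, y) ∈ D.graph) {x : H} (hx : x ∈ V) : x ∈ smoothDomain D := by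
  refine (Submodule.mem_iInf _).mpr fun n => ?_
  induction n generalizing x with
  | zero => trivial
  | succ n ih =>
    obtain ⟨y, hy, hxy⟩ := hV x hx
    exact mem_powDomain_succ.mpr ⟨y, hxy, ih hy⟩

variable [CompleteSpace H]

theorem IsGrading.graph {ε : H →L[ℂ] H} {D : H →ₗ.[ℂ] H} (h : IsGrading ε D) {x y : H}
    (hxy : (x, y) ∈ D.graph) : (ε x, -ε y) ∈ D.graph := by
  obtain ⟨hx, rfl⟩ := exists_apply_eq_iff.mpr hxy
  exact exists_apply_eq_iff.mp (h.anticomm ⟨x, hx⟩)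

theorem IsGrading.apply_apply {ε : H →L[ℂ] H} {D : H →ₗ.[ℂ] H} (h : IsGrading ε D) (x : H) :
    ε (ε x) = x :=
  congrArg (fun S : H →L[ℂ] H => S x) h.mul_self

variable {D : H →ₗ.[ℂ] H}

theorem graph_symm (hD : IsSelfAdjoint D) {x x' y y' : H} (h : (x, x') ∈ D.graph)
    (h' : (y, y') ∈ D.graph) : inner ℂ x' y = inner ℂ x y' := by
  obtain ⟨hx, rfl⟩ := exists_apply_eq_iff.mpr h
  obtain ⟨hy, rfl⟩ := exists_apply_eq_iff.mpr h'
  have h1 := D.adjoint_isFormalAdjoint hD.dense_domain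
  rw [LinearPMap.isSelfAdjoint_def.mp hD] at h1
  exact h1 ⟨x, hx⟩ ⟨y, hy⟩

theorem mem_graph_of_forall (hD : IsSelfAdjoint D) {y w : H}
    (h : ∀ x x', (x, x') ∈ D.graph → inner ℂ w x = inner ℂ y x') : (y, w) ∈ D.graph := by
  have h1 : ∀ x : D.domain, inner ℂ w (x : H) = inner ℂ y (D x) :=
    fun x => h x (D x) (D.mem_graph x)
  have h2 : ∃ hy : y ∈ D.adjoint.domain, D.adjoint ⟨y, hy⟩ = w :=
    ⟨D.mem_adjoint_domain_of_exists y ⟨w, h1⟩, D.adjoint_apply_eq hD.dense_domain _ h1⟩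
  rw [LinearPMap.isSelfAdjoint_def.mp hD] at h2
  exact exists_apply_eq_iff.mp h2

/-- This is the definition of the domain of the adjoint, read through `D* = D`. -/
theorem mem_graph_of_bound (hD : IsSelfAdjoint D) {y : H} {C : ℝ}
    (h : ∀ x x', (x, x') ∈ D.graph → ‖inner ℂ y x'‖ ≤ C * ‖x‖) : ∃ w, (y, w) ∈ D.graph := by
  have h1 : y ∈ D.adjoint.domain := by
    rw [LinearPMap.mem_adjoint_domain_iff]
    exact AddMonoidHomClass.continuous_of_bound _ C fun x => h x (D x) (D.mem_graph x)
  rw [LinearPMap.isSelfAdjoint_def.mp hD] at h1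
  exact ⟨_, D.mem_graph ⟨y, h1⟩⟩

/-- Von Neumann's argument: project `(x, 0)` orthogonally onto the closed graph of `D` in `H ⊕ H`,
obtaining `(u, Du)`. Orthogonality to the graph reads `⟨x - u, z⟩ = ⟨Du, Dz⟩`, so `Du ∈ Dom D* = Dom
D` and `D²u = x - u`. -/
theorem exists_resolvent (hD : IsSelfAdjoint D) :
    ∃ R : H →L[ℂ] H, ∀ x : H, ∃ y : H, SqRel D (R x) y ∧ R x + y = x := by
  let e := WithLp.prodContinuousLinearEquiv 2 ℂ H H
  let K : Submodule ℂ (WithLp 2 (H × H)) := D.graph.comap (e : WithLp 2 (H × H) →ₗ[ℂ] H × H)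
  have hcl : IsClosed (K : Set (WithLp 2 (H × H))) := by
    have h1 : IsClosed (D.graph : Set (H × H)) := hD.isClosed
    exact h1.preimage e.continuous
  have : CompleteSpace K := hcl.completeSpace_coe
  let P : H →L[ℂ] WithLp 2 (H × H) :=
    K.starProjection.comp ((e.symm : H × H →L[ℂ] WithLp 2 (H × H)).comp
      (ContinuousLinearMap.inl ℂ H H))
  have hP : ∀ x, P x = K.starProjection (e.symm (x, 0)) := fun x => rfl
  refine ⟨(ContinuousLinearMap.fst ℂ H H).comp
    ((e : WithLp 2 (H × H) →L[ℂ] H × H).comp P), fun x => ?_⟩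
  have h1 : ((e (P x)).1, (e (P x)).2) ∈ D.graph := by
    have : P x ∈ K := K.starProjection_apply_mem _
    exact this
  refine ⟨x - (e (P x)).1, sqRel_iff.mpr ⟨(e (P x)).2, h1, ?_⟩, by simp⟩
  refine mem_graph_of_forall hD fun z z' hz => ?_
  have h2 : e.symm (z, z') ∈ K := hz
  have h3 := K.starProjection_inner_eq_zero (e.symm (x, 0)) _ h2
  rw [← hP, WithLp.prod_inner_apply] at h3
  have h4 : inner ℂ (x - (e (P x)).1) z + inner ℂ (0 - (e (P x)).2) z' = 0 := h3
  rw [zero_sub, inner_neg_left] at h4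
  exact add_neg_eq_zero.mp h4

theorem resolvent_spec (hD : IsSelfAdjoint D) (x : H) :
    ∃ y, (invOneAddSq D x, y) ∈ D.graph ∧ (y, x - invOneAddSq D x) ∈ D.graph := by
  obtain ⟨z, h1, h2⟩ := Classical.epsilon_spec (exists_resolvent hD) x
  obtain ⟨y, h3, h4⟩ := sqRel_iff.mp h1
  refine ⟨y, h3, ?_⟩
  have : x - invOneAddSq D x = z := sub_eq_of_eq_add' h2.symm
  rwa [this]

/-- The difference `a` of two solutions satisfies `Da = b`, `Db = -a`, and symmetry of `D` gives
`‖b‖² = -‖a‖²`. -/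
theorem resolvent_unique (hD : IsSelfAdjoint D) {u v x : H} (h1 : (u, v) ∈ D.graph)
    (h2 : (v, x - u) ∈ D.graph) : invOneAddSq D x = u := by
  obtain ⟨y, h3, h4⟩ := resolvent_spec hD x
  have h5 := graph_sub h3 h1
  have h6 := graph_sub h4 h2
  have h7 := graph_symm hD h5 h6
  set a := invOneAddSq D x - u with ha
  rw [show x - invOneAddSq D x - (x - u) = -a by rw [ha]; abel, inner_neg_right,
    inner_self_eq_norm_sq_to_K, inner_self_eq_norm_sq_to_K] at h7
  have h8 : ‖y - v‖ ^ 2 = -‖a‖ ^ 2 := by exact_mod_cast h7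
  have h9 : ‖a‖ ^ 2 = 0 := by nlinarith [sq_nonneg ‖y - v‖, sq_nonneg ‖a‖]
  exact sub_eq_zero.mp (norm_eq_zero.mp (pow_eq_zero_iff two_ne_zero |>.mp h9))

theorem resolvent_inner (hD : IsSelfAdjoint D) {x x' y y' : H}
    (h : (invOneAddSq D x, x') ∈ D.graph) (h' : (y', y - invOneAddSq D y) ∈ D.graph) :
    inner ℂ (invOneAddSq D x) y
      = inner ℂ (invOneAddSq D x) (invOneAddSq D y) + inner ℂ x' y' := by
  rw [graph_symm hD h h', ← inner_add_right, add_sub_cancel]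

/-- By `resolvent_inner`, `⟨Rx, y⟩ = ⟨Rx, Ry⟩ + ⟨DRx, DRy⟩`, a hermitian and nonnegative form. -/
theorem resolvent_nonneg (hD : IsSelfAdjoint D) : 0 ≤ invOneAddSq D := by
  rw [ContinuousLinearMap.nonneg_iff_isPositive, ContinuousLinearMap.isPositive_def]
  constructor
  · intro x y
    obtain ⟨x', h1, h2⟩ := resolvent_spec hD x
    obtain ⟨y', h3, h4⟩ := resolvent_spec hD y
    have e1 := resolvent_inner hD h1 h4
    have e2 := resolvent_inner hD h3 h2
    have e3 := congrArg (starRingEnd ℂ) e2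
    rw [map_add, inner_conj_symm, inner_conj_symm, inner_conj_symm] at e3
    exact e1.trans e3.symm
  · intro x
    obtain ⟨x', h1, h2⟩ := resolvent_spec hD x
    rw [ContinuousLinearMap.reApplyInnerSelf, resolvent_inner hD h1 h2, map_add]
    exact add_nonneg inner_self_nonneg inner_self_nonneg

theorem resolvent_injective (hD : IsSelfAdjoint D) {x : H} (h : invOneAddSq D x = 0) : x = 0 := by
  obtain ⟨y, h1, h2⟩ := resolvent_spec hD x
  rw [h] at h1 h2
  have h3 : y = 0 := graph_unique h1 D.graph.zero_mem
  rw [h3, sub_zero] at h2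
  exact graph_unique h2 D.graph.zero_mem

theorem resolvent_graph (hD : IsSelfAdjoint D) {x x' : H} (h : (x, x') ∈ D.graph) :
    (invOneAddSq D x, invOneAddSq D x') ∈ D.graph := by
  obtain ⟨v, h1, h2⟩ := resolvent_spec hD x
  rwa [resolvent_unique hD h2 (graph_sub h h1)]

/-! ### The operators `(1 + D²)^(-1/2)` and `D(1 + D²)^(-1/2)` -/

theorem regInv_nonneg (D : H →ₗ.[ℂ] H) : 0 ≤ regInv D := CFC.sqrt_nonneg _

theorem regInv_isSelfAdjoint (D : H →ₗ.[ℂ] H) : IsSelfAdjoint (regInv D) :=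
  ((ContinuousLinearMap.nonneg_iff_isPositive _).mp (regInv_nonneg D)).isSelfAdjoint

theorem regInv_mul_self (hD : IsSelfAdjoint D) : regInv D * regInv D = invOneAddSq D :=
  CFC.sqrt_mul_sqrt_self _ (resolvent_nonneg hD)

theorem regInv_apply_apply (hD : IsSelfAdjoint D) (x : H) :
    regInv D (regInv D x) = invOneAddSq D x :=
  congrArg (fun S : H →L[ℂ] H => S x) (regInv_mul_self hD)

theorem regInv_injective (hD : IsSelfAdjoint D) {x : H} (h : regInv D x = 0) : x = 0 := by
  apply resolvent_injective hD
  rw [← regInv_apply_apply hD, h, map_zero]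

theorem regInv_comm {B : H →L[ℂ] H} (h : invOneAddSq D * B = B * invOneAddSq D) :
    regInv D * B = B * regInv D :=
  (Commute.cfcₙ_nnreal (show Commute (invOneAddSq D) B from h) NNReal.sqrt).eq

/-- Bounded operators are determined by their product with `⟨D⟩⁻¹`. -/
theorem eq_of_mul_regInv (hD : IsSelfAdjoint D) {S T : H →L[ℂ] H}
    (h : S * regInv D = T * regInv D) : S = T := by
  rw [← sub_eq_zero, ← star_eq_zero]
  ext x
  apply regInv_injective hD
  have h1 : regInv D * star (S - T) = 0 := by
    have : star ((S - T) * regInv D) = 0 := by rw [sub_mul, h, sub_self, star_zero]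
    rwa [star_mul, (regInv_isSelfAdjoint D).star_eq] at this
  exact congrArg (fun S : H →L[ℂ] H => S x) h1

/-- With `R = g²`, which commutes with `D`: `‖gDx‖² = ⟨Dx, DRx⟩ = ⟨x, D²Rx⟩ = ⟨x, x - Rx⟩ ≤ ‖x‖²`.
-/
theorem norm_regInv_apply_le (hD : IsSelfAdjoint D) {x x' : H} (h : (x, x') ∈ D.graph) :
    ‖regInv D x'‖ ≤ ‖x‖ := by
  obtain ⟨v, h1, h2⟩ := resolvent_spec hD x
  have hv := graph_unique (resolvent_graph hD h) h1
  have h3 : inner ℂ (regInv D x') (regInv D x') = inner ℂ x x - inner ℂ x (invOneAddSq D x) := by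
    rw [isSelfAdjoint_apply (regInv_isSelfAdjoint D), regInv_apply_apply hD, hv,
      graph_symm hD h h2, inner_sub_right]
  have h4 := congrArg Complex.re h3
  have h5 : ∀ y : H, (inner ℂ y y : ℂ).re = ‖y‖ ^ 2 := inner_self_eq_norm_sq (𝕜 := ℂ)
  rw [Complex.sub_re, h5, h5] at h4
  have h6 : 0 ≤ (inner ℂ x (invOneAddSq D x)).re :=
    ((ContinuousLinearMap.nonneg_iff_isPositive _).mp (resolvent_nonneg hD)).re_inner_nonneg_right x
  exact le_of_sq_le_sq (by linarith) (norm_nonneg _)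

/-- The estimate `|⟨gx, Dy⟩| = |⟨x, gDy⟩| ≤ ‖x‖‖y‖` puts `gx` in `Dom D* = Dom D`, and the same
estimate, extended by density, bounds `Dgx` by `‖x‖`. -/
theorem exists_boundedTransform (hD : IsSelfAdjoint D) :
    ∃ F : H →L[ℂ] H, ∀ x : H, ∃ h : regInv D x ∈ D.domain, D ⟨regInv D x, h⟩ = F x := by
  have h1 : ∀ x, ∃ w, (regInv D x, w) ∈ D.graph := fun x =>
    mem_graph_of_bound hD (C := ‖x‖) fun y y' hy => by
      rw [isSelfAdjoint_apply (regInv_isSelfAdjoint D)]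
      refine (norm_inner_le_norm _ _).trans ?_
      gcongr
      exact norm_regInv_apply_le hD hy
  choose f hf using h1
  let F : H →ₗ[ℂ] H :=
    { toFun := f
      map_add' := fun x y => graph_unique (hf (x + y)) (by
        rw [map_add]; exact graph_add (hf x) (hf y))
      map_smul' := fun c x => graph_unique (hf (c • x)) (by
        rw [map_smul]; exact graph_smul c (hf x)) }
  have hd : Dense (D.domain : Set H) := hD.dense_domain
  refine ⟨F.mkContinuous 1 fun x => ?_, fun x => exists_apply_eq_iff.mpr (hf x)⟩
  rw [one_mul]
  change ‖f x‖ ≤ ‖x‖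
  have h2 : ∀ y : H, ‖inner ℂ (f x) y‖ ≤ ‖x‖ * ‖y‖ := by
    intro y
    refine hd.induction (P := fun y => ‖inner ℂ (f x) y‖ ≤ ‖x‖ * ‖y‖) ?_ ?_ y
    · intro y hy
      rw [graph_symm hD (hf x) (D.mem_graph ⟨y, hy⟩),
        isSelfAdjoint_apply (regInv_isSelfAdjoint D)]
      refine (norm_inner_le_norm _ _).trans ?_
      gcongr
      exact norm_regInv_apply_le hD (D.mem_graph ⟨y, hy⟩)
    · exact isClosed_le (by fun_prop) (by fun_prop)
  have h3 := h2 (f x)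
  rw [inner_self_eq_norm_sq_to_K] at h3
  by_cases h4 : ‖f x‖ = 0
  · rw [h4]; exact norm_nonneg _
  · have h5 : 0 < ‖f x‖ := lt_of_le_of_ne (norm_nonneg _) (Ne.symm h4)
    simp only [Complex.coe_algebraMap, norm_pow, Complex.norm_real, norm_norm] at h3
    rw [sq] at h3
    exact le_of_mul_le_mul_right h3 h5

theorem boundedTransform_graph (hD : IsSelfAdjoint D) (x : H) :
    (regInv D x, boundedTransform D x) ∈ D.graph :=
  exists_apply_eq_iff.mp (Classical.epsilon_spec (exists_boundedTransform hD) x)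

theorem regInv_apply_eq (hD : IsSelfAdjoint D) {x x' : H} (h : (x, x') ∈ D.graph)
    (hF : IsSelfAdjoint (boundedTransform D)) : regInv D x' = boundedTransform D x := by
  refine ext_inner_right ℂ fun v => ?_
  rw [isSelfAdjoint_apply (regInv_isSelfAdjoint D), isSelfAdjoint_apply hF,
    graph_symm hD h (boundedTransform_graph hD v)]

/-- The product `Fg = DR` commutes with the resolvent `R`, hence with `g = √R`; then `(Fg)g =
(gF)g`, and `g` can be cancelled on the right. -/
theorem boundedTransform_comm (hD : IsSelfAdjoint D) :
    boundedTransform D * regInv D = regInv D * boundedTransform D := by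
  have h1 : invOneAddSq D * (boundedTransform D * regInv D)
      = boundedTransform D * regInv D * invOneAddSq D := by
    ext x
    have h2 : ∀ y, (invOneAddSq D y, boundedTransform D (regInv D y)) ∈ D.graph := fun y => by
      rw [← regInv_apply_apply hD]; exact boundedTransform_graph hD _
    exact graph_unique (resolvent_graph hD (h2 x)) (h2 (invOneAddSq D x))
  refine eq_of_mul_regInv hD ?_
  rw [← regInv_comm h1, mul_assoc]

/-- Symmetry of `D` on the range of `g` gives `F*g = gF = Fg`; cancel `g`. -/
theorem boundedTransform_isSelfAdjoint (hD : IsSelfAdjoint D) :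
    IsSelfAdjoint (boundedTransform D) := by
  refine eq_of_mul_regInv hD ?_
  rw [boundedTransform_comm hD]
  ext x
  refine ext_inner_right ℂ fun y => ?_
  have h1 := graph_symm hD (boundedTransform_graph hD y) (boundedTransform_graph hD x)
  rw [mul_apply_eq_comp, mul_apply_eq_comp, isSelfAdjoint_apply (regInv_isSelfAdjoint D),
    ContinuousLinearMap.star_eq_adjoint, ContinuousLinearMap.adjoint_inner_left]
  have h2 := congrArg (starRingEnd ℂ) h1
  rw [inner_conj_symm, inner_conj_symm] at h2
  exact h2

theorem boundedTransform_sq (hD : IsSelfAdjoint D) :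
    boundedTransform D * boundedTransform D + regInv D * regInv D = 1 := by
  ext x
  obtain ⟨v, h1, h2⟩ := resolvent_spec hD x
  have h3 := boundedTransform_graph hD (regInv D x)
  rw [regInv_apply_apply hD] at h3
  rw [graph_unique h1 h3] at h2
  have h4 : boundedTransform D (regInv D x) = regInv D (boundedTransform D x) :=
    congrArg (fun S : H →L[ℂ] H => S x) (boundedTransform_comm hD)
  rw [h4] at h2
  have h5 := graph_unique h2 (boundedTransform_graph hD (boundedTransform D x))
  rw [regInv_mul_self hD, add_apply, mul_apply_eq_comp, ← h5, one_apply_eq_self,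
    sub_add_cancel]

/-- Apply `g` to `DTgx = TDgx + Xgx` and use `gD ⊆ F`. The result is the only trace of `D` that the
compactness argument needs. -/
theorem regInv_mul_commutator_mul (hD : IsSelfAdjoint D) {T X : H →L[ℂ] H}
    (h : IsCommutator D T X) : regInv D * X * regInv D
      = boundedTransform D * T * regInv D - regInv D * T * boundedTransform D := by
  ext x
  have h1 := isCommutator_iff.mp h _ _ (boundedTransform_graph hD x)
  have h2 := regInv_apply_eq hD h1 (boundedTransform_isSelfAdjoint hD)
  rw [map_add] at h2
  exact eq_sub_of_add_eq' h2

theorem isCompactOperator_boundedTransform_commutator (hD : IsSelfAdjoint D)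
    (hc : IsCompactOperator (regInv D)) {T X : H →L[ℂ] H} (h : IsCommutator D T X) :
    IsCompactOperator (boundedTransform D * T - T * boundedTransform D : H →L[ℂ] H) :=
  isCompactOperator_commutator (boundedTransform_isSelfAdjoint hD) (regInv_nonneg D)
    (fun _ => regInv_injective hD) hc (boundedTransform_comm hD) (boundedTransform_sq hD)
    (regInv_mul_commutator_mul hD h)

theorem regInv_graph (hD : IsSelfAdjoint D) {x x' : H} (h : (x, x') ∈ D.graph) :
    (regInv D x, regInv D x') ∈ D.graph := by
  rw [regInv_apply_eq hD h (boundedTransform_isSelfAdjoint hD)]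
  exact boundedTransform_graph hD x

theorem regInv_mem_smoothDomain (hD : IsSelfAdjoint D) {x : H} (hx : x ∈ smoothDomain D) :
    regInv D x ∈ smoothDomain D := by
  refine mem_smoothDomain_of_invariant (regInv D '' smoothDomain D) ?_ ⟨x, hx, rfl⟩
  rintro _ ⟨y, hy, rfl⟩
  have h1 := D.mem_graph ⟨y, smoothDomain_le_domain D hy⟩
  exact ⟨_, ⟨_, apply_mem_smoothDomain hy h1, rfl⟩, regInv_graph hD h1⟩

/-- Eigenspaces of the compact resolvent are stable under `D`, so they lie in `H_∞`, and together
they span a dense subspace. -/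
theorem dense_smoothDomain (hD : IsSelfAdjoint D) (hc : IsCompactOperator (regInv D)) :
    Dense (smoothDomain D : Set H) := by
  have hRc : IsCompactOperator (invOneAddSq D) := by
    rw [← regInv_mul_self hD]; exact hc.comp_clm (regInv D)
  have hRs := ((ContinuousLinearMap.nonneg_iff_isPositive _).mp (resolvent_nonneg hD)).isSelfAdjoint
  intro x
  refine mem_of_eigenspace_le hRs hRc (smoothDomain D).topologicalClosure
    (Submodule.isClosed_topologicalClosure _) (fun μ y hy => ?_) x
  refine Submodule.le_topologicalClosure _ ?_
  by_cases hμ : μ = 0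
  · rw [hμ, zero_smul] at hy
    rw [resolvent_injective hD hy]
    exact zero_mem _
  refine mem_smoothDomain_of_invariant {z | invOneAddSq D z = μ • z} (fun z hz => ?_) hy
  obtain ⟨v, h1, h2⟩ := resolvent_spec hD z
  -- Here `v = D R z = μ D z`, so `Dz = μ⁻¹ v`.
  refine ⟨μ⁻¹ • v, ?_, ?_⟩
  · have h3 := resolvent_graph hD h1
    rw [show invOneAddSq D z = μ • z from hz, map_smul, show invOneAddSq D z = μ • z from hz] at h3
    rw [show invOneAddSq D z = μ • z from hz] at h1
    have h4 := graph_unique h3 (graph_smul μ h1)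
    change invOneAddSq D (μ⁻¹ • v) = _
    rw [map_smul, h4, smul_comm]
  · have := graph_smul μ⁻¹ h1
    rwa [show invOneAddSq D z = μ • z from hz, inv_smul_smul₀ hμ] at this

/-- The smooth domain is a core: twisted commutators with `D` extend from it to the domain. -/
theorem graph_of_smoothDomain (hD : IsSelfAdjoint D) (hc : IsCompactOperator (regInv D))
    {T T' X : H →L[ℂ] H}
    (h : ∀ x y, x ∈ smoothDomain D → (x, y) ∈ D.graph → (T x, T' y + X x) ∈ D.graph) {x y : H}
    (hxy : (x, y) ∈ D.graph) : (T x, T' y + X x) ∈ D.graph := by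
  set g := regInv D
  set F := boundedTransform D
  -- The map `z ↦ (gz, Fz)` parametrizes the graph of `D`, with inverse `(x, y) ↦ gx + Fy`. It then
  -- suffices to let `z` run through the dense subspace `H_∞`, which `g` preserves.
  have hx : g (g x + F y) = x ∧ F (g x + F y) = y := by
    have h1 := boundedTransform_sq hD
    have h2 := boundedTransform_comm hD
    have h3 : ∀ z, F (F z) + g (g z) = z := fun z => congrArg (fun S : H →L[ℂ] H => S z) h1
    have h4 : ∀ z, F (g z) = g (F z) := fun z => congrArg (fun S : H →L[ℂ] H => S z) h2
    have h5 : g y = F x := regInv_apply_eq hD hxy (boundedTransform_isSelfAdjoint hD)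
    constructor
    · rw [map_add, ← h4, h5, add_comm]; exact h3 x
    · rw [map_add, h4, ← h5, add_comm]; exact h3 y
  have key : ∀ z, (T (g z), T' (F z) + X (g z)) ∈ D.graph := fun z => by
    refine (dense_smoothDomain hD hc).induction
      (P := fun z => (T (g z), T' (F z) + X (g z)) ∈ D.graph) ?_ ?_ z
    · intro z hz
      exact h _ _ (regInv_mem_smoothDomain hD hz) (boundedTransform_graph hD z)
    · have h1 : IsClosed (D.graph : Set (H × H)) := hD.isClosed
      exact h1.preimage (by fun_prop : Continuous fun z => (T (g z), T' (F z) + X (g z)))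
  have := key (g x + F y)
  rwa [hx.1, hx.2] at this

theorem IsGrading.resolvent_comm {ε : H →L[ℂ] H} (hε : IsGrading ε D) (hD : IsSelfAdjoint D) :
    invOneAddSq D * ε = ε * invOneAddSq D := by
  ext x
  obtain ⟨v, h1, h2⟩ := resolvent_spec hD x
  refine resolvent_unique hD (hε.graph h1) ?_
  have := graph_neg (hε.graph h2)
  rwa [neg_neg, map_sub] at this

theorem IsGrading.boundedTransform_anticomm {ε : H →L[ℂ] H} (hε : IsGrading ε D)
    (hD : IsSelfAdjoint D) : ε * boundedTransform D = -(boundedTransform D * ε) := by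
  ext x
  have h1 := hε.graph (boundedTransform_graph hD x)
  have h2 := boundedTransform_graph hD (ε x)
  have h3 : regInv D (ε x) = ε (regInv D x) :=
    congrArg (fun S : H →L[ℂ] H => S x) (regInv_comm (hε.resolvent_comm hD))
  rw [h3] at h2
  have h4 := graph_unique h1 h2
  exact neg_eq_iff_eq_neg.mp h4

end SelfAdjoint

/-! ### The conjugation of a cyclic trace vector -/

section Conjugation

variable {H : Type u} [NormedAddCommGroup H] [InnerProductSpace ℂ H] [CompleteSpace H]

/-- The orbit of a vector under a `*`-algebra of operators. -/
def orbit (S : StarSubalgebra ℂ (H →L[ℂ] H)) (Φ : H) : Submodule ℂ H where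
  carrier := {x | ∃ w ∈ S, x = w Φ}
  add_mem' := by
    rintro _ _ ⟨u, hu, rfl⟩ ⟨v, hv, rfl⟩
    exact ⟨u + v, add_mem hu hv, rfl⟩
  zero_mem' := ⟨0, zero_mem S, rfl⟩
  smul_mem' := by
    rintro c _ ⟨u, hu, rfl⟩
    exact ⟨c • u, SMulMemClass.smul_mem c hu, rfl⟩

theorem mem_orbit {S : StarSubalgebra ℂ (H →L[ℂ] H)} {w : H →L[ℂ] H} (hw : w ∈ S) (Φ : H) :
    w Φ ∈ orbit S Φ := ⟨w, hw, rfl⟩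

/-- The trace identity makes `uΦ ↦ u*Φ` well defined and isometric on the dense orbit; the
involution and inner product identities pass to the continuous extension. -/
theorem exists_conjugation (S : StarSubalgebra ℂ (H →L[ℂ] H)) (Φ : H)
    (hd : Dense (orbit S Φ : Set H))
    (htr : ∀ u ∈ S, ∀ v ∈ S, inner ℂ (v Φ) (u Φ) = inner ℂ ((star u) Φ) ((star v) Φ)) :
    ∃ J : H ≃ₗᵢ⋆[ℂ] H, (∀ u ∈ S, J (u Φ) = (star u) Φ) ∧ (∀ x, J (J x) = x) ∧
      ∀ x y, inner ℂ (J x) (J y) = inner ℂ y x := by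
  have hnorm : ∀ u ∈ S, ‖(star u) Φ‖ = ‖u Φ‖ := by
    intro u hu
    have h1 := congrArg Complex.re (htr u hu u hu)
    have h2 : ∀ y : H, (inner ℂ y y : ℂ).re = ‖y‖ ^ 2 := inner_self_eq_norm_sq (𝕜 := ℂ)
    rw [h2, h2] at h1
    exact ((sq_eq_sq₀ (norm_nonneg _) (norm_nonneg _)).mp h1).symm
  have hwell : ∀ u ∈ S, ∀ v ∈ S, u Φ = v Φ → (star u) Φ = (star v) Φ := by
    intro u hu v hv h
    have h1 := hnorm (u - v) (sub_mem hu hv)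
    rw [sub_apply, h, sub_self, norm_zero, norm_eq_zero, star_sub, sub_apply] at h1
    exact sub_eq_zero.mp h1
  -- Representatives are arbitrary; `hwell` shows that `(star w) Φ` depends only on `w Φ`.
  choose w hw hwx using fun x : orbit S Φ => x.2
  let f : orbit S Φ →ₛₗ[starRingEnd ℂ] H :=
    { toFun := fun x => (star (w x)) Φ
      map_add' := fun x y => by
        rw [← add_apply, ← star_add]
        refine hwell _ (hw _) _ (add_mem (hw x) (hw y)) ?_
        rw [add_apply, ← hwx, ← hwx, ← hwx]; rfl
      map_smul' := fun c x => by
        have : (starRingEnd ℂ) c • (star (w x)) Φ = (star (c • w x)) Φ := by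
          rw [star_smul]; rfl
        rw [this]
        refine hwell _ (hw _) _ (SMulMemClass.smul_mem c (hw x)) ?_
        rw [smul_apply, ← hwx, ← hwx]; rfl }
  have hf : ∀ (u : H →L[ℂ] H) (hu : u ∈ S), f ⟨u Φ, mem_orbit hu Φ⟩ = (star u) Φ := fun u hu =>
    hwell _ (hw _) _ hu (hwx ⟨u Φ, mem_orbit hu Φ⟩).symm
  let f' : orbit S Φ →SL[starRingEnd ℂ] H := f.mkContinuous 1 fun x => by
    obtain ⟨_, u, hu, rfl⟩ := x
    rw [hf u hu, hnorm u hu, one_mul]; rfl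
  have hdr : DenseRange (orbit S Φ).subtypeL := by
    rw [DenseRange]
    convert hd
    exact Subtype.range_coe
  have hui : IsUniformInducing (orbit S Φ).subtypeL := isUniformEmbedding_subtype_val.isUniformInducing
  let J₀ : H →SL[starRingEnd ℂ] H := f'.extend (orbit S Φ).subtypeL
  have hJ₀ : ∀ u ∈ S, J₀ (u Φ) = (star u) Φ := fun u hu =>
    (f'.extend_eq hdr hui ⟨u Φ, mem_orbit hu Φ⟩).trans (hf u hu)
  have hinv : ∀ x, J₀ (J₀ x) = x := by
    intro x
    refine hd.induction (P := fun x => J₀ (J₀ x) = x) ?_ ?_ x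
    · rintro _ ⟨u, hu, rfl⟩
      rw [hJ₀ u hu, hJ₀ _ (star_mem hu), star_star]
    · exact isClosed_eq (by fun_prop) continuous_id
  have hinner : ∀ x y, inner ℂ (J₀ x) (J₀ y) = inner ℂ y x := by
    intro x y
    refine hd.induction (P := fun x => inner ℂ (J₀ x) (J₀ y) = inner ℂ y x) ?_ ?_ x
    · rintro _ ⟨u, hu, rfl⟩
      refine hd.induction (P := fun y => inner ℂ (J₀ (u Φ)) (J₀ y) = inner ℂ y (u Φ)) ?_ ?_ y
      · rintro _ ⟨v, hv, rfl⟩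
        rw [hJ₀ u hu, hJ₀ v hv, htr u hu v hv]
      · exact isClosed_eq (by fun_prop) (by fun_prop)
    · exact isClosed_eq (by fun_prop) (by fun_prop)
  refine ⟨{ toLinearEquiv := LinearEquiv.ofInvolutive (J₀ : H →ₛₗ[starRingEnd ℂ] H) hinv
            norm_map' := fun x => ?_ }, hJ₀, hinv, hinner⟩
  have h1 := congrArg Complex.re (hinner x x)
  have h2 : ∀ y : H, (inner ℂ y y : ℂ).re = ‖y‖ ^ 2 := inner_self_eq_norm_sq (𝕜 := ℂ)
  rw [h2, h2] at h1
  exact (sq_eq_sq₀ (norm_nonneg _) (norm_nonneg _)).mp h1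

theorem rightOp_apply (J : H ≃ₗᵢ⋆[ℂ] H) (T : H →L[ℂ] H) (x : H) :
    rightOp J T x = J ((star T) (J x)) := rfl

/-- The `*`-homomorphism `T^op ↦ J T* J`, for an antiunitary involution `J`. -/
def rightHom (J : H ≃ₗᵢ⋆[ℂ] H) (hJ : ∀ x, J (J x) = x)
    (hJi : ∀ x y, inner ℂ (J x) (J y) = inner ℂ y x) :
    (H →L[ℂ] H)ᵐᵒᵖ →⋆ₐ[ℂ] (H →L[ℂ] H) where
  toFun T := rightOp J T.unop
  map_one' := by
    ext x
    simp [rightOp_apply, hJ]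
  map_mul' S T := by
    ext x
    simp [rightOp_apply, hJ]
  map_zero' := by
    ext x
    simp [rightOp_apply]
  map_add' S T := by
    ext x
    simp [rightOp_apply]
  commutes' z := by
    ext x
    simp [rightOp_apply, hJ, Algebra.algebraMap_eq_smul_one, map_smulₛₗ]
  map_star' T := by
    ext x
    refine ext_inner_right ℂ fun y => ?_
    rw [ContinuousLinearMap.star_eq_adjoint, ContinuousLinearMap.adjoint_inner_left,
      rightOp_apply, rightOp_apply, MulOpposite.unop_star, star_star]
    rw [← hJ y, hJi, ← hJ x, hJi, hJ, hJ, ContinuousLinearMap.star_eq_adjoint,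
      ContinuousLinearMap.adjoint_inner_left]

/-! ### Right multiplication and the bicommutant -/

section Trace

variable {S : StarSubalgebra ℂ (H →L[ℂ] H)} {Φ : H} {J : H ≃ₗᵢ⋆[ℂ] H}

/-- `J v* J uΦ = J v* u* Φ = (v* u*)* Φ = uvΦ`: the conjugated operator is right multiplication by
`v`. -/
theorem rightOp_orbit (hJS : ∀ u ∈ S, J (u Φ) = (star u) Φ) {u v : H →L[ℂ] H} (hu : u ∈ S)
    (hv : v ∈ S) : rightOp J v (u Φ) = (u * v) Φ := by
  rw [rightOp_apply, hJS u hu]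
  change J ((star v * star u) Φ) = _
  rw [← star_mul, hJS _ (star_mem (mul_mem hu hv)), star_star]

theorem commute_rightOp (hd : Dense (orbit S Φ : Set H)) (hJS : ∀ u ∈ S, J (u Φ) = (star u) Φ)
    {u v : H →L[ℂ] H} (hu : u ∈ S) (hv : v ∈ S) : u * rightOp J v = rightOp J v * u := by
  ext x
  refine hd.induction (P := fun x => (u * rightOp J v) x = (rightOp J v * u) x) ?_ ?_ x
  · rintro _ ⟨t, ht, rfl⟩
    rw [mul_apply_eq_comp, mul_apply_eq_comp, rightOp_orbit hJS ht hv]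
    change (u * (t * v)) Φ = rightOp J v ((u * t) Φ)
    rw [rightOp_orbit hJS (mul_mem hu ht) hv, mul_assoc]
  · exact isClosed_eq (by fun_prop) (by fun_prop)

/-- Right multiplications `R_v = J v* J` lie in the commutant of `S`, so `T` commutes with them:
`⟨JTΦ|vΦ⟩ = ⟨v*Φ|TΦ⟩ = ⟨Φ|R_v TΦ⟩ = ⟨Φ|T vΦ⟩ = ⟨T*Φ|vΦ⟩`. No approximation of `T` by elements of `S`
is needed. -/
theorem conjugation_bicommutant (hd : Dense (orbit S Φ : Set H))
    (hJS : ∀ u ∈ S, J (u Φ) = (star u) Φ) (hJ : ∀ x, J (J x) = x)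
    (hJi : ∀ x y, inner ℂ (J x) (J y) = inner ℂ y x) {T : H →L[ℂ] H}
    (hT : T ∈ Set.centralizer (Set.centralizer (S : Set (H →L[ℂ] H)))) :
    J (T Φ) = (star T) Φ := by
  have hΦ : ∀ v ∈ S, rightOp J v Φ = v Φ := fun v hv => by
    have := rightOp_orbit hJS (one_mem S) hv
    rwa [one_mul] at this
  have hcomm : ∀ v ∈ S, ∀ x, rightOp J v (T x) = T (rightOp J v x) := fun v hv x => by
    have h1 : rightOp J v ∈ Set.centralizer (S : Set (H →L[ℂ] H)) :=
      fun u hu => commute_rightOp hd hJS hu hv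
    exact congrArg (fun R : H →L[ℂ] H => R x) (hT _ h1)
  refine ext_inner_right ℂ fun y => ?_
  refine hd.induction (P := fun y => inner ℂ (J (T Φ)) y = inner ℂ ((star T) Φ) y) ?_ ?_ y
  · rintro _ ⟨v, hv, rfl⟩
    have h1 : v Φ = J ((star v) Φ) := by rw [hJS _ (star_mem hv), star_star]
    have h2 : star (rightOp J v) = rightOp J (star v) :=
      (map_star (rightHom J hJ hJi) (MulOpposite.op v)).symm
    rw [h1, hJi, ← hΦ _ (star_mem hv), ← h2, ContinuousLinearMap.star_eq_adjoint,
      ContinuousLinearMap.adjoint_inner_left, hcomm v hv, hΦ v hv,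
      ContinuousLinearMap.star_eq_adjoint, ContinuousLinearMap.adjoint_inner_left,
      ← ContinuousLinearMap.star_eq_adjoint, h2, hΦ _ (star_mem hv), ← h1]
  · exact isClosed_eq (by fun_prop) (by fun_prop)

end Trace

/-! ### Twisting by the grading -/

section TwistOp

variable {H : Type u} [NormedAddCommGroup H] [InnerProductSpace ℂ H]

/-- The unitary `(1 + ε) / 2 - i (1 - ε) / 2`, equal to `1` on even and to `-i` on odd vectors. -/
def twistOp (ε : H →L[ℂ] H) : H →L[ℂ] H :=
  ((1 - Complex.I) / 2) • 1 + ((1 + Complex.I) / 2) • ε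

theorem commute_twistOp {ε T : H →L[ℂ] H} (h : ε * T = T * ε) :
    twistOp ε * T = T * twistOp ε := by
  simp only [twistOp, add_mul, mul_add, smul_mul_assoc, mul_smul_comm, one_mul, mul_one, h]

theorem twistOp_comm (ε : H →L[ℂ] H) : twistOp ε * ε = ε * twistOp ε := commute_twistOp rfl

end TwistOp

section Twist

variable {D : H →ₗ.[ℂ] H} {ε : H →L[ℂ] H}

theorem star_twistOp (hε : IsGrading ε D) :
    star (twistOp ε) = ((1 + Complex.I) / 2) • 1 + ((1 - Complex.I) / 2) • ε := by
  rw [twistOp, star_add, star_smul, star_smul, star_one, hε.star_eq]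
  congr 2 <;> simp [sub_eq_add_neg]

theorem twistOp_mem_unitary (hε : IsGrading ε D) : twistOp ε ∈ unitary (H →L[ℂ] H) := by
  have hI : Complex.I ^ 2 = -1 := Complex.I_sq
  have h1 : (1 - Complex.I) / 2 * ((1 + Complex.I) / 2) * 2 = 1 := by
    linear_combination (-1 / 2) * hI
  have h2 : ((1 - Complex.I) / 2) * ((1 - Complex.I) / 2)
      + ((1 + Complex.I) / 2) * ((1 + Complex.I) / 2) = 0 := by
    linear_combination (1 / 2) * hI
  have key : ∀ a b : ℂ, a * b * 2 = 1 → a * a + b * b = 0 →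
      (a • (1 : H →L[ℂ] H) + b • ε) * (b • 1 + a • ε) = 1 := by
    intro a b hab hab'
    have : (a • (1 : H →L[ℂ] H) + b • ε) * (b • 1 + a • ε)
        = (a * b) • 1 + (a * b) • (ε * ε) + (a * a + b * b) • ε := by
      simp only [mul_add, add_mul, smul_mul_smul_comm, one_mul, mul_one, add_smul, mul_comm b a]
      abel
    rw [this, hε.mul_self, hab', zero_smul, add_zero, ← add_smul, ← mul_two, hab, one_smul]
  rw [Unitary.mem_iff, star_twistOp hε]
  refine ⟨?_, key _ _ h1 h2⟩
  exact key _ _ (by linear_combination h1) (by linear_combination h2)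

/-- `T^op ↦ U J T* J U*`, where `U` is the twisting unitary: this is `J T* J` on even and
`-i J T* J ε` on odd operators `T`. -/
def twistedRightHom (hε : IsGrading ε D) (J : H ≃ₗᵢ⋆[ℂ] H) (hJ : ∀ x, J (J x) = x)
    (hJi : ∀ x y, inner ℂ (J x) (J y) = inner ℂ y x) : (H →L[ℂ] H)ᵐᵒᵖ →⋆ₐ[ℂ] (H →L[ℂ] H) :=
  ((Unitary.conjStarAlgAut ℂ (H →L[ℂ] H) ⟨twistOp ε, twistOp_mem_unitary hε⟩ :
    (H →L[ℂ] H) ≃⋆ₐ[ℂ] (H →L[ℂ] H)) : (H →L[ℂ] H) →⋆ₐ[ℂ] (H →L[ℂ] H)).comp (rightHom J hJ hJi)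

variable {J : H ≃ₗᵢ⋆[ℂ] H} {hJ : ∀ x, J (J x) = x}
  {hJi : ∀ x y, inner ℂ (J x) (J y) = inner ℂ y x} (hε : IsGrading ε D)

theorem twistedRightHom_apply (T : H →L[ℂ] H) :
    twistedRightHom hε J hJ hJi (MulOpposite.op T)
      = twistOp ε * rightOp J T * star (twistOp ε) := rfl

theorem twistedRightHom_injective : Function.Injective (twistedRightHom hε J hJ hJi) := by
  refine (Unitary.conjStarAlgAut ℂ (H →L[ℂ] H) ⟨twistOp ε, twistOp_mem_unitary hε⟩).injective.comp ?_
  intro S T h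
  refine MulOpposite.unop_injective (star_injective ?_)
  ext x
  have h1 := congrArg (fun R : H →L[ℂ] H => J (R (J x))) h
  change J (J ((star S.unop) (J (J x)))) = J (J ((star T.unop) (J (J x)))) at h1
  rwa [hJ, hJ, hJ] at h1

/-- Moving `U` past an odd operator replaces `ε` by `-ε` in it, and the result is `-i U ε`. -/
theorem anticommute_mul_twistOp {T : H →L[ℂ] H} (hε : IsGrading ε D) (h : ε * T = -(T * ε)) :
    T * twistOp ε = -Complex.I • (twistOp ε * ε * T) := by
  have h' : T * ε = -(ε * T) := by rw [h, neg_neg]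
  have hI : Complex.I ^ 2 = -1 := Complex.I_sq
  simp only [twistOp, add_mul, mul_add, smul_mul_assoc, mul_smul_comm, one_mul, mul_one,
    hε.mul_self, h', smul_add, smul_smul, smul_neg]
  rw [show -Complex.I * ((1 - Complex.I) / 2) = -((1 + Complex.I) / 2) by
    linear_combination (1 / 2) * hI,
    show -Complex.I * ((1 + Complex.I) / 2) = (1 - Complex.I) / 2 by
    linear_combination (-1 / 2) * hI, neg_smul, add_comm]

theorem anticommute_mul_star_twistOp {T : H →L[ℂ] H} (hε : IsGrading ε D)
    (h : ε * T = -(T * ε)) :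
    T * star (twistOp ε) = Complex.I • (ε * star (twistOp ε) * T) := by
  have h' : T * ε = -(ε * T) := by rw [h, neg_neg]
  have hI : Complex.I ^ 2 = -1 := Complex.I_sq
  simp only [star_twistOp hε, add_mul, mul_add, smul_mul_assoc, mul_smul_comm, one_mul, mul_one,
    hε.mul_self, h', smul_add, smul_smul, smul_neg]
  rw [show Complex.I * ((1 + Complex.I) / 2) = -((1 - Complex.I) / 2) by
    linear_combination (1 / 2) * hI,
    show Complex.I * ((1 - Complex.I) / 2) = (1 + Complex.I) / 2 by
    linear_combination (-1 / 2) * hI, neg_smul, add_comm]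

theorem mul_star_twistOp_mul (hε : IsGrading ε D) (T : H →L[ℂ] H) :
    twistOp ε * (star (twistOp ε) * T) = T := by
  rw [← mul_assoc, (Unitary.mem_iff.mp (twistOp_mem_unitary hε)).2, one_mul]

theorem star_twistOp_comm (hε : IsGrading ε D) :
    star (twistOp ε) * ε = ε * star (twistOp ε) := by
  have := congrArg star (twistOp_comm ε)
  rw [star_mul, star_mul, hε.star_eq] at this
  exact this.symm

theorem conj_rightOp (hε : IsGrading ε D) (hJε : ∀ x, J (ε x) = ε (J x)) (T : H →L[ℂ] H) :
    ε * rightOp J T * ε = rightOp J (ε * T * ε) := by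
  ext x
  simp only [mul_apply_eq_comp, rightOp_apply, star_mul, hε.star_eq, hJε]

theorem conj_twistedRightHom (hJε : ∀ x, J (ε x) = ε (J x)) (T : H →L[ℂ] H) :
    ε * twistedRightHom hε J hJ hJi (MulOpposite.op T) * ε
      = twistedRightHom hε J hJ hJi (MulOpposite.op (ε * T * ε)) := by
  rw [twistedRightHom_apply, twistedRightHom_apply, ← conj_rightOp hε hJε]
  calc ε * (twistOp ε * rightOp J T * star (twistOp ε)) * ε
      = (ε * twistOp ε) * rightOp J T * (star (twistOp ε) * ε) := by simp only [mul_assoc]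
    _ = (twistOp ε * ε) * rightOp J T * (ε * star (twistOp ε)) := by
      rw [twistOp_comm, star_twistOp_comm hε]
    _ = _ := by simp only [mul_assoc]

theorem twistedRightHom_of_even (hJε : ∀ x, J (ε x) = ε (J x)) {T : H →L[ℂ] H}
    (hT : ε * T = T * ε) :
    twistedRightHom hε J hJ hJi (MulOpposite.op T) = rightOp J T := by
  have h1 : ε * T * ε = T := by rw [hT, mul_assoc, hε.mul_self, mul_one]
  have h2 := conj_rightOp hε hJε T
  rw [h1] at h2
  have h3 : ε * rightOp J T = rightOp J T * ε := by
    conv_rhs => rw [← h2]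
    rw [mul_assoc, hε.mul_self, mul_one]
  rw [twistedRightHom_apply, commute_twistOp h3, mul_assoc,
    (Unitary.mem_iff.mp (twistOp_mem_unitary hε)).2, mul_one]

/-- `J` commutes with `ε`, so `J T* J` is odd along with `T`; moving it past `U*` produces the
factor `-i ε`. This formula matches the twist in `i J D J ε`. -/
theorem twistedRightHom_of_odd (hJε : ∀ x, J (ε x) = ε (J x)) {T : H →L[ℂ] H}
    (hT : ε * T = -(T * ε)) :
    twistedRightHom hε J hJ hJi (MulOpposite.op T) = -Complex.I • (rightOp J T * ε) := by
  have h1 : ε * T * ε = -T := by rw [hT, neg_mul, mul_assoc, hε.mul_self, mul_one]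
  have h2 := conj_rightOp hε hJε T
  have h3 : ε * rightOp J T * ε = -rightOp J T := by
    rw [h2, h1]
    ext x
    simp only [rightOp_apply, star_neg, neg_apply, map_neg]
  have h4 : ε * rightOp J T = -(rightOp J T * ε) := by
    rw [← neg_mul, ← h3, mul_assoc, hε.mul_self, mul_one]
  rw [twistedRightHom_apply, mul_assoc, anticommute_mul_star_twistOp hε h4, mul_smul_comm,
    mul_assoc ε, ← mul_assoc (twistOp ε), twistOp_comm, mul_assoc,
    mul_star_twistOp_mul hε, h4, smul_neg, neg_smul]

/-- The graded first order condition: an odd operator which commutes with `J T* J`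
graded-commutes with its twist. -/
theorem odd_mul_twistedRightHom (hJε : ∀ x, J (ε x) = ε (J x)) {X T : H →L[ℂ] H}
    (hX : ε * X = -(X * ε)) (hXT : X * rightOp J T = rightOp J T * X) :
    X * twistedRightHom hε J hJ hJi (MulOpposite.op T)
      = twistedRightHom hε J hJ hJi (MulOpposite.op (ε * T * ε)) * X := by
  rw [twistedRightHom_apply, twistedRightHom_apply, ← conj_rightOp hε hJε]
  have hI : Complex.I * Complex.I = -1 := Complex.I_mul_I
  -- Passing `X` through `U` and `U*` yields the scalars `-i` and `i`, which cancel, and two factors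
  -- `ε`, which conjugate `J T* J`.
  calc X * (twistOp ε * rightOp J T * star (twistOp ε))
      = (X * twistOp ε) * rightOp J T * star (twistOp ε) := by simp only [mul_assoc]
    _ = -Complex.I • (twistOp ε * ε * (X * rightOp J T) * star (twistOp ε)) := by
      rw [anticommute_mul_twistOp hε hX]; simp only [smul_mul_assoc, mul_assoc]
    _ = -Complex.I • (twistOp ε * ε * rightOp J T * (X * star (twistOp ε))) := by
      rw [hXT]; simp only [mul_assoc]
    _ = twistOp ε * (ε * rightOp J T * ε) * star (twistOp ε) * X := by
      rw [anticommute_mul_star_twistOp hε hX, mul_smul_comm, smul_smul, neg_mul, hI, neg_neg,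
        one_smul]
      simp only [mul_assoc]

end Twist

end Conjugation

/-! ### Boundedness of adjointable module maps -/

section Krein

/-- Log-convexity makes the ratios `a (k + 1) / a k` nondecreasing. If the first ratio `r` exceeded
`c`, then `a k ≥ rᵏ a 0` would outgrow `M cᵏ`; the case `c = 0` is treated apart. -/
theorem le_mul_of_log_convex {a : ℕ → ℝ} (h0 : ∀ k, 0 ≤ a k)
    (h : ∀ k, a (k + 1) ^ 2 ≤ a k * a (k + 2)) {c M : ℝ} (hc : 0 ≤ c)
    (hM : ∀ k, a k ≤ M * c ^ k) : a 1 ≤ c * a 0 := by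
  by_contra! hlt
  have ha0 : 0 < a 0 := by
    refine lt_of_le_of_ne (h0 0) fun h1 => ?_
    have h2 := h 0
    rw [← h1, zero_mul] at h2
    rw [← h1, mul_zero] at hlt
    have : 0 < a (0 + 1) ^ 2 := by positivity
    linarith
  set r := a 1 / a 0 with hr
  have hcr : c < r := by rwa [hr, lt_div_iff₀ ha0]
  have hr0 : 0 < r := hc.trans_lt hcr
  have key : ∀ k, 0 < a k ∧ r * a k ≤ a (k + 1) := by
    intro k
    induction k with
    | zero => exact ⟨ha0, by rw [hr, div_mul_cancel₀ _ ha0.ne']⟩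
    | succ k ih =>
      obtain ⟨h1, h2⟩ := ih
      have h3 : 0 < a (k + 1) := lt_of_lt_of_le (by positivity) h2
      refine ⟨h3, ?_⟩
      have h4 := h k
      have h5 : a k * (r * a (k + 1)) ≤ a k * a (k + 2) := by nlinarith
      exact le_of_mul_le_mul_left h5 h1
  have hpow : ∀ k, r ^ k * a 0 ≤ a k := by
    intro k
    induction k with
    | zero => simp
    | succ k ih =>
      calc r ^ (k + 1) * a 0 = r * (r ^ k * a 0) := by ring
        _ ≤ r * a k := by gcongr
        _ ≤ a (k + 1) := (key k).2
  rcases hc.eq_or_lt with h1 | h1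
  · have h2 := hM 1
    have h3 := (key 1).1
    rw [← h1, pow_one, mul_zero] at h2
    linarith
  · have h2 : 1 < r / c := by rwa [one_lt_div h1]
    obtain ⟨k, hk⟩ := pow_unbounded_of_one_lt (M / a 0) h2
    rw [div_pow, div_lt_div_iff₀ ha0 (by positivity)] at hk
    have h3 := hM k
    have h4 := hpow k
    linarith

variable {H : Type u} [NormedAddCommGroup H] [InnerProductSpace ℂ H]

/-- **Krein's lemma**: a symmetric operator on an invariant subspace whose orbits grow at most
geometrically is bounded. -/
theorem norm_le_of_symmetric_of_growth {V : Submodule ℂ H} (S : V → V)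
    (hS : ∀ x y : V, inner ℂ (S x : H) (y : H) = inner ℂ (x : H) (S y : H)) {c M : ℝ} (hc : 0 ≤ c)
    (x : V) (hM : ∀ k, ‖(S^[k] x : H)‖ ≤ M * c ^ k) : ‖(S x : H)‖ ≤ c * ‖(x : H)‖ := by
  refine le_mul_of_log_convex (a := fun k => ‖(S^[k] x : H)‖) (fun _ => norm_nonneg _)
    (fun k => ?_) hc hM
  have h1 : inner ℂ (S^[k + 1] x : H) (S^[k + 1] x : H)
      = inner ℂ (S^[k] x : H) (S^[k + 2] x : H) := by
    rw [Function.iterate_succ_apply', hS, ← Function.iterate_succ_apply' S,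
      ← Function.iterate_succ_apply' S]
  have h2 := congrArg norm h1
  rw [inner_self_eq_norm_sq_to_K] at h2
  simp only [Complex.coe_algebraMap, norm_pow, Complex.norm_real, norm_norm] at h2
  calc _ = _ := h2
    _ ≤ _ := norm_inner_le_norm _ _

variable [CompleteSpace H]

theorem IsFiniteProjective.exists_generators {A : StarSubalgebra ℂ (H →L[ℂ] H)}
    {V : Submodule ℂ H} (h : IsFiniteProjective A V) :
    ∃ (n : ℕ) (x : Fin n → V), ∀ y : V, ∃ a : Fin n → H →L[ℂ] H,
      (∀ i, a i ∈ A) ∧ (y : H) = ∑ i, a i (x i) := by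
  obtain ⟨W, hWV, hfin, -⟩ := h
  obtain ⟨n, x, hx⟩ := Submodule.fg_iff_exists_fin_generating_family.mp hfin.fg_top
  have hmem : ∀ w : W, (w : H) ∈ V := fun w => by
    have : (w : H) ∈ (W : Set H) := w.2
    rwa [hWV] at this
  refine ⟨n, fun i => ⟨x i, hmem _⟩, fun y => ?_⟩
  have hy : (y : H) ∈ W := by
    have : (y : H) ∈ (V : Set H) := y.2
    rwa [← hWV] at this
  have h1 : (⟨y, hy⟩ : W) ∈ Submodule.span A (Set.range x) := by rw [hx]; trivial
  obtain ⟨a, ha⟩ := (Submodule.mem_span_range_iff_exists_fun A).mp h1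
  refine ⟨fun i => a i, fun i => (a i).2, ?_⟩
  have h2 := congrArg (Subtype.val : W → H) ha
  rw [← h2, AddSubmonoidClass.coe_finsetSum]
  rfl

/-- An adjointable endomorphism of a finitely generated module of vectors, over a `*`-algebra of
bounded operators, is bounded. -/
theorem exists_bound_of_adjointable {A : StarSubalgebra ℂ (H →L[ℂ] H)} {V : Submodule ℂ H}
    (h : IsFiniteProjective A V) (T T' : V →ₗ[ℂ] V)
    (hT : ∀ a ∈ A, ∀ x y : V, (y : H) = a x → (T y : H) = a (T x))
    (hT' : ∀ a ∈ A, ∀ x y : V, (y : H) = a x → (T' y : H) = a (T' x))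
    (hadj : ∀ x y : V, inner ℂ (T x : H) (y : H) = inner ℂ (x : H) (T' y : H)) :
    ∃ C : ℝ, ∀ x, ‖(T x : H)‖ ≤ C * ‖(x : H)‖ := by
  obtain ⟨n, x, hx⟩ := h.exists_generators
  have hAV : ∀ a ∈ A, ∀ y : V, a y ∈ V := by
    obtain ⟨W, hWV, -, -⟩ := h
    intro a ha y
    have h1 : (y : H) ∈ (W : Set H) := by rw [hWV]; exact y.2
    have h2 : a (y : H) ∈ (W : Set H) := W.smul_mem ⟨a, ha⟩ h1
    rwa [hWV] at h2
  -- `S = T'T` is symmetric and commutes with `A`, so Krein's lemma applies to it; afterwards `‖Ty‖²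
  -- = ⟨y, Sy⟩` bounds `T`.
  set S : V →ₗ[ℂ] V := T'.comp T with hSdef
  have hS : ∀ a ∈ A, ∀ y z : V, (z : H) = a y → (S z : H) = a (S y) := fun a ha y z hz =>
    hT' a ha _ _ (hT a ha _ _ hz)
  have hSsymm : ∀ y z : V, inner ℂ (S y : H) (z : H) = inner ℂ (y : H) (S z : H) := by
    intro y z
    have h1 := hadj z (T y)
    have h2 := hadj y (T z)
    have h3 := congrArg (starRingEnd ℂ) h1
    rw [inner_conj_symm, inner_conj_symm] at h3
    exact h3.symm.trans h2
  choose s hsA hs using fun i => hx (S (x i))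
  -- The entries `s i j` express `S xᵢ` in the generators. Each application of `S` multiplies a row
  -- of coefficients by this matrix of bounded operators, so the sum of coefficient norms grows by
  -- at most `c`, whatever the vector; only the constant `N` depends on `y`.
  set c : ℝ := ∑ i, ∑ j, ‖s i j‖ with hc
  have hc0 : 0 ≤ c := Finset.sum_nonneg fun i _ => Finset.sum_nonneg fun j _ => norm_nonneg _
  have hrow : ∀ i, ∑ j, ‖s i j‖ ≤ c := fun i =>
    Finset.single_le_sum (f := fun i => ∑ j, ‖s i j‖)
      (fun i _ => Finset.sum_nonneg fun j _ => norm_nonneg _) (Finset.mem_univ i)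
  have hstep : ∀ (y : V) (N : ℝ), (∃ a : Fin n → H →L[ℂ] H, (∀ i, a i ∈ A) ∧
      (y : H) = ∑ i, a i (x i) ∧ ∑ i, ‖a i‖ ≤ N) →
      ∃ a : Fin n → H →L[ℂ] H, (∀ i, a i ∈ A) ∧
        (S y : H) = ∑ i, a i (x i) ∧ ∑ i, ‖a i‖ ≤ N * c := by
    rintro y N ⟨a, haA, hy, hN⟩
    refine ⟨fun j => ∑ i, a i * s i j, fun j => sum_mem fun i _ => mul_mem (haA i) (hsA i j),
      ?_, ?_⟩
    · have h1 : y = ∑ i, (⟨a i (x i), hAV _ (haA i) _⟩ : V) := by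
        apply Subtype.ext
        rw [AddSubmonoidClass.coe_finsetSum, hy]
      rw [h1, map_sum, AddSubmonoidClass.coe_finsetSum]
      simp only [sum_apply, mul_apply_eq_comp]
      rw [Finset.sum_comm]
      refine Finset.sum_congr rfl fun i _ => ?_
      rw [hS (a i) (haA i) (x i) _ rfl, hs i, map_sum]
    · calc ∑ j, ‖∑ i, a i * s i j‖ ≤ ∑ j, ∑ i, ‖a i‖ * ‖s i j‖ :=
            Finset.sum_le_sum fun j _ => (norm_sum_le _ _).trans
              (Finset.sum_le_sum fun i _ => norm_mul_le _ _)
        _ = ∑ i, ‖a i‖ * ∑ j, ‖s i j‖ := by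
            rw [Finset.sum_comm]
            exact Finset.sum_congr rfl fun i _ => (Finset.mul_sum _ _ _).symm
        _ ≤ ∑ i, ‖a i‖ * c := Finset.sum_le_sum fun i _ => by gcongr; exact hrow i
        _ = (∑ i, ‖a i‖) * c := (Finset.sum_mul _ _ _).symm
        _ ≤ N * c := by gcongr
  have hgrow : ∀ y : V, ‖(S y : H)‖ ≤ c * ‖(y : H)‖ := by
    intro y
    obtain ⟨a, haA, hy⟩ := hx y
    set N := ∑ i, ‖a i‖ with hN
    have hiter : ∀ k : ℕ, ∃ b : Fin n → H →L[ℂ] H, (∀ i, b i ∈ A) ∧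
        (S^[k] y : H) = ∑ i, b i (x i) ∧ ∑ i, ‖b i‖ ≤ N * c ^ k := by
      intro k
      induction k with
      | zero => exact ⟨a, haA, hy, by simp [hN]⟩
      | succ k ih =>
        rw [Function.iterate_succ_apply', pow_succ, ← mul_assoc]
        exact hstep _ _ ih
    refine norm_le_of_symmetric_of_growth S hSsymm (M := (∑ i, ‖(x i : H)‖) * N) hc0 y
      fun k => ?_
    obtain ⟨b, -, hb, hbN⟩ := hiter k
    rw [hb]
    calc ‖∑ i, b i (x i)‖ ≤ ∑ i, ‖b i‖ * ‖(x i : H)‖ :=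
          (norm_sum_le _ _).trans (Finset.sum_le_sum fun i _ => (b i).le_opNorm _)
      _ ≤ ∑ i, ‖b i‖ * ∑ j, ‖(x j : H)‖ := Finset.sum_le_sum fun i _ => by
          gcongr
          exact Finset.single_le_sum (f := fun i => ‖(x i : H)‖) (fun i _ => norm_nonneg _)
            (Finset.mem_univ i)
      _ = (∑ j, ‖(x j : H)‖) * ∑ i, ‖b i‖ := by rw [← Finset.sum_mul, mul_comm]
      _ ≤ (∑ j, ‖(x j : H)‖) * (N * c ^ k) := by gcongr
      _ = _ := by ring
  refine ⟨√c, fun y => ?_⟩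
  have h1 : ‖(T y : H)‖ ^ 2 ≤ c * ‖(y : H)‖ ^ 2 := by
    have h2 := congrArg norm (hadj y (T y))
    rw [inner_self_eq_norm_sq_to_K] at h2
    simp only [Complex.coe_algebraMap, norm_pow, Complex.norm_real, norm_norm] at h2
    rw [h2]
    calc _ ≤ ‖(y : H)‖ * ‖(S y : H)‖ := norm_inner_le_norm _ _
      _ ≤ ‖(y : H)‖ * (c * ‖(y : H)‖) := by gcongr; exact hgrow y
      _ = _ := by ring
  refine le_of_sq_le_sq ?_ (by positivity)
  rwa [mul_pow, Real.sq_sqrt hc0]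

theorem exists_extension_of_bound {V : Submodule ℂ H} (hV : Dense (V : Set H)) (T : V →ₗ[ℂ] V)
    {C : ℝ} (hC : ∀ x, ‖(T x : H)‖ ≤ C * ‖(x : H)‖) :
    ∃ X : H →L[ℂ] H, ∀ x : V, X x = T x := by
  have hdr : DenseRange V.subtypeL := by
    rw [DenseRange]
    convert hV
    exact Subtype.range_coe
  have hui : IsUniformInducing V.subtypeL := isUniformEmbedding_subtype_val.isUniformInducing
  let f : V →L[ℂ] H := (V.subtype.comp T).mkContinuous C hC
  exact ⟨f.extend V.subtypeL, fun x => f.extend_eq hdr hui x⟩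

end Krein

/-! ### Graded commutators with the right action -/

section RightCommutator

variable {H : Type u} [NormedAddCommGroup H] [InnerProductSpace ℂ H]
  {D : H →ₗ.[ℂ] H}

/-- The restriction of `D` to the smooth domain. -/
def smoothRestrict (D : H →ₗ.[ℂ] H) : smoothDomain D →ₗ[ℂ] smoothDomain D :=
  (D.toFun.comp (Submodule.inclusion (smoothDomain_le_domain D))).codRestrict (smoothDomain D)
    fun x => apply_mem_smoothDomain x.2 (D.mem_graph ⟨x, smoothDomain_le_domain D x.2⟩)

theorem smoothRestrict_graph (D : H →ₗ.[ℂ] H) (x : smoothDomain D) :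
    ((x : H), (smoothRestrict D x : H)) ∈ D.graph :=
  D.mem_graph ⟨x, smoothDomain_le_domain D x.2⟩

variable [CompleteSpace H]

/-- Operators `B`, `B'` satisfying the first order condition `[D, a] B = B' [D, a]` for `a ∈ A`,
and preserving the smooth domain together with their adjoints, have bounded `D B - B' D`. -/
theorem exists_bounded_twisted_commutator {A : StarSubalgebra ℂ (H →L[ℂ] H)}
    (hD : IsSelfAdjoint D) (hc : IsCompactOperator (regInv D))
    (hbdd : ∀ a ∈ A, ∃ X, IsCommutator D a X) (hfin : IsFiniteProjective A (smoothDomain D))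
    {B B' : H →L[ℂ] H}
    (hB : ∀ x ∈ smoothDomain D, B x ∈ smoothDomain D)
    (hB' : ∀ x ∈ smoothDomain D, B' x ∈ smoothDomain D)
    (hBs : ∀ x ∈ smoothDomain D, (star B) x ∈ smoothDomain D)
    (hBs' : ∀ x ∈ smoothDomain D, (star B') x ∈ smoothDomain D)
    (hAB : ∀ a ∈ A, a * B = B * a) (hAB' : ∀ a ∈ A, a * B' = B' * a)
    (hX : ∀ a ∈ A, ∀ X, IsCommutator D a X → X * B = B' * X) :
    ∃ X : H →L[ℂ] H, ∀ x y, (x, y) ∈ D.graph → (B x, B' y + X x) ∈ D.graph := by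
  set V := smoothDomain D
  have hlin : ∀ (P P' : H →L[ℂ] H) (hP : ∀ x ∈ V, P x ∈ V) (hP' : ∀ x ∈ V, P' x ∈ V),
      (∀ a ∈ A, a * P = P * a) → (∀ a ∈ A, a * P' = P' * a) →
      (∀ a ∈ A, ∀ X, IsCommutator D a X → X * P = P' * X) →
      ∃ T : V →ₗ[ℂ] V,
        (∀ x, (T x : H) = smoothRestrict D ⟨P x, hP x x.2⟩ - P' (smoothRestrict D x : H)) ∧
        ∀ a ∈ A, ∀ x y : V, (y : H) = a x → (T y : H) = a (T x) := by
    intro P P' hP hP' hAP hAP' hXP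
    let P₁ : V →ₗ[ℂ] V := (P : H →ₗ[ℂ] H).restrict hP
    let P₂ : V →ₗ[ℂ] V := (P' : H →ₗ[ℂ] H).restrict hP'
    -- For `T = DP - P'D`, both `DPa` and `P'Da` produce a term from `[D, a] = X`: `T a x = a T x +
    -- (XP - P'X)x`, and the last term vanishes by the first order condition.
    refine ⟨(smoothRestrict D).comp P₁ - P₂.comp (smoothRestrict D), fun x => rfl, ?_⟩
    intro a ha x y hy
    obtain ⟨X, haX⟩ := hbdd a ha
    have hcomm : ∀ z w : V, (w : H) = a z →
        (smoothRestrict D w : H) = a (smoothRestrict D z) + X z := by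
      intro z w hw
      have h1 := isCommutator_iff.mp haX _ _ (smoothRestrict_graph D z)
      rw [← hw] at h1
      exact graph_unique (smoothRestrict_graph D w) h1
    change (smoothRestrict D (P₁ y) : H) - P' (smoothRestrict D y)
      = a ((smoothRestrict D (P₁ x) : H) - P' (smoothRestrict D x))
    have h1 : ((P₁ y : V) : H) = a (P₁ x : V) := by
      change P y = a (P x)
      rw [hy]
      exact (congrArg (fun R : H →L[ℂ] H => R x) (hAP a ha)).symm
    have h2 : X (P x) = P' (X x) := congrArg (fun R : H →L[ℂ] H => R x) (hXP a ha X haX)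
    have h3 : ∀ z, a (P' z) = P' (a z) := fun z =>
      congrArg (fun R : H →L[ℂ] H => R z) (hAP' a ha)
    rw [hcomm _ _ h1, hcomm _ _ hy, map_add, map_sub, h3]
    change _ + X (P x) - _ = _
    rw [h2]
    abel
  obtain ⟨T, hT, hTA⟩ := hlin B B' hB hB' hAB hAB' hX
  have hstarA : ∀ {P : H →L[ℂ] H}, (∀ a ∈ A, a * P = P * a) → ∀ a ∈ A, a * star P = star P * a := by
    intro P hP a ha
    have := congrArg star (hP (star a) (star_mem ha))
    rw [star_mul, star_mul, star_star] at this
    exact this.symm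
  have hd : Dense (D.domain : Set H) := hD.dense_domain
  -- The first order condition for the pair `(B'*, B*)` is the adjoint of the one for `a*`, through
  -- `[D, a*] = -[D, a]*`.
  obtain ⟨T', hT', hTA'⟩ := hlin (star B') (star B) hBs' hBs (hstarA hAB') (hstarA hAB) (by
    intro a ha X haX
    have h1 : IsCommutator D (star a) (-star X) := by
      refine isCommutator_iff.mpr fun x y hxy => mem_graph_of_forall hD fun z z' hz => ?_
      have h2 := isCommutator_iff.mp haX _ _ hz
      have h3 := graph_symm hD hxy h2
      simp only [ContinuousLinearMap.star_eq_adjoint, inner_add_left, neg_apply, inner_neg_left,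
        ContinuousLinearMap.adjoint_inner_left, h3, inner_add_right]
      abel
    have h2 := congrArg star (hX (star a) (star_mem ha) _ h1)
    rw [star_mul, star_mul, star_neg, star_star, neg_mul, mul_neg, neg_inj] at h2
    exact h2.symm)
  -- The formal adjoint of `DB - B'D` is `B*D - DB'*`, which is `-T'`.
  obtain ⟨C, hC⟩ := exists_bound_of_adjointable hfin T (-T') hTA
    (fun a ha x y hy => by
      rw [LinearMap.neg_apply, LinearMap.neg_apply, Submodule.coe_neg, Submodule.coe_neg,
        hTA' a ha x y hy, map_neg])
    (fun x y => by
      have h1 := graph_symm hD (smoothRestrict_graph D ⟨B x, hB x x.2⟩) (smoothRestrict_graph D y)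
      have h2 := graph_symm hD (smoothRestrict_graph D x)
        (smoothRestrict_graph D ⟨(star B') y, hBs' y y.2⟩)
      rw [LinearMap.neg_apply, Submodule.coe_neg, inner_neg_right, hT, hT', inner_sub_left,
        inner_sub_right, h1, ← h2]
      simp only [ContinuousLinearMap.star_eq_adjoint, ContinuousLinearMap.adjoint_inner_right]
      abel)
  obtain ⟨X, hXT⟩ := exists_extension_of_bound (dense_smoothDomain hD hc) T hC
  refine ⟨X, fun x y hxy => graph_of_smoothDomain hD hc (fun x y hx hxy => ?_) hxy⟩
  have h1 := hXT ⟨x, hx⟩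
  have h2 := graph_unique (smoothRestrict_graph D ⟨x, hx⟩) hxy
  change X x = _ at h1
  rw [h1, hT, h2, add_sub_cancel]
  exact smoothRestrict_graph D ⟨B x, hB x hx⟩

end RightCommutator

/-! ### The twisted operator through its graph, and commutators of tensors -/

section RightAction

variable {H : Type u} [NormedAddCommGroup H] [InnerProductSpace ℂ H]

/-- Solve `y = i J D J ε x` for `D J ε x`; antilinearity of `J` leaves the factor `i` in front of `J
y`. -/
theorem mem_graph_twistedDirac {J : H ≃ₗᵢ⋆[ℂ] H} {D : H →ₗ.[ℂ] H} {ε : H →L[ℂ] H}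
    (hJ : ∀ x, J (J x) = x) {x y : H} :
    (x, y) ∈ (twistedDirac J D ε).graph ↔ (J (ε x), Complex.I • J y) ∈ D.graph := by
  rw [← exists_apply_eq_iff, ← exists_apply_eq_iff]
  refine exists_congr fun h => ?_
  change Complex.I • J (D ⟨J (ε x), _⟩) = y ↔ _
  constructor
  · rintro rfl
    rw [map_smulₛₗ, hJ, smul_smul, Complex.conj_I, mul_neg, Complex.I_mul_I, neg_neg, one_smul]
  · intro h1
    rw [h1, map_smulₛₗ, hJ, smul_smul, Complex.conj_I, mul_neg, Complex.I_mul_I, neg_neg, one_smul]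

variable [CompleteSpace H]

theorem dense_domain_twistedDirac {J : H ≃ₗᵢ⋆[ℂ] H} {D : H →ₗ.[ℂ] H} {ε : H →L[ℂ] H}
    (hJ : ∀ x, J (J x) = x) (hε : IsGrading ε D) (hD : Dense (D.domain : Set H)) :
    Dense ((twistedDirac J D ε).domain : Set H) := by
  have hs : Function.Surjective fun x => ε (J x) := fun y =>
    ⟨J (ε y), by simp only [hJ, hε.apply_apply]⟩
  refine (hs.denseRange.dense_image (ε.continuous.comp J.continuous) hD).mono ?_
  rintro _ ⟨x, hx, rfl⟩
  change J (ε (ε (J x))) ∈ D.domain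
  rwa [hε.apply_apply, hJ]

variable {𝔄 𝔅 : Type u} [Ring 𝔄] [StarRing 𝔄] [Algebra ℂ 𝔄] [Ring 𝔅] [StarRing 𝔅] [Algebra ℂ 𝔅]

/-- Bounded graded commutators of the two factors give bounded graded commutators of all elements of
the tensor product. -/
theorem exists_isGradedCommutator_tensorAction {D : H →ₗ.[ℂ] H} {ε : H →L[ℂ] H}
    (ρ : 𝔄 →⋆ₐ[ℂ] (H →L[ℂ] H)) (σ : 𝔅 →⋆ₐ[ℂ] (H →L[ℂ] H))
    (hρε : ∀ a, ε * ρ a = ρ a * ε) (hρ : ∀ a, ∃ X, IsCommutator D (ρ a) X)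
    (hσ : ∀ b, ∃ X, IsGradedCommutator D ε (σ b) X) (y : 𝔄 ⊗[ℂ] 𝔅) :
    ∃ X, IsGradedCommutator D ε (tensorAction ρ σ y) X := by
  induction y using TensorProduct.induction_on with
  | zero =>
    refine ⟨0, isGradedCommutator_iff.mpr fun x y _ => ?_⟩
    rw [map_zero]
    simp
  | add y z hy hz =>
    obtain ⟨X, hX⟩ := hy
    obtain ⟨Y, hY⟩ := hz
    refine ⟨X + Y, isGradedCommutator_iff.mpr fun u v huv => ?_⟩
    have h1 := graph_add (isGradedCommutator_iff.mp hX _ _ huv)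
      (isGradedCommutator_iff.mp hY _ _ huv)
    rw [map_add, mul_add, add_mul]
    simp only [add_apply] at h1 ⊢
    rwa [add_add_add_comm] at h1
  | tmul a b =>
    obtain ⟨X, hX⟩ := hρ a
    obtain ⟨Y, hY⟩ := hσ b
    refine ⟨ρ a * Y + X * σ b, isGradedCommutator_iff.mpr fun u v huv => ?_⟩
    have h1 := isCommutator_iff.mp hX _ _ (isGradedCommutator_iff.mp hY _ _ huv)
    have h2 : tensorAction ρ σ (a ⊗ₜ b) = ρ a * σ b := rfl
    have h3 : ε * (ρ a * σ b) * ε = ρ a * (ε * σ b * ε) := by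
      rw [← mul_assoc, hρε]; simp only [mul_assoc]
    rw [h2, h3]
    simp only [mul_apply_eq_comp, add_apply, map_add] at h1 ⊢
    rwa [add_assoc] at h1

end RightAction

/-! ### The trace vector, its conjugation and the right Clifford action -/

namespace NCRiemannianManifold

variable {H : Type u} [NormedAddCommGroup H] [InnerProductSpace ℂ H] [CompleteSpace H]
  {ω : DixmierLimit} {p : ℕ} (M : NCRiemannianManifold ω p H)

theorem smoothDomain_eq_orbit : smoothDomain M.D = orbit M.C M.Φ := SetLike.ext' M.cyclic

theorem dense_orbit : Dense (orbit M.C M.Φ : Set H) := by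
  rw [← M.smoothDomain_eq_orbit]
  exact dense_smoothDomain M.selfAdjoint M.compact

theorem apply_Φ_mem {w : H →L[ℂ] H} (hw : w ∈ M.C) : w M.Φ ∈ smoothDomain M.D := by
  rw [M.smoothDomain_eq_orbit]
  exact mem_orbit hw _

/-- `Φ` is a trace vector: the pairing of `H_∞` gives
`⟨vΦ|uΦ⟩ = ψ(v* u z) = ψ(v* z u) = ⟨u*Φ|v*Φ⟩`, as `z = (Φ|Φ)` is central. -/
theorem trace_vector {u v : H →L[ℂ] H} (hu : u ∈ M.C) (hv : v ∈ M.C) :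
    inner ℂ (v M.Φ) (u M.Φ) = inner ℂ ((star u) M.Φ) ((star v) M.Φ) := by
  obtain ⟨P, hΦ, hP, hPψ, hz, -⟩ := M.pairing
  set Φ' : smoothDomain M.D := ⟨M.Φ, hΦ⟩
  set z := P Φ' Φ' with hzdef
  have hzs : star z = z := hP.star _ _
  have hvu := mul_mem (star_mem hv) hu
  have h1 : inner ℂ (v M.Φ) (u M.Φ) = inner ℂ M.Φ ((star v * u) M.Φ) := by
    rw [mul_apply_eq_comp, ContinuousLinearMap.star_eq_adjoint,
      ContinuousLinearMap.adjoint_inner_right]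
  have h2 := hPψ ⟨(star v * u) M.Φ, M.apply_Φ_mem hvu⟩ Φ'
  have h3 := hPψ ⟨(star v) M.Φ, M.apply_Φ_mem (star_mem hv)⟩
    ⟨(star u) M.Φ, M.apply_Φ_mem (star_mem hu)⟩
  rw [hP.smul_left _ hvu Φ' _ _ rfl] at h2
  rw [hP.smul_left _ (star_mem hv) Φ' _ _ rfl, ← hP.star,
    hP.smul_left _ (star_mem hu) Φ' _ _ rfl, star_mul, star_star, ← hzdef, hzs, hz u hu,
    ← mul_assoc] at h3
  rw [h1]
  exact h2.trans h3.symm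

theorem grading_mem_C {w : H →L[ℂ] H} (hw : w ∈ M.C) : M.ε * w * M.ε ∈ M.C :=
  M.map_C_le ⟨w, hw, rfl⟩

theorem grading_apply_Φ (w : H →L[ℂ] H) : M.ε (w M.Φ) = (M.ε * w * M.ε) M.Φ := by
  rw [mul_apply_eq_comp, mul_apply_eq_comp, M.grading_Φ]

/-- The Tomita conjugation of `Φ`. -/
theorem exists_tomita : ∃ J : H ≃ₗᵢ⋆[ℂ] H, (∀ u ∈ M.C, J (u M.Φ) = (star u) M.Φ) ∧
    (∀ x, J (J x) = x) ∧ (∀ x y, inner ℂ (J x) (J y) = inner ℂ y x) ∧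
      ∀ x, J (M.ε x) = M.ε (J x) := by
  obtain ⟨J, h1, h2, h3⟩ := exists_conjugation M.C M.Φ M.dense_orbit
    fun u hu v hv => M.trace_vector hu hv
  refine ⟨J, h1, h2, h3, fun x => ?_⟩
  refine M.dense_orbit.induction (P := fun x => J (M.ε x) = M.ε (J x)) ?_ ?_ x
  · rintro _ ⟨u, hu, rfl⟩
    rw [M.grading_apply_Φ, h1 _ (M.grading_mem_C hu), h1 u hu, M.grading_apply_Φ, star_mul,
      star_mul, M.grading.star_eq, mul_assoc]
  · exact isClosed_eq (J.continuous.comp M.ε.continuous) (M.ε.continuous.comp J.continuous)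

theorem isCommutator_unique {T X : H →L[ℂ] H} (hT : T ∈ M.A) (hX : IsCommutator M.D T X) :
    X = comm M.D T :=
  comm_eq_of_isCommutator M.selfAdjoint.dense_domain hX (M.isCommutator_comm hT)

theorem isCommutator_star {a X : H →L[ℂ] H} (hX : IsCommutator M.D a X) :
    IsCommutator M.D (star a) (-star X) := by
  refine isCommutator_iff.mpr fun x y hxy => mem_graph_of_forall M.selfAdjoint fun z z' hz => ?_
  have h3 := graph_symm M.selfAdjoint hxy (isCommutator_iff.mp hX _ _ hz)
  simp only [ContinuousLinearMap.star_eq_adjoint, inner_add_left, neg_apply, inner_neg_left,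
    ContinuousLinearMap.adjoint_inner_left, h3, inner_add_right]
  abel

/-- `D` is odd and `a` is even, so conjugating `[D, a]` by `ε` changes its sign. -/
theorem odd_of_isCommutator {a X : H →L[ℂ] H} (ha : a ∈ M.A) (hX : IsCommutator M.D a X) :
    M.ε * X = -(X * M.ε) := by
  have hd : Dense (M.D.domain : Set H) := M.selfAdjoint.dense_domain
  ext x
  refine hd.induction (P := fun x => (M.ε * X) x = (-(X * M.ε)) x) (fun x hx => ?_) ?_ x
  · have h1 := M.D.mem_graph ⟨x, hx⟩
    have h2 := M.grading.graph (isCommutator_iff.mp hX _ _ h1)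
    have h3 := isCommutator_iff.mp hX _ _ (M.grading.graph h1)
    have hc : ∀ y, M.ε (a y) = a (M.ε y) := fun y =>
      congrArg (fun S : H →L[ℂ] H => S y) (M.grading_A a ha)
    rw [hc, map_add, hc] at h2
    rw [map_neg] at h3
    have h4 := graph_unique h2 h3
    rw [neg_add, add_right_inj] at h4
    exact neg_eq_iff_eq_neg.mp h4
  · exact isClosed_eq (by fun_prop) (by fun_prop)

section Right

variable {J : H ≃ₗᵢ⋆[ℂ] H} {hJ : ∀ x, J (J x) = x}
  {hJi : ∀ x y, inner ℂ (J x) (J y) = inner ℂ y x}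

/-- On `H_∞ = C_D(A)Φ` right multiplication by `w` and `ε` act inside the orbit, and `U`, `U*` are
combinations of `1` and `ε`. -/
theorem twistedRightHom_mem_smoothDomain (hJC : ∀ u ∈ M.C, J (u M.Φ) = (star u) M.Φ)
    {w : H →L[ℂ] H} (hw : w ∈ M.C) {x : H} (hx : x ∈ smoothDomain M.D) :
    twistedRightHom M.grading J hJ hJi (MulOpposite.op w) x ∈ smoothDomain M.D := by
  have hε : ∀ y ∈ smoothDomain M.D, M.ε y ∈ smoothDomain M.D := by
    intro y hy
    rw [M.smoothDomain_eq_orbit] at hy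
    obtain ⟨u, hu, rfl⟩ := hy
    rw [M.grading_apply_Φ]
    exact M.apply_Φ_mem (M.grading_mem_C hu)
  have hr : ∀ y ∈ smoothDomain M.D, rightOp J w y ∈ smoothDomain M.D := by
    intro y hy
    rw [M.smoothDomain_eq_orbit] at hy
    obtain ⟨u, hu, rfl⟩ := hy
    rw [rightOp_orbit hJC hu hw]
    exact M.apply_Φ_mem (mul_mem hu hw)
  have hU : ∀ a b : ℂ, ∀ y ∈ smoothDomain M.D,
      (a • (1 : H →L[ℂ] H) + b • M.ε) y ∈ smoothDomain M.D := fun a b y hy =>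
    add_mem ((smoothDomain M.D).smul_mem a hy) ((smoothDomain M.D).smul_mem b (hε y hy))
  rw [twistedRightHom_apply, star_twistOp M.grading]
  exact hU _ _ _ (hr _ (hU _ _ _ hx))

theorem commute_twistedRightHom (hJC : ∀ u ∈ M.C, J (u M.Φ) = (star u) M.Φ)
    {a w : H →L[ℂ] H} (ha : a ∈ M.C) (haε : M.ε * a = a * M.ε) (hw : w ∈ M.C) :
    a * twistedRightHom M.grading J hJ hJi (MulOpposite.op w)
      = twistedRightHom M.grading J hJ hJi (MulOpposite.op w) * a := by
  have h1 := commute_twistOp haε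
  have h2 : a * star (twistOp M.ε) = star (twistOp M.ε) * a := by
    have h3 : M.ε * star a = star a * M.ε := by
      have := congrArg star haε
      rw [star_mul, star_mul, M.grading.star_eq] at this
      exact this.symm
    have := congrArg star (commute_twistOp h3)
    rwa [star_mul, star_mul, star_star] at this
  rw [twistedRightHom_apply]
  calc a * (twistOp M.ε * rightOp J w * star (twistOp M.ε))
      = (a * twistOp M.ε) * rightOp J w * star (twistOp M.ε) := by simp only [mul_assoc]
    _ = twistOp M.ε * (a * rightOp J w) * star (twistOp M.ε) := by
      rw [← h1]; simp only [mul_assoc]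
    _ = twistOp M.ε * rightOp J w * (a * star (twistOp M.ε)) := by
      rw [commute_rightOp M.dense_orbit hJC ha hw]; simp only [mul_assoc]
    _ = _ := by rw [h2]; simp only [mul_assoc]

theorem isCommutator_mul_twistedRightHom (hJC : ∀ u ∈ M.C, J (u M.Φ) = (star u) M.Φ)
    (hJε : ∀ x, J (M.ε x) = M.ε (J x)) {a X w : H →L[ℂ] H} (ha : a ∈ M.A)
    (hX : IsCommutator M.D a X) (hw : w ∈ M.C) :
    X * twistedRightHom M.grading J hJ hJi (MulOpposite.op w)
      = twistedRightHom M.grading J hJ hJi (MulOpposite.op (M.ε * w * M.ε)) * X := by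
  refine odd_mul_twistedRightHom M.grading hJε (M.odd_of_isCommutator ha hX)
    (commute_rightOp M.dense_orbit hJC ?_ hw)
  rw [M.isCommutator_unique ha hX]
  exact M.comm_mem_C ha

/-- Instance of `exists_bounded_twisted_commutator` with `B = α(w)`, `B' = α(εwε)`, the latter being
`ε α(w) ε`. Adjoints are covered because `α` preserves them and `C_D(A)` is a `*`-algebra. -/
theorem exists_isGradedCommutator (hJC : ∀ u ∈ M.C, J (u M.Φ) = (star u) M.Φ)
    (hJε : ∀ x, J (M.ε x) = M.ε (J x)) {w : H →L[ℂ] H} (hw : w ∈ M.C) :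
    ∃ X, IsGradedCommutator M.D M.ε
      (twistedRightHom M.grading J hJ hJi (MulOpposite.op w)) X := by
  have hw' := M.grading_mem_C hw
  obtain ⟨X, hX⟩ := exists_bounded_twisted_commutator
    (B := twistedRightHom M.grading J hJ hJi (MulOpposite.op w))
    (B' := twistedRightHom M.grading J hJ hJi (MulOpposite.op (M.ε * w * M.ε)))
    M.selfAdjoint M.compact M.bounded_comm M.finite_A
    (fun x hx => M.twistedRightHom_mem_smoothDomain hJC hw hx)
    (fun x hx => M.twistedRightHom_mem_smoothDomain hJC hw' hx)
    (fun x hx => by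
      rw [← map_star]; exact M.twistedRightHom_mem_smoothDomain hJC (star_mem hw) hx)
    (fun x hx => by
      rw [← map_star]; exact M.twistedRightHom_mem_smoothDomain hJC (star_mem hw') hx)
    (fun a ha => M.commute_twistedRightHom hJC (M.A_le_C ha) (M.grading_A a ha) hw)
    (fun a ha => M.commute_twistedRightHom hJC (M.A_le_C ha) (M.grading_A a ha) hw')
    (fun a ha X hX => M.isCommutator_mul_twistedRightHom hJC hJε ha hX hw)
  refine ⟨X, isGradedCommutator_iff.mpr fun x y hxy => ?_⟩
  rw [conj_twistedRightHom M.grading hJε]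
  exact hX x y hxy

/-- As `ε` commutes with `J a* J`, the commutator is `i J [D, a*] J ε = -i J X* J ε`, which is the
twist of the odd operator `X`. -/
theorem isCommutator_twistedDirac (hJε : ∀ x, J (M.ε x) = M.ε (J x)) {a X : H →L[ℂ] H}
    (ha : a ∈ M.A) (hX : IsCommutator M.D a X) :
    IsCommutator (twistedDirac J M.D M.ε) (rightOp J a)
      (twistedRightHom M.grading J hJ hJi (MulOpposite.op X)) := by
  refine isCommutator_iff.mpr fun x y hxy => ?_
  rw [mem_graph_twistedDirac hJ] at hxy ⊢
  have h1 := isCommutator_iff.mp (M.isCommutator_star hX) _ _ hxy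
  have hc : ∀ y, M.ε ((star a) y) = (star a) (M.ε y) := fun y =>
    congrArg (fun S : H →L[ℂ] H => S y) (M.grading_A _ (star_mem ha))
  rw [twistedRightHom_of_odd M.grading hJε (M.odd_of_isCommutator ha hX)]
  have e1 : J (M.ε (rightOp J a x)) = (star a) (J (M.ε x)) := by
    rw [hJε, rightOp_apply, hJ, hc, hJε]
  have e2 : Complex.I • J (rightOp J a y + (-Complex.I • (rightOp J X * M.ε)) x)
      = (star a) (Complex.I • J y) + (-star X) (J (M.ε x)) := by
    simp only [map_add, smul_apply, mul_apply_eq_comp, rightOp_apply, map_smulₛₗ, hJ, smul_add,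
      smul_smul, map_neg, Complex.conj_I, neg_neg, Complex.I_mul_I, neg_apply, RingHom.id_apply,
      neg_smul, one_smul]
  rw [e1, e2]
  exact h1

theorem twistedRightHom_of_mem_A (hJε : ∀ x, J (M.ε x) = M.ε (J x)) {a : H →L[ℂ] H}
    (ha : a ∈ M.A) : twistedRightHom M.grading J hJ hJi (MulOpposite.op a) = rightOp J a :=
  twistedRightHom_of_even M.grading hJε (M.grading_A a ha)

variable (J hJ hJi)

/-- The right action `a^op ↦ J a* J` of `A`. -/
def rightRep : (M.A)ᵐᵒᵖ →⋆ₐ[ℂ] (H →L[ℂ] H) := (rightHom J hJ hJi).comp (opHom M.A.subtype)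

/-- The right Clifford action of `C_D(A)`. -/
def rightCliffordRep : (M.C)ᵐᵒᵖ →⋆ₐ[ℂ] (H →L[ℂ] H) :=
  (twistedRightHom M.grading J hJ hJi).comp (opHom M.C.subtype)

theorem rightRep_eq (hJε : ∀ x, J (M.ε x) = M.ε (J x)) (a : (M.A)ᵐᵒᵖ) :
    M.rightRep J hJ hJi a
      = twistedRightHom M.grading J hJ hJi (MulOpposite.op (a.unop : H →L[ℂ] H)) :=
  (M.twistedRightHom_of_mem_A hJε a.unop.2).symm

/-- Generators correspond to generators. For the reverse inclusion a bounded commutator with the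
twisted operator must be the one already found, by density of the domain. -/
theorem range_rightCliffordRep (hJε : ∀ x, J (M.ε x) = M.ε (J x)) :
    (M.rightCliffordRep J hJ hJi).range
      = cliffordAlg (M.rightRep J hJ hJi).range (twistedDirac J M.D M.ε) := by
  apply le_antisymm
  · rintro _ ⟨w, rfl⟩
    obtain ⟨w, hw⟩ := w
    change twistedRightHom M.grading J hJ hJi (MulOpposite.op w) ∈ _
    induction hw using StarAlgebra.adjoin_induction with
    | mem x hx =>
      refine StarAlgebra.subset_adjoin ℂ _ ?_
      rcases hx with hx | ⟨a, ha, hX⟩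
      · exact Or.inl ⟨MulOpposite.op ⟨x, hx⟩, M.rightRep_eq J hJ hJi hJε _⟩
      · exact Or.inr ⟨rightOp J a, ⟨MulOpposite.op ⟨a, ha⟩, rfl⟩,
          M.isCommutator_twistedDirac hJε ha hX⟩
    | algebraMap r =>
      rw [show MulOpposite.op (algebraMap ℂ (H →L[ℂ] H) r)
        = algebraMap ℂ (H →L[ℂ] H)ᵐᵒᵖ r from rfl, AlgHomClass.commutes]
      exact algebraMap_mem _ r
    | add x y _ _ hx hy => rw [MulOpposite.op_add, map_add]; exact add_mem hx hy
    | mul x y _ _ hx hy => rw [MulOpposite.op_mul, map_mul]; exact mul_mem hy hx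
    | star x _ hx => rw [MulOpposite.op_star, map_star]; exact star_mem hx
  · refine StarAlgebra.adjoin_le ?_
    rintro X (⟨a, rfl⟩ | ⟨_, ⟨a, rfl⟩, hX⟩)
    · exact ⟨MulOpposite.op ⟨a.unop, M.A_le_C a.unop.2⟩, (M.rightRep_eq J hJ hJi hJε a).symm⟩
    · refine ⟨MulOpposite.op ⟨_, M.comm_mem_C a.unop.2⟩, ?_⟩
      exact comm_eq_of_isCommutator
        (dense_domain_twistedDirac hJ M.grading M.selfAdjoint.dense_domain)
        (M.isCommutator_twistedDirac hJε a.unop.2 (M.isCommutator_comm a.unop.2)) hX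

theorem norm_rightCliffordRep (w : (M.C)ᵐᵒᵖ) : ‖M.rightCliffordRep J hJ hJi w‖ = ‖w‖ :=
  NonUnitalStarAlgHom.norm_map (twistedRightHom M.grading J hJ hJi)
    (twistedRightHom_injective M.grading) _

/-- Stated for any algebra acting by twisted right multiplications, so that it serves both
`C_D(A)^op` and `A^op`. -/
theorem isGradedSpectralTriple_right (hJC : ∀ u ∈ M.C, J (u M.Φ) = (star u) M.Φ)
    (hJε : ∀ x, J (M.ε x) = M.ε (J x)) {𝔅 : Type u} [Ring 𝔅] [StarRing 𝔅] [Algebra ℂ 𝔅]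
    (σ : 𝔅 →⋆ₐ[ℂ] (H →L[ℂ] H)) (γ : 𝔅 → 𝔅) (hσ : Function.Injective σ)
    (hγ : ∀ b, M.ε * σ b * M.ε = σ (γ b))
    (hC : ∀ b, ∃ w ∈ M.C, σ b = twistedRightHom M.grading J hJ hJi (MulOpposite.op w)) :
    IsGradedSpectralTriple M.A.subtype σ γ M.D M.ε where
  faithful_left := Subtype.val_injective
  faithful_right := hσ
  commute a b := by
    obtain ⟨w, hw, e⟩ := hC b
    rw [e]
    exact M.commute_twistedRightHom hJC (M.A_le_C a.2) (M.grading_A _ a.2) hw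
  selfAdjoint := M.selfAdjoint
  compact := M.compact
  grading := M.grading
  even_left a := by
    change M.ε * (a : H →L[ℂ] H) * M.ε = a
    rw [M.grading_A _ a.2, mul_assoc, M.grading.mul_self, mul_one]
  graded_right := hγ
  bounded_comm := exists_isGradedCommutator_tensorAction _ _
    (fun a => M.grading_A _ a.2) (fun a => M.bounded_comm _ a.2) fun b => by
      obtain ⟨w, hw, e⟩ := hC b
      rw [e]
      exact M.exists_isGradedCommutator hJC hJε hw

end Right

end NCRiemannianManifold

/-! ### Compact operators on a Hilbert space -/

section Compact

variable {H : Type u} [NormedAddCommGroup H] [InnerProductSpace ℂ H]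

/-- A Hilbert space which carries a compact operator of dense range is separable. -/
theorem separableSpace_of_isCompactOperator {T : H →L[ℂ] H} (hT : IsCompactOperator T)
    (hd : DenseRange T) : TopologicalSpace.SeparableSpace H := by
  rw [← TopologicalSpace.isSeparable_univ_iff, ← hd.closure_range]
  refine TopologicalSpace.IsSeparable.closure ?_
  have h1 : Set.range T ⊆ ⋃ n : ℕ, closure (T '' Metric.closedBall 0 (n : ℝ)) := by
    rintro _ ⟨x, rfl⟩
    obtain ⟨n, hn⟩ := exists_nat_ge ‖x‖
    exact Set.mem_iUnion.mpr ⟨n, subset_closure ⟨x, by simpa using hn, rfl⟩⟩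
  exact (TopologicalSpace.IsSeparable.iUnion fun n : ℕ =>
    (hT.isCompact_closure_image_closedBall (n : ℝ)).isSeparable).mono h1

variable [CompleteSpace H]

/-- Compact operators on a Hilbert space are limits of operators of finite rank. -/
theorem mem_compactOps {T : H →L[ℂ] H} (hT : IsCompactOperator T) : T ∈ compactOps ℂ H := by
  refine Metric.mem_closure_iff.mpr fun e he => ?_
  have hK := hT.isCompact_closure_image_closedBall 1
  obtain ⟨t, htf, ht⟩ := Metric.totallyBounded_iff.mp hK.totallyBounded (e / 2) (by positivity)
  set V : Submodule ℂ H := Submodule.span ℂ t with hV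
  have hfin : FiniteDimensional ℂ V := FiniteDimensional.span_of_finite ℂ htf
  have b := stdOrthonormalBasis ℂ V
  -- `V` is spanned by a finite `e/2`-net of the closure of the image of the unit ball, and the
  -- projection of `Tx` on `V` is at least as close to `Tx` as any point of the net.
  refine ⟨V.starProjection * T, ?_, ?_⟩
  · rw [b.starProjection_eq_sum_rankOne, Finset.sum_mul]
    refine sum_mem fun i _ => Submodule.subset_span ⟨b i, (star T) (b i), fun x => ?_⟩
    rw [mul_apply_eq_comp, InnerProductSpace.rankOne_apply, ContinuousLinearMap.star_eq_adjoint]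
    change _ = (inner ℂ (ContinuousLinearMap.adjoint T (b i : H)) x : ℂ) • (b i : H)
    rw [ContinuousLinearMap.adjoint_inner_left]
  · rw [dist_eq_norm]
    refine lt_of_le_of_lt ?_ (half_lt_self he)
    refine ContinuousLinearMap.opNorm_le_of_unit_norm (by positivity) fun x hx => ?_
    have h1 : T x ∈ closure (T '' Metric.closedBall 0 1) :=
      subset_closure ⟨x, by simp [hx], rfl⟩
    obtain ⟨y, hy, hTy⟩ := Set.mem_iUnion₂.mp (ht h1)
    rw [Metric.mem_ball, dist_eq_norm] at hTy
    have h2 := V.starProjection_minimal (y := T x)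
    have h3 : ‖T x - V.starProjection (T x)‖ ≤ ‖T x - y‖ := by
      rw [h2]
      exact ciInf_le ⟨0, by rintro _ ⟨z, rfl⟩; exact norm_nonneg _⟩
        (⟨y, Submodule.subset_span hy⟩ : V)
    exact h3.trans hTy.le

variable {D : H →ₗ.[ℂ] H} {ε : H →L[ℂ] H}

/-- `(1 + D²)^(-1/2)` is selfadjoint and injective, so its range is dense; separability supplies the
countable generation of the Kasparov module. -/
theorem separableSpace_of_compact_resolvent (hD : IsSelfAdjoint D)
    (hc : IsCompactOperator (regInv D)) : TopologicalSpace.SeparableSpace H := by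
  refine separableSpace_of_isCompactOperator hc ?_
  have h1 : (regInv D).rangeᗮ = ⊥ := by
    rw [eq_bot_iff]
    intro x hx
    refine regInv_injective hD (ext_inner_left ℂ fun y => ?_)
    rw [← isSelfAdjoint_apply (regInv_isSelfAdjoint D), inner_zero_right]
    exact hx _ ⟨y, rfl⟩
  have h2 := (Submodule.dense_iff_topologicalClosure_eq_top).mpr
    ((Submodule.topologicalClosure_eq_top_iff).mpr h1)
  exact h2

/-- The operators which graded-commute with `F`, modulo compact operators. -/
def compactCommutant (hε : IsGrading ε D) (F : H →L[ℂ] H) : Subalgebra ℂ (H →L[ℂ] H) where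
  carrier := {T | IsCompactOperator (F * T - ε * T * ε * F : H →L[ℂ] H)}
  mul_mem' := fun {S T} hS hT => by
    have h1 : IsCompactOperator ((F * S - ε * S * ε * F) * T : H →L[ℂ] H) := hS.comp_clm T
    have h2 : IsCompactOperator (ε * S * ε * (F * T - ε * T * ε * F) : H →L[ℂ] H) :=
      hT.clm_comp (ε * S * ε)
    have e : F * (S * T) - ε * (S * T) * ε * F
        = (F * S - ε * S * ε * F) * T + ε * S * ε * (F * T - ε * T * ε * F) := by
      rw [mul_sub, show ε * S * ε * (ε * T * ε * F) = ε * S * (ε * ε) * T * ε * F by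
        simp only [mul_assoc], hε.mul_self]
      noncomm_ring
    change IsCompactOperator (F * (S * T) - ε * (S * T) * ε * F : H →L[ℂ] H)
    rw [e]
    exact h1.add h2
  add_mem' := fun {S T} hS hT => by
    have e : F * (S + T) - ε * (S + T) * ε * F
        = (F * S - ε * S * ε * F) + (F * T - ε * T * ε * F) := by noncomm_ring
    change IsCompactOperator (F * (S + T) - ε * (S + T) * ε * F : H →L[ℂ] H)
    rw [e]
    exact hS.add hT
  algebraMap_mem' := fun z => by
    have e : F * algebraMap ℂ _ z - ε * algebraMap ℂ _ z * ε * F = 0 := by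
      rw [← Algebra.commutes z ε, mul_assoc (algebraMap ℂ _ z), hε.mul_self, mul_one,
        Algebra.commutes, sub_self]
    change IsCompactOperator (F * algebraMap ℂ _ z - ε * algebraMap ℂ _ z * ε * F : H →L[ℂ] H)
    rw [e]
    exact isCompactOperator_zero

theorem isClosed_compactCommutant (hε : IsGrading ε D) (F : H →L[ℂ] H) :
    IsClosed (compactCommutant hε F : Set (H →L[ℂ] H)) := by
  have h1 : IsClosed {K : H →L[ℂ] H | IsCompactOperator K} := isClosed_setOfPred_isCompactOperator
  exact h1.preimage (by fun_prop : Continuous fun T : H →L[ℂ] H => F * T - ε * T * ε * F)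

theorem IsGradedCommutator.conj (hε : IsGrading ε D) {T X : H →L[ℂ] H}
    (h : IsGradedCommutator D ε T X) : IsGradedCommutator D ε (ε * T * ε) (-(ε * X * ε)) := by
  refine isGradedCommutator_iff.mpr fun x y hxy => ?_
  have h1 := hε.graph (isGradedCommutator_iff.mp h _ _ (hε.graph hxy))
  simp only [mul_apply_eq_comp, map_neg, map_add, neg_add, neg_neg, hε.apply_apply, neg_apply]
    at h1 ⊢
  exact h1

/-- Bounded graded commutators with `D` give compact graded commutators with the bounded transform. -/
theorem mem_compactCommutant (hε : IsGrading ε D) (hD : IsSelfAdjoint D)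
    (hc : IsCompactOperator (regInv D)) {T X : H →L[ℂ] H} (h : IsGradedCommutator D ε T X) :
    T ∈ compactCommutant hε (boundedTransform D) := by
  set F := boundedTransform D with hF
  set T' := ε * T * ε with hT'
  have h' := h.conj hε
  have hTT : ε * T' * ε = T := by
    rw [hT', show ε * (ε * T * ε) * ε = (ε * ε) * T * (ε * ε) by simp only [mul_assoc],
      hε.mul_self, one_mul, mul_one]
  -- For the even operator `T + T'` the graded commutator is the ordinary one.
  have c1 : IsCommutator D (T + T') (X - ε * X * ε) := by
    refine isCommutator_iff.mpr fun x y hxy => ?_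
    have h1 := graph_add (isGradedCommutator_iff.mp h _ _ hxy)
      (isGradedCommutator_iff.mp h' _ _ hxy)
    rw [← hT', hTT] at h1
    convert h1 using 1
    simp only [add_apply, sub_apply, neg_apply]
    congr 1
    abel
  -- For the odd operator `T - T'` the graded commutator is an anticommutator; multiplying by `ε`,
  -- which anticommutes with `D`, makes it an ordinary commutator.
  have c2 : IsCommutator D (ε * (T - T')) (-(ε * (X + ε * X * ε))) := by
    refine isCommutator_iff.mpr fun x y hxy => ?_
    have h1 := hε.graph (graph_sub (isGradedCommutator_iff.mp h _ _ hxy)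
      (isGradedCommutator_iff.mp h' _ _ hxy))
    rw [← hT', hTT] at h1
    convert h1 using 1
    simp only [mul_apply_eq_comp, add_apply, sub_apply, neg_apply, map_add, map_sub, map_neg]
    congr 1
    abel
  have k1 := isCompactOperator_boundedTransform_commutator hD hc c1
  have k2 := isCompactOperator_boundedTransform_commutator hD hc c2
  rw [← hF] at k1 k2
  have hεF : ε * F = -(F * ε) := hε.boundedTransform_anticomm hD
  have e1 : ε * (F * (ε * (T - T')) - ε * (T - T') * F) = -(F * (T - T') + (T - T') * F) := by
    have e2 : ε * (F * (ε * (T - T'))) = -(F * (T - T')) := by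
      rw [← mul_assoc, hεF, neg_mul, mul_assoc, ← mul_assoc ε, hε.mul_self, one_mul]
    have e3 : ε * (ε * (T - T') * F) = (T - T') * F := by
      rw [mul_assoc, ← mul_assoc, hε.mul_self, one_mul]
    rw [mul_sub, e2, e3, neg_add, sub_eq_add_neg]
  have k3 : IsCompactOperator (ε * (F * (ε * (T - T')) - ε * (T - T') * F) : H →L[ℂ] H) :=
    k2.clm_comp ε
  have k4 := (k1.sub k3).smul (1 / 2 : ℂ)
  have e : F * T - T' * F = (1 / 2 : ℂ) • ((F * (T + T') - (T + T') * F)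
      - ε * (F * (ε * (T - T')) - ε * (T - T') * F)) := by
    rw [e1, show (F * (T + T') - (T + T') * F) - -(F * (T - T') + (T - T') * F)
      = (2 : ℂ) • (F * T - T' * F) by rw [two_smul]; noncomm_ring, smul_smul]
    norm_num
  change IsCompactOperator (F * T - T' * F : H →L[ℂ] H)
  rw [e]
  exact k4

end Compact

/-! ### Density in closures and in the maximal tensor product -/

section Density

variable {U : Type*} [CStarAlgebra U]

theorem continuous_starAlgHom {V : Type*} [CStarAlgebra V] (f : U →⋆ₐ[ℂ] V) : Continuous f :=
  AddMonoidHomClass.continuous_of_bound f 1 fun y => by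
    simpa using NonUnitalStarAlgHom.norm_apply_le f y

theorem Closure.denseRange_incl (S : StarSubalgebra ℂ U) : DenseRange (Closure.incl S) := by
  intro x
  refine Metric.mem_closure_iff.mpr fun e he => ?_
  have hx : (Closure.val S x) ∈ closure (S : Set U) := x.2
  obtain ⟨s, hs, hd⟩ := Metric.mem_closure_iff.mp hx e he
  exact ⟨Closure.incl S ⟨s, hs⟩, ⟨⟨s, hs⟩, rfl⟩, hd⟩

theorem Closure.induction {S : StarSubalgebra ℂ U} {P : Closure S → Prop}
    (hP : IsClosed {x | P x}) (h : ∀ s, P (Closure.incl S s)) (x : Closure S) : P x :=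
  (Closure.denseRange_incl S).induction_on x hP h

variable {A B : Type u} [CStarAlgebra A] [CStarAlgebra B]

/-- The ranges of the two factors are closed under the involution and contain the scalars, so sums,
products and limits suffice. -/
theorem MaxTensor.induction {P : MaxTensor A B → Prop} (hP : IsClosed {x | P x})
    (hl : ∀ a, P (inl a)) (hr : ∀ b, P (inr b)) (hadd : ∀ x y, P x → P y → P (x + y))
    (hmul : ∀ x y, P x → P y → P (x * y)) (x : MaxTensor A B) : P x := by
  refine Closure.induction hP ?_ x
  rintro ⟨s, hs⟩
  have hs' : s ∈ Algebra.adjoin ℂ (Set.range (univLeft : A →⋆ₐ[ℂ] RepProduct A B)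
      ∪ Set.range (univRight : B →⋆ₐ[ℂ] RepProduct A B)
      ∪ star (Set.range (univLeft : A →⋆ₐ[ℂ] RepProduct A B)
      ∪ Set.range (univRight : B →⋆ₐ[ℂ] RepProduct A B))) := hs
  suffices h : ∀ (h' : s ∈ algTensor A B), P (Closure.incl _ ⟨s, h'⟩) from h hs
  induction hs' using Algebra.adjoin_induction with
  | mem y hy =>
    intro h'
    rcases hy with (⟨a, rfl⟩ | ⟨b, rfl⟩) | (⟨a, ha⟩ | ⟨b, hb⟩)
    · exact hl a
    · exact hr b
    · have : y = univLeft (star a) := by rw [map_star, ha, star_star]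
      subst this
      exact hl (star a)
    · have : y = univRight (star b) := by rw [map_star, hb, star_star]
      subst this
      exact hr (star b)
  | algebraMap r =>
    intro h'
    have h1 : Closure.incl (algTensor A B) ⟨algebraMap ℂ _ r, h'⟩
        = inl (B := B) (algebraMap ℂ A r) := by
      rw [AlgHomClass.commutes]; rfl
    rw [h1]
    exact hl _
  | add y z hy hz ihy ihz =>
    intro h'
    exact hadd _ _ (ihy hy hy) (ihz hz hz)
  | mul y z hy hz ihy ihz =>
    intro h'
    exact hmul _ _ (ihy hy hy) (ihz hz hz)

/-- The representation of the maximal tensor product attached to a commuting pair of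
representations. -/
def CommutingRep.integrated (r : CommutingRep A B) : MaxTensor A B →⋆ₐ[ℂ] (r.K →L[ℂ] r.K) :=
  StarAlgHom.comp
    -- Evaluation at the coordinate `r` of the universal product.
    { toFun := fun x : RepProduct A B => x.1 r
      map_one' := rfl
      map_mul' := fun _ _ => rfl
      map_zero' := rfl
      map_add' := fun _ _ => rfl
      commutes' := fun _ => rfl
      map_star' := fun _ => rfl } (Closure.val (algTensor A B))

end Density

/-! ### The Kasparov module -/

section Kasparov

variable {H : Type u} [NormedAddCommGroup H] [InnerProductSpace ℂ H] [CompleteSpace H]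

/-- A graded representation of a C*-algebra in the compact commutant of the bounded transform of an
odd operator with compact resolvent is a Kasparov module. -/
theorem isKasparovModule_boundedTransform {D : H →ₗ.[ℂ] H} {ε : H →L[ℂ] H} (hε : IsGrading ε D)
    (hD : IsSelfAdjoint D) (hc : IsCompactOperator (regInv D)) {X : Type*} [CStarAlgebra X]
    {γ : X →⋆ₐ[ℂ] X} {π : X →⋆ₐ[ℂ] (H →L[ℂ] H)} (hγ : ∀ x, ε * π x * ε = π (γ x))
    (hπ : ∀ x, π x ∈ compactCommutant hε (boundedTransform D)) :
    IsKasparovModule γ ℂ H ε (π : X →ₙₐ[ℂ] (H →L[ℂ] H)) (boundedTransform D) where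
  countably_generated := by
    have := separableSpace_of_compact_resolvent hD hc
    have : Nonempty H := ⟨0⟩
    refine ⟨_, Set.countable_range (TopologicalSpace.denseSeq H), ?_⟩
    refine (TopologicalSpace.denseRange_denseSeq H).mono ?_
    rintro _ ⟨n, rfl⟩
    exact Submodule.subset_span ⟨1, _, ⟨n, rfl⟩, (one_smul ℂ _).symm⟩
  grading_sq := hε.mul_self
  grading_adj e f := isSelfAdjoint_apply hε.star_eq e f
  rep_adj x e f := by
    change inner ℂ (π x e) f = inner ℂ e (π (star x) f)
    rw [map_star, ContinuousLinearMap.star_eq_adjoint, ContinuousLinearMap.adjoint_inner_right]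
  rep_graded := hγ
  odd := hε.boundedTransform_anticomm hD
  comm_compact x := by
    change boundedTransform D * π x - π (γ x) * boundedTransform D ∈ _
    rw [← hγ]
    exact mem_compactOps (hπ x)
  sq_compact x := by
    refine mem_compactOps ?_
    have e : boundedTransform D * boundedTransform D - 1 = -(regInv D * regInv D) := by
      rw [← boundedTransform_sq hD]; abel
    rw [e]
    have h1 : IsCompactOperator (regInv D * regInv D : H →L[ℂ] H) := hc.comp_clm _
    exact h1.neg.comp_clm (π x)
  adj_compact := ⟨boundedTransform D,
    fun e f => isSelfAdjoint_apply (boundedTransform_isSelfAdjoint hD) e f, fun x => by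
      rw [sub_self, zero_mul]
      exact mem_compactOps isCompactOperator_zero⟩

end Kasparov

/-! ### The Kasparov module and its class -/

namespace NCRiemannianManifold

variable {H : Type u} [NormedAddCommGroup H] [InnerProductSpace ℂ H] [CompleteSpace H]
  {ω : DixmierLimit} {p : ℕ} (M : NCRiemannianManifold ω p H)

section Right

variable (J : H ≃ₗᵢ⋆[ℂ] H) (hJ : ∀ x, J (J x) = x)
  (hJi : ∀ x y, inner ℂ (J x) (J y) = inner ℂ y x)

/-- The commuting pair of representations of the closures of `A` and `C_D(A)^op`. -/
def commutingRep (hJC : ∀ u ∈ M.C, J (u M.Φ) = (star u) M.Φ) : CommutingRep M.Abar (M.Cbar)ᵐᵒᵖ where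
  K := H
  -- `‖Φ‖ = 1` shows that the space is nonzero.
  nontriv := ⟨M.Φ, 0, fun h => by
    have := M.norm_Φ
    rw [h, norm_zero] at this
    exact zero_ne_one this⟩
  left := Closure.val M.A
  right := (twistedRightHom M.grading J hJ hJi).comp (opHom (Closure.val M.C))
  comm a b := by
    set R := (twistedRightHom M.grading J hJ hJi).comp (opHom (Closure.val M.C))
    have hR : Continuous R := continuous_starAlgHom R
    have hL : Continuous (Closure.val M.A) := continuous_starAlgHom _
    obtain ⟨b, rfl⟩ := MulOpposite.op_surjective b
    have hRop : Continuous fun b => R (MulOpposite.op b) := hR.comp MulOpposite.continuous_op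
    refine Closure.induction (P := fun a => Closure.val M.A a * R (MulOpposite.op b)
      = R (MulOpposite.op b) * Closure.val M.A a) (isClosed_eq (by fun_prop) (by fun_prop))
      (fun a => ?_) a
    refine Closure.induction (P := fun b => Closure.val M.A (Closure.incl M.A a)
      * R (MulOpposite.op b) = R (MulOpposite.op b) * Closure.val M.A (Closure.incl M.A a))
      (isClosed_eq (by fun_prop) (by fun_prop)) (fun b => ?_) b
    exact M.commute_twistedRightHom hJC (M.A_le_C a.2) (M.grading_A _ a.2) b.2

/-- The action of the maximal tensor product of the closures of `A` and `C_D(A)^op`. -/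
def kasparovRep (hJC : ∀ u ∈ M.C, J (u M.Φ) = (star u) M.Φ) :
    MaxTensor M.Abar (M.Cbar)ᵐᵒᵖ →⋆ₐ[ℂ] (H →L[ℂ] H) :=
  (M.commutingRep J hJ hJi hJC).integrated

variable {J hJ hJi}

theorem maxTensor_induction {P : MaxTensor M.Abar (M.Cbar)ᵐᵒᵖ → Prop} (hP : IsClosed {x | P x})
    (hl : ∀ a, P (inl (Closure.incl M.A a)))
    (hr : ∀ b, P (inr (opHom (Closure.incl M.C) b)))
    (hadd : ∀ x y, P x → P y → P (x + y)) (hmul : ∀ x y, P x → P y → P (x * y))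
    (x : MaxTensor M.Abar (M.Cbar)ᵐᵒᵖ) : P x := by
  refine MaxTensor.induction hP (fun a => ?_) (fun b => ?_) hadd hmul x
  · have h1 : Continuous (inl : M.Abar →⋆ₐ[ℂ] MaxTensor M.Abar (M.Cbar)ᵐᵒᵖ) :=
      continuous_starAlgHom _
    exact Closure.induction (P := fun a => P (inl a)) (hP.preimage h1) hl a
  · obtain ⟨b, rfl⟩ := MulOpposite.op_surjective b
    have h1 : Continuous (inr : (M.Cbar)ᵐᵒᵖ →⋆ₐ[ℂ] MaxTensor M.Abar (M.Cbar)ᵐᵒᵖ) :=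
      continuous_starAlgHom _
    exact Closure.induction (P := fun b => P (inr (MulOpposite.op b)))
      (hP.preimage (h1.comp MulOpposite.continuous_op)) (fun b => hr (MulOpposite.op b)) b

/-- Compatibility with the gradings and compactness of graded commutators are both closed
conditions, stable under sums and products, so they need checking only on `𝒜` and `C_D(𝒜)^op`, where
the commutators with `D` are bounded. -/
theorem isKasparovModule (hJC : ∀ u ∈ M.C, J (u M.Φ) = (star u) M.Φ)
    (hJε : ∀ x, J (M.ε x) = M.ε (J x)) :
    IsKasparovModule (MaxTensor.grade (opHom M.gradeCbar)) ℂ H M.ε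
      (M.kasparovRep J hJ hJi hJC : MaxTensor M.Abar (M.Cbar)ᵐᵒᵖ →ₙₐ[ℂ] (H →L[ℂ] H))
      (boundedTransform M.D) := by
  set π := M.kasparovRep J hJ hJi hJC
  have hπ : Continuous π := continuous_starAlgHom π
  have hγ : Continuous (MaxTensor.grade (A := M.Abar) (opHom M.gradeCbar)) :=
    continuous_starAlgHom _
  refine isKasparovModule_boundedTransform M.grading M.selfAdjoint M.compact (π := π)
    (fun x => ?_) (fun x => ?_)
  · refine M.maxTensor_induction (P := fun x => M.ε * π x * M.ε
      = π (MaxTensor.grade (opHom M.gradeCbar) x)) (isClosed_eq (by fun_prop) (hπ.comp hγ))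
      (fun a => ?_) (fun b => ?_) (fun x y hx hy => ?_) (fun x y hx hy => ?_) x
    · change M.ε * (a : H →L[ℂ] H) * M.ε = a
      rw [M.grading_A _ a.2, mul_assoc, M.grading.mul_self, mul_one]
    · exact conj_twistedRightHom M.grading hJε _
    · rw [map_add, map_add, map_add, ← hx, ← hy, mul_add, add_mul]
    · rw [map_mul, map_mul, map_mul, ← hx, ← hy]
      exact map_mul (conjHom M.grading) (π x) (π y)
  · refine M.maxTensor_induction
      (P := fun x => π x ∈ compactCommutant M.grading (boundedTransform M.D))
      ((isClosed_compactCommutant M.grading _).preimage hπ)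
      (fun a => ?_) (fun b => ?_) (fun x y hx hy => ?_) (fun x y hx hy => ?_) x
    · obtain ⟨X, hX⟩ := M.bounded_comm _ a.2
      refine mem_compactCommutant (X := X) M.grading M.selfAdjoint M.compact
        (isGradedCommutator_iff.mpr ?_)
      have e : M.ε * (a : H →L[ℂ] H) * M.ε = a := by
        rw [M.grading_A _ a.2, mul_assoc, M.grading.mul_self, mul_one]
      change ∀ x y, _ → ((a : H →L[ℂ] H) x, (M.ε * (a : H →L[ℂ] H) * M.ε) y + X x) ∈ _
      rw [e]
      exact isCommutator_iff.mp hX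
    · obtain ⟨X, hX⟩ := M.exists_isGradedCommutator (hJ := hJ) (hJi := hJi) hJC hJε b.unop.2
      exact mem_compactCommutant M.grading M.selfAdjoint M.compact hX
    · rw [map_add]; exact add_mem hx hy
    · rw [map_mul]; exact mul_mem hx hy

theorem existsUnique_isClassOf (hJC : ∀ u ∈ M.C, J (u M.Φ) = (star u) M.Φ)
    (hJε : ∀ x, J (M.ε x) = M.ε (J x)) :
    ∃! lam : KK.{u} (MaxTensor M.Abar (M.Cbar)ᵐᵒᵖ) (MaxTensor.grade (opHom M.gradeCbar)),
      IsClassOf (opHom M.gradeCbar) (Closure.incl M.A) (opHom (Closure.incl M.C))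
        M.A.subtype (M.rightCliffordRep J hJ hJi) M.D M.ε lam := by
  set π := M.kasparovRep J hJ hJi hJC
  have hk := M.isKasparovModule (hJ := hJ) (hJi := hJi) hJC hJε
  refine ⟨_, ⟨(π : MaxTensor M.Abar (M.Cbar)ᵐᵒᵖ →ₙₐ[ℂ] (H →L[ℂ] H)), fun a => rfl,
    fun b => rfl, hk, rfl⟩, ?_⟩
  rintro _ ⟨π', hl, hr, hk', rfl⟩
  have hπ' : π' = (π : MaxTensor M.Abar (M.Cbar)ᵐᵒᵖ →ₙₐ[ℂ] (H →L[ℂ] H)) := by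
    -- A competing `π'` is only assumed to be an algebra homomorphism; the adjointness clause of a
    -- Kasparov module makes it a `*`-homomorphism, hence contractive and determined by its values
    -- on the dense generators.
    have hstar : ∀ x, π' (star x) = star (π' x) := fun x => by
      ext e
      refine ext_inner_right ℂ fun f => ?_
      rw [ContinuousLinearMap.star_eq_adjoint, ContinuousLinearMap.adjoint_inner_left]
      have h1 : inner ℂ (π' (star x) e) f = inner ℂ e (π' (star (star x)) f) :=
        hk'.rep_adj (star x) e f
      rwa [star_star] at h1
    let σ : MaxTensor M.Abar (M.Cbar)ᵐᵒᵖ →⋆ₙₐ[ℂ] (H →L[ℂ] H) := { π' with map_star' := hstar }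
    have hσ : Continuous π' := AddMonoidHomClass.continuous_of_bound π' 1 fun y => by
      rw [one_mul]; exact NonUnitalStarAlgHom.norm_apply_le σ y
    have hπ : Continuous π := continuous_starAlgHom π
    ext1 x
    change π' x = π x
    refine M.maxTensor_induction (P := fun x => π' x = π x) (isClosed_eq hσ hπ)
      (fun a => hl a) (fun b => hr b) (fun x y hx hy => ?_) (fun x y hx hy => ?_) x
    · rw [map_add, map_add, hx, hy]
    · rw [map_mul, map_mul, hx, hy]
  subst hπ'
  rfl

end Right

end NCRiemannianManifold

end NCRiem

/-! ### The fundamental class -/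

theorem mainTheorem3 {H : Type u} [NormedAddCommGroup H] [InnerProductSpace ℂ H] [CompleteSpace H]
    (ω : NCRiem.DixmierLimit) (p : ℕ) (M : NCRiem.NCRiemannianManifold ω p H) :
    ∃ J : H ≃ₗᵢ⋆[ℂ] H,
      -- the Tomita conjugation of the vector `Φ`
      (∀ T ∈ Set.centralizer (Set.centralizer (M.C : Set (H →L[ℂ] H))),
        J (T M.Φ) = (star T) M.Φ) ∧
      ∃ (β : (M.A)ᵐᵒᵖ →⋆ₐ[ℂ] (H →L[ℂ] H)) (α : (M.C)ᵐᵒᵖ →⋆ₐ[ℂ] (H →L[ℂ] H)),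
        -- the right action of `A` and the right Clifford action
        (∀ a : M.A, β (MulOpposite.op a) = NCRiem.rightOp J a) ∧
        (∀ (a : H →L[ℂ] H) (ha : a ∈ M.A),
          α (MulOpposite.op ⟨a, M.A_le_C ha⟩) = NCRiem.rightOp J a ∧
          NCRiem.IsCommutator (NCRiem.twistedDirac J M.D M.ε) (NCRiem.rightOp J a)
            (α (MulOpposite.op ⟨NCRiem.comm M.D a, M.comm_mem_C ha⟩))) ∧
        α.range = NCRiem.cliffordAlg β.range (NCRiem.twistedDirac J M.D M.ε) ∧
        (∀ w, ‖α w‖ = ‖w‖) ∧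
        -- `(A ⊗ C_D(A)^op, H, D)` is a graded spectral triple with the first order condition,
        -- and `(A ⊗ A^op, H, D)` is even
        NCRiem.IsGradedSpectralTriple M.A.subtype α (NCRiem.opHom M.gradeAlg) M.D M.ε ∧
        NCRiem.FirstOrder M.A.subtype α (NCRiem.opHom M.gradeAlg) M.D ∧
        NCRiem.IsGradedSpectralTriple M.A.subtype β id M.D M.ε ∧
        -- the class in `KK(A ⊗ C^op, ℂ)`
        ∃! lam : NCRiem.KK.{u} (NCRiem.MaxTensor M.Abar (M.Cbar)ᵐᵒᵖ)
            (NCRiem.MaxTensor.grade (NCRiem.opHom M.gradeCbar)),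
          NCRiem.IsClassOf (NCRiem.opHom M.gradeCbar)
            (NCRiem.Closure.incl M.A)
            (NCRiem.opHom (NCRiem.Closure.incl M.C))
            M.A.subtype α M.D M.ε lam := by
  obtain ⟨J, hJC, hJ, hJi, hJε⟩ := M.exists_tomita
  refine ⟨J, fun T hT => NCRiem.conjugation_bicommutant M.dense_orbit hJC hJ hJi hT,
    M.rightRep J hJ hJi, M.rightCliffordRep J hJ hJi, fun a => rfl, fun a ha => ⟨?_, ?_⟩,
    M.range_rightCliffordRep J hJ hJi hJε, M.norm_rightCliffordRep J hJ hJi, ?_, ?_, ?_, ?_⟩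
  · exact M.twistedRightHom_of_mem_A hJε ha
  · exact M.isCommutator_twistedDirac hJε ha (M.isCommutator_comm ha)
  · refine M.isGradedSpectralTriple_right J hJ hJi hJC hJε _ _
      (fun v w h => ?_) (fun w => NCRiem.conj_twistedRightHom M.grading hJε _)
      fun w => ⟨w.unop, w.unop.2, rfl⟩
    have h1 := NCRiem.twistedRightHom_injective M.grading h
    exact MulOpposite.unop_injective (Subtype.ext (MulOpposite.op_injective h1))
  · intro a w
    rw [sub_eq_zero]
    exact M.isCommutator_mul_twistedRightHom hJC hJε a.2 (M.isCommutator_comm a.2) w.unop.2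
  -- Elements of `A` are even, so the twist by `U` does not affect them and the grading on `A^op` is
  -- trivial.
  · refine M.isGradedSpectralTriple_right J hJ hJi hJC hJε _ _
      (fun a b h => ?_) (fun a => ?_)
      fun a => ⟨a.unop, M.A_le_C a.unop.2, M.rightRep_eq J hJ hJi hJε a⟩
    · rw [M.rightRep_eq J hJ hJi hJε, M.rightRep_eq J hJ hJi hJε] at h
      have h1 := NCRiem.twistedRightHom_injective M.grading h
      exact MulOpposite.unop_injective (Subtype.ext (MulOpposite.op_injective h1))
    · rw [id, M.rightRep_eq J hJ hJi hJε, NCRiem.conj_twistedRightHom M.grading hJε,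
        M.grading_A _ a.unop.2, mul_assoc, M.grading.mul_self, mul_one]
  · exact M.existsUnique_isClassOf hJC hJε
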